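/- **Setting: substitution tilings.** Let $d\ge 1$. A tile substitution consists of a finite non-empty set $\mathcal V$ of prototiles $p_v\subset\mathbb R^d$ ($v\in\mathcal V$; compact, equal to the closure of their interior, with a puncture at the origin, which lies in the interior; different labels may carry the same set), an inflation factor $\lambda>1$, and for each $v$ a finite set $\omega(v)$ of translated prototiles with pairwise disjoint interiors and union $\lambda p_v$. It extends to sets of tiles by inflating and subdividing each tile. Let $\Omega$ be the set of tilings of $\mathbb R^d$ all of whose finite patches occur, up to translation, in some $\omega^n(v)$, and let the canonical transversal $\Xi\subset\Omega$ be the set of the tilings with the puncture of a tile at $0$. The metric of $\Xi$ is $\rho(T,T')=\inf\{(1+r)^{-1}: r\ge 0,\ T \text{ and } T' \text{ have the same tiles meeting } B(0,r)\}$, with $B(0,r)$ the open ball. Assume that the substitution is primitive, has finite local complexity, is aperiodic (no $T\in\Omega$ has a non-zero period) and forces its border (for some $n$ the tiles of $\omega^n(T)$ that meet the $n$-th inflation of a tile of $T$, $T\in\Omega$, depend up to translation only on the type of that tile). **Bratteli diagram.** The Bratteli diagram of the substitution is the stationary diagram with a root $\circ$, vertex set $\mathcal V$ at each later level, one edge from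 the root to each vertex of the first level, and then, between consecutive levels, one edge from $v$ to $v'$ for each occurrence of a tile of type $v$ in $\omega(v')$. Let $A$ be its adjacency matrix ($A_{vv'}$ is the number of edges from $v$ to $v'$), $\Lambda$ the Perron–Frobenius eigenvalue of $A$, and $\nu$ the positive eigenvector, $A\nu=\Lambda\nu$, $\sum_v\nu_v=1$. Let $\Pi$ be the set of finite paths from the root (the trivial path $\circ$ included) and $\Pi_\infty$ the space of infinite paths, with the topology generated by the cylinders $[\gamma]$, $\gamma\in\Pi$. Write $r(\gamma)$ for the end vertex of $\gamma$. Put $w(\circ)=1$ and $w(\gamma)=\nu_{r(\gamma)}^{1/d}\Lambda^{-n/d}$ for $\gamma=(e_0,\dots,e_n)$; this is the diameter assigned to $[\gamma]$. **Laplacians.** On $\ell^2(\Pi)\otimes\mathbb C^2$ let $D=\bigoplus_\gamma w(\gamma)^{-1}\begin{pmatrix}0&1\\1&0\end{pmatrix}$. A choice function $\tau$ assigns to each $\gamma\in\Pi$ a pair $\tau(\gamma)=(x_\gamma,y_\gamma)$ of points of $[\gamma]$, whose longest common prefix $x_\gamma\wedge y_\gamma$ is $\gamma$ if $\gamma$ has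 at least two one-edge extensions; put $\pi_\tau(f)=\bigoplus_\gamma\mathrm{diag}(f(x_\gamma),f(y_\gamma))$. Let $s_0$ be the abscissa of convergence of $\sum_\gamma w(\gamma)^t$, and let $\mu$ be the Dixmier trace measure, that is, the Borel probability measure on $\Pi_\infty$ with $\int f\,d\mu=\lim_{t\downarrow s_0}\mathrm{Tr}(|D|^{-t}\pi_\tau(f))/\mathrm{Tr}(|D|^{-t})$ for all continuous $f$ and all $\tau$. For $s\in\mathbb R$ let $\Delta_s$ be the non-negative self-adjoint operator on $L^2(\Pi_\infty,\mu)$ associated with the Dirichlet form $$\mathcal D_s(f,g)=\tfrac12\int \mathrm{Tr}\bigl(|D|^{-s}[D,\pi_\tau(f)]^*[D,\pi_\tau(g)]\bigr)\,d\kappa(\tau),$$ where under the product measure $\kappa$ the pair $\tau(\gamma)$ has the law $\mu\otimes\mu$ conditioned on $\{(x,y): x\wedge y=\gamma\}$, and a $\gamma$ with only one extension contributes $0$. The $\omega$-spectrum of $\Delta_s$ is $\mathrm{Sp}_\omega(\Delta_s)=\bigcap_n\overline{S_n}\subset\mathbb R$, where $S_n$ is the set of the eigenvalues of $\Delta_s$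 that have an eigenvector orthogonal to all functions constant on each cylinder of depth $n$ (the eigenvalues, listed with multiplicity, that remain after those of depth less than $n$ are removed). **Statement.** Suppose that all edges of the Bratteli diagram are simple (there is at most one edge from a vertex to another) and that the coordinates $\nu_v$, $v\in\mathcal V$, are pairwise distinct. Then there is $s_1\in\mathbb R$ such that for every $s>s_1$ there is a bi-Hölder homeomorphism $\varphi:\Xi\to\mathrm{Sp}_\omega(\Delta_s)$: there are $\theta,c,C>0$ with $$c\,\rho(T,T')^\theta\le|\varphi(T)-\varphi(T')|\le C\,\rho(T,T')^\theta\qquad(T,T'\in\Xi).$$ -/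

import Mathlib

open Filter Topology MeasureTheory
open scoped Matrix ENNReal

noncomputable section

/-! ### Stationary Bratteli diagrams -/

/-- A stationary Bratteli diagram: vertices `V` and edges `E` at each level, with source and range
maps. There is a root `∘`, joined by exactly one edge to each vertex of the first level. -/
structure StationaryBratteli (V E : Type*) where
  src : E → V
  tgt : E → V

namespace StationaryBratteli

variable {V E : Type*}

/-- The adjacency matrix: `A v v'` is the number of edges from `v` to `v'`. -/
def adjacency (B : StationaryBratteli V E) : Matrix V V ℝ :=
  fun v v' => (Nat.card {e : E // B.src e = v ∧ B.tgt e = v'} : ℝ)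

/-- All edges are simple: there is at most one edge from a vertex to another. -/
def SimpleEdges (B : StationaryBratteli V E) : Prop :=
  ∀ e f : E, B.src e = B.src f → B.tgt e = B.tgt f → e = f

/-- `Λ` is the Perron-Frobenius eigenvalue of `A` and `ν` the Perron-Frobenius eigenvector, that is,
the positive eigenvector whose coordinates add up to `1`. -/
def IsPerronFrobenius [Fintype V] (A : Matrix V V ℝ) (Λ : ℝ) (ν : V → ℝ) : Prop :=
  (∀ v, 0 < ν v) ∧ ∑ v, ν v = 1 ∧ A *ᵥ ν = Λ • ν

open Classical in
/-- The Perron-Frobenius eigenvalue and normalized eigenvector of the adjacency matrix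
(unique when that matrix is primitive; the value `0` is a default that is not attained then). -/
def pfPair [Fintype V] (B : StationaryBratteli V E) : ℝ × (V → ℝ) :=
  if h : ∃ p : ℝ × (V → ℝ), IsPerronFrobenius B.adjacency p.1 p.2 then h.choose else 0

/-- The Perron-Frobenius eigenvalue. -/
def pfEigenvalue [Fintype V] (B : StationaryBratteli V E) : ℝ := B.pfPair.1

/-- The normalized Perron-Frobenius eigenvector. -/
def pfVector [Fintype V] (B : StationaryBratteli V E) : V → ℝ := B.pfPair.2

/-! ### Infinite and finite paths -/

/-- An infinite path `(e₀, e₁, e₂, …)` from the root. The edge `e₀` is recorded by its range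
`start`, and `e_{n+1}` is `edge n`. -/
structure InfPath (B : StationaryBratteli V E) where
  start : V
  edge : ℕ → E
  src_zero : B.src (edge 0) = start
  tgt_eq_src : ∀ n, B.tgt (edge n) = B.src (edge (n + 1))

/-- `l` is a list of composable edges starting at the vertex `v`. -/
def IsChainFrom (B : StationaryBratteli V E) : V → List E → Prop
  | _, [] => True
  | v, e :: l => B.src e = v ∧ IsChainFrom B (B.tgt e) l

/-- The vertex at which a list of composable edges starting at `v` ends. -/
def endpoint (B : StationaryBratteli V E) : V → List E → V
  | v, [] => v
  | _, e :: l => endpoint B (B.tgt e) l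

/-- Finite paths from the root: the trivial path `root` (the root itself), and
`path v [e₁, …, eₙ]`, which stands for `(e₀, e₁, …, eₙ)` with `e₀` the edge from the root to `v`. -/
inductive FinPath (B : StationaryBratteli V E) where
  | root : FinPath B
  | path (v : V) (l : List E) (h : B.IsChainFrom v l) : FinPath B

/-- The number of edges of a finite path, the edge at the root included. -/
def FinPath.depth {B : StationaryBratteli V E} : FinPath B → ℕ
  | .root => 0
  | .path _ l _ => l.length + 1

/-- The cylinder `[γ]`: the infinite paths that have `γ` as a prefix. -/
def cylinder (B : StationaryBratteli V E) : FinPath B → Set (InfPath B)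
  | .root => Set.univ
  | .path v l _ => {x | x.start = v ∧ (List.range l.length).map x.edge = l}

/-- The pairs `(x, y)` of infinite paths whose longest common prefix `x ∧ y` is `γ`. -/
def pairs (B : StationaryBratteli V E) : FinPath B → Set (InfPath B × InfPath B)
  | .root => {p | p.1.start ≠ p.2.start}
  | .path v l h => {p | p.1 ∈ B.cylinder (.path v l h) ∧ p.2 ∈ B.cylinder (.path v l h) ∧
      p.1.edge l.length ≠ p.2.edge l.length}

/-- The topology of the space of infinite paths is generated by the cylinders. -/
instance (B : StationaryBratteli V E) : TopologicalSpace (InfPath B) :=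
  TopologicalSpace.generateFrom (Set.range B.cylinder)

instance (B : StationaryBratteli V E) : MeasurableSpace (InfPath B) := borel _

instance (B : StationaryBratteli V E) : BorelSpace (InfPath B) := ⟨rfl⟩

/-- The weight of a finite path, that is, the diameter of its cylinder:
`w(γ) = ν_{r(γ)}^{1/d} αⁿ` with `α = Λ^{-1/d}`, for `γ = (e₀, …, eₙ)`. The root has weight `1`. -/
def weight [Fintype V] (B : StationaryBratteli V E) (d : ℕ) : FinPath B → ℝ
  | .root => 1
  | .path v l _ => B.pfVector (B.endpoint v l) ^ (1 / (d : ℝ)) *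
      (B.pfEigenvalue ^ (-(1 / (d : ℝ)))) ^ l.length

/-! ### The spectral triple, the Dixmier trace measure, and the Laplacians

The Hilbert space is `ℓ²(Π) ⊗ ℂ²`, with `Π` the set of finite paths, so that the operators below are
direct sums over `Π` of `2 × 2` blocks. -/

variable [Fintype V]

/-- The abscissa of convergence `s₀` of the zeta function `∑_γ w(γ)^t`. -/
def abscissa (B : StationaryBratteli V E) (d : ℕ) : ℝ :=
  sInf {t : ℝ | Summable fun γ : FinPath B => B.weight d γ ^ t}

/-- The block at `γ` of the Dirac operator `D`. -/
def diracBlock (B : StationaryBratteli V E) (d : ℕ) (γ : FinPath B) : Matrix (Fin 2) (Fin 2) ℂ :=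
  (((B.weight d γ)⁻¹ : ℝ) : ℂ) • !![0, 1; 1, 0]

/-- The block at `γ` of `|D|^{-t}`; here `|D|` acts as the scalar `w(γ)⁻¹` since the matrix in `D`
is a symmetry. -/
def absDiracBlock (B : StationaryBratteli V E) (d : ℕ) (t : ℝ) (γ : FinPath B) :
    Matrix (Fin 2) (Fin 2) ℂ :=
  ((B.weight d γ ^ t : ℝ) : ℂ) • 1

/-- The block of the representation `π_τ(f)` at a finite path to which the choice function `τ`
assigns the pair `p = (x, y)`: the diagonal matrix with entries `f x` and `f y`. -/
def repBlock {B : StationaryBratteli V E} (f : InfPath B → ℂ) (p : InfPath B × InfPath B) :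
    Matrix (Fin 2) (Fin 2) ℂ :=
  Matrix.diagonal ![f p.1, f p.2]

/-- A choice function assigns to each finite path `γ` a pair of points of `[γ]`, with longest common
prefix `γ` as soon as there is such a pair (that is, when `γ` has at least two extensions). -/
def IsChoice (B : StationaryBratteli V E) (τ : FinPath B → InfPath B × InfPath B) : Prop :=
  ∀ γ, (τ γ).1 ∈ B.cylinder γ ∧ (τ γ).2 ∈ B.cylinder γ ∧ ((B.pairs γ).Nonempty → τ γ ∈ B.pairs γ)

/-- The Dixmier trace measure of the spectral triple: the probability measure with
`∫ f dμ = lim_{t ↓ s₀} Tr(|D|^{-t} π_τ(f)) / Tr(|D|^{-t})` for all continuous `f` and all `τ`. -/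
def IsDixmierMeasure (B : StationaryBratteli V E) (d : ℕ) (μ : Measure (InfPath B)) : Prop :=
  IsProbabilityMeasure μ ∧
    ∀ τ : FinPath B → InfPath B × InfPath B, B.IsChoice τ → ∀ f : C(InfPath B, ℂ),
      Tendsto (fun t : ℝ => (∑' γ, (B.absDiracBlock d t γ * repBlock f (τ γ)).trace) /
          ∑' γ, (B.absDiracBlock d t γ).trace)
        (𝓝[>] (B.abscissa d)) (𝓝 (∫ x, f x ∂μ))

open Classical in
/-- The Dixmier trace measure (the measure `0` if the limits above do not define one). -/
def dixmierMeasure (B : StationaryBratteli V E) (d : ℕ) : Measure (InfPath B) :=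
  if h : ∃ μ, B.IsDixmierMeasure d μ then h.choose else 0

/-- The Hilbert space `L²(Π_∞, μ)`. -/
abbrev L2 (B : StationaryBratteli V E) (d : ℕ) : Type _ := Lp ℂ 2 (B.dixmierMeasure d)

/-- The contribution of `γ` to the Dirichlet form
`𝒟_s(f, g) = ½ ∫ Tr(|D|^{-s} [D, π_τ(f)]* [D, π_τ(g)]) dκ(τ)`.
Here `κ` is the product measure on choices, under which `τ(γ)` has the law `μ ⊗ μ` conditioned on
`{(x, y) | x ∧ y = γ}`. A path with only one extension contributes `0`. -/
def energyTerm (B : StationaryBratteli V E) (d : ℕ) (s : ℝ) (f g : InfPath B → ℂ)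
    (γ : FinPath B) : ℂ :=
  ∫ p, (1 / 2 : ℂ) * (B.absDiracBlock d s γ *
      (B.diracBlock d γ * repBlock f p - repBlock f p * B.diracBlock d γ)ᴴ *
      (B.diracBlock d γ * repBlock g p - repBlock g p * B.diracBlock d γ)).trace
    ∂(ProbabilityTheory.cond ((B.dixmierMeasure d).prod (B.dixmierMeasure d)) (B.pairs γ))

/-- The Dirichlet form `𝒟_s`. -/
def dirichletForm (B : StationaryBratteli V E) (d : ℕ) (s : ℝ) (f g : B.L2 d) : ℂ :=
  ∑' γ, B.energyTerm d s f g γ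

/-- The domain of `𝒟_s`: the square integrable functions of finite energy. For `s > s₀ + 2` the form
is bounded and this is all of `L²`. -/
def formDomain (B : StationaryBratteli V E) (d : ℕ) (s : ℝ) : Set (B.L2 d) :=
  {f | Summable fun γ => B.energyTerm d s f f γ}

/-- The graph of the Laplacian `Δ_s`, the non-negative self-adjoint operator with
`⟨h, Δ_s f⟩ = 𝒟_s(h, f)` for all `h` in the form domain. -/
def laplacianGraph (B : StationaryBratteli V E) (d : ℕ) (s : ℝ) : Set (B.L2 d × B.L2 d) :=
  {q | q.1 ∈ B.formDomain d s ∧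
    ∀ h ∈ B.formDomain d s, B.dirichletForm d s h q.1 = inner ℂ h q.2}

/-- The eigenvalues of `Δ_s` that remain after those of `Δ_s|_{Π_n}` (counted with multiplicity)
have been removed: the eigenvalues of the restriction of `Δ_s` to the orthogonal complement of the
finite-dimensional invariant space of the functions that are constant on each cylinder of
depth `n`. -/
def tailEigenvalues (B : StationaryBratteli V E) (d : ℕ) (s : ℝ) (n : ℕ) : Set ℝ :=
  {c | ∃ f : B.L2 d, f ≠ 0 ∧ (f, (c : ℂ) • f) ∈ B.laplacianGraph d s ∧
    ∀ γ : FinPath B, γ.depth = n → ∫ x in B.cylinder γ, f x ∂(B.dixmierMeasure d) = 0}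

/-- The `ω`-spectrum of `Δ_s`: the limit points, as the depth goes to infinity, of the
eigenvalues. -/
def omegaSpectrum (B : StationaryBratteli V E) (d : ℕ) (s : ℝ) : Set ℝ :=
  ⋂ n : ℕ, closure (B.tailEigenvalues d s n)

end StationaryBratteli

/-! ### Substitution tilings of `ℝᵈ` -/

/-- A substitution on finitely many (labelled) prototiles of `ℝᵈ`, with inflation factor `lam`. The
puncture of each prototile is at the origin. A tile is a pair `(i, x)`: the translate by `x` of the
prototile `i`. -/
structure TileSubstitution (d : ℕ) (ι : Type*) where
  supp : ι → Set (EuclideanSpace ℝ (Fin d))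
  isCompact_supp : ∀ i, IsCompact (supp i)
  closure_interior_supp : ∀ i, closure (interior (supp i)) = supp i
  zero_mem_interior : ∀ i, (0 : EuclideanSpace ℝ (Fin d)) ∈ interior (supp i)
  lam : ℝ
  one_lt_lam : 1 < lam
  sub : ι → Finset (ι × EuclideanSpace ℝ (Fin d))
  /-- the tiles of the substitution of `i` cover the inflated prototile `i` -/
  sub_cover : ∀ i, (⋃ t ∈ sub i, {p | p - t.2 ∈ supp t.1}) = (fun p => lam • p) '' supp i
  /-- and have pairwise disjoint interiors -/
  sub_disjoint : ∀ i, ∀ t ∈ sub i, ∀ t' ∈ sub i, t ≠ t' →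
    Disjoint (interior {p | p - t.2 ∈ supp t.1}) (interior {p | p - t'.2 ∈ supp t'.1})

namespace TileSubstitution

variable {d : ℕ} {ι : Type*}

/-- The set covered by a tile. -/
def tileSupp (σ : TileSubstitution d ι) (t : ι × EuclideanSpace ℝ (Fin d)) :
    Set (EuclideanSpace ℝ (Fin d)) :=
  {p | p - t.2 ∈ σ.supp t.1}

/-- The translate of a set of tiles. -/
def translate (v : EuclideanSpace ℝ (Fin d)) (T : Set (ι × EuclideanSpace ℝ (Fin d))) :
    Set (ι × EuclideanSpace ℝ (Fin d)) :=
  (fun t => (t.1, t.2 + v)) '' T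

/-- The substitution map `ω`: inflate each tile and subdivide it. -/
def subst (σ : TileSubstitution d ι) (T : Set (ι × EuclideanSpace ℝ (Fin d))) :
    Set (ι × EuclideanSpace ℝ (Fin d)) :=
  {t | ∃ p ∈ T, ∃ q ∈ σ.sub p.1, t = (q.1, σ.lam • p.2 + q.2)}

/-- A tiling: tiles that cover the whole space and have pairwise disjoint interiors. -/
def IsTiling (σ : TileSubstitution d ι) (T : Set (ι × EuclideanSpace ℝ (Fin d))) : Prop :=
  (⋃ t ∈ T, σ.tileSupp t) = Set.univ ∧
    ∀ t ∈ T, ∀ t' ∈ T, t ≠ t' → Disjoint (interior (σ.tileSupp t)) (interior (σ.tileSupp t'))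

/-- The tiling space `Ω`: the tilings all of whose finite patches occur, up to translation, in some
iterated substitution of a prototile. -/
def tilingSpace (σ : TileSubstitution d ι) : Set (Set (ι × EuclideanSpace ℝ (Fin d))) :=
  {T | σ.IsTiling T ∧ ∀ P : Finset (ι × EuclideanSpace ℝ (Fin d)), (P : Set _) ⊆ T →
    ∃ (i : ι) (n : ℕ) (v : EuclideanSpace ℝ (Fin d)),
      (P : Set _) ⊆ translate v (σ.subst^[n] {(i, 0)})}

/-- The tiles of `T` that meet the set `K`. -/
def meeting (σ : TileSubstitution d ι) (T : Set (ι × EuclideanSpace ℝ (Fin d)))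
    (K : Set (EuclideanSpace ℝ (Fin d))) : Set (ι × EuclideanSpace ℝ (Fin d)) :=
  {t ∈ T | (σ.tileSupp t ∩ K).Nonempty}

/-- The canonical transversal `Ξ`: the tilings of `Ω` with the puncture of a tile at the origin. -/
structure Transversal (σ : TileSubstitution d ι) where
  tiling : Set (ι × EuclideanSpace ℝ (Fin d))
  mem_tilingSpace : tiling ∈ σ.tilingSpace
  puncture : ∃ i, (i, (0 : EuclideanSpace ℝ (Fin d))) ∈ tiling

/-- Finite local complexity: for each radius, there are finitely many patches of that radius around
the puncture of a tile, up to translation. -/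
def FiniteLocalComplexity (σ : TileSubstitution d ι) : Prop :=
  ∀ r : ℝ, (Set.range fun T : σ.Transversal => σ.meeting T.tiling (Metric.ball 0 r)).Finite

/-- No tiling of `Ω` has a non-zero period. -/
def Aperiodic (σ : TileSubstitution d ι) : Prop :=
  ∀ T ∈ σ.tilingSpace, ∀ v : EuclideanSpace ℝ (Fin d), translate v T = T → v = 0

/-- The substitution forces its border: for some `n`, the tiles of `ωⁿ(T)` that meet the `n`-th
inflation of a tile of `T` depend, up to translation, only on the type of that tile. -/
def ForcesBorder (σ : TileSubstitution d ι) : Prop :=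
  ∃ n : ℕ, ∀ i : ι, ∀ T ∈ σ.tilingSpace, ∀ T' ∈ σ.tilingSpace,
    (i, (0 : EuclideanSpace ℝ (Fin d))) ∈ T → (i, (0 : EuclideanSpace ℝ (Fin d))) ∈ T' →
      σ.meeting (σ.subst^[n] T) ((fun p => σ.lam ^ n • p) '' σ.supp i) =
        σ.meeting (σ.subst^[n] T') ((fun p => σ.lam ^ n • p) '' σ.supp i)

/-- The Bratteli diagram of the substitution. Its vertices are the prototiles, and there is one edge
from `j` to `i` for each occurrence of a tile of type `j` in the substitution of `i`. -/
def bratteli (σ : TileSubstitution d ι) :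
    StationaryBratteli ι (Σ i : ι, {t : ι × EuclideanSpace ℝ (Fin d) // t ∈ σ.sub i}) where
  src e := e.2.1.1
  tgt e := e.1

open Classical in
/-- The substitution is primitive: some power of its matrix has positive entries. -/
def Primitive [Fintype ι] (σ : TileSubstitution d ι) : Prop :=
  σ.bratteli.adjacency.IsPrimitive

/-! ### The metric of the transversal -/

/-- The distance of two tilings of the transversal is the infimum of the `1 / (1 + r)` over the
`r ≥ 0` such that they have the same tiles meeting the open ball of radius `r` at the origin. -/
def transversalDist (σ : TileSubstitution d ι) (T T' : σ.Transversal) : ℝ :=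
  sInf {c | ∃ r : ℝ, 0 ≤ r ∧ c = (1 + r)⁻¹ ∧
    σ.meeting T.tiling (Metric.ball 0 r) = σ.meeting T'.tiling (Metric.ball 0 r)}

theorem transversalDist_bddBelow (σ : TileSubstitution d ι) (T T' : σ.Transversal) :
    BddBelow {c | ∃ r : ℝ, 0 ≤ r ∧ c = (1 + r)⁻¹ ∧
      σ.meeting T.tiling (Metric.ball 0 r) = σ.meeting T'.tiling (Metric.ball 0 r)} := by
  refine ⟨0, ?_⟩
  rintro c ⟨r, hr, rfl, -⟩
  positivity

theorem transversalDist_nonempty (σ : TileSubstitution d ι) (T T' : σ.Transversal) :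
    {c | ∃ r : ℝ, 0 ≤ r ∧ c = (1 + r)⁻¹ ∧
      σ.meeting T.tiling (Metric.ball 0 r) = σ.meeting T'.tiling (Metric.ball 0 r)}.Nonempty :=
  ⟨1, 0, le_rfl, by simp, by simp [meeting]⟩

theorem meeting_ball_mono (σ : TileSubstitution d ι) {T T' : Set (ι × EuclideanSpace ℝ (Fin d))}
    {r r' : ℝ} (h : r ≤ r')
    (hT : σ.meeting T (Metric.ball 0 r') = σ.meeting T' (Metric.ball 0 r')) :
    σ.meeting T (Metric.ball 0 r) = σ.meeting T' (Metric.ball 0 r) := by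
  have key : ∀ S : Set (ι × EuclideanSpace ℝ (Fin d)),
      σ.meeting S (Metric.ball 0 r) =
        σ.meeting (σ.meeting S (Metric.ball 0 r')) (Metric.ball 0 r) := by
    intro S
    ext t
    constructor
    · rintro ⟨h1, h2⟩
      exact ⟨⟨h1, h2.mono (Set.inter_subset_inter_right _ (Metric.ball_subset_ball h))⟩, h2⟩
    · rintro ⟨⟨h1, -⟩, h2⟩
      exact ⟨h1, h2⟩
  rw [key T, key T', hT]

theorem subset_of_transversalDist (σ : TileSubstitution d ι) {T T' : σ.Transversal}
    (h : σ.transversalDist T T' = 0) : T.tiling ⊆ T'.tiling := by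
  intro t ht
  have hpos : (0 : ℝ) < (1 + (‖t.2‖ + 1))⁻¹ := by positivity
  obtain ⟨c, ⟨r, hr, rfl, hag⟩, hc⟩ :=
    exists_lt_of_csInf_lt (σ.transversalDist_nonempty T T') (h.trans_lt hpos)
  have hr' : ‖t.2‖ + 1 < r := by
    have := (inv_lt_inv₀ (by positivity) (by positivity)).1 hc
    linarith
  have hmem : t ∈ σ.meeting T.tiling (Metric.ball 0 r) := by
    refine ⟨ht, t.2, ?_, ?_⟩
    · simpa [tileSupp] using interior_subset (σ.zero_mem_interior t.1)
    · simp only [Metric.mem_ball, dist_zero_right]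
      linarith
  rw [hag] at hmem
  exact hmem.1

instance (σ : TileSubstitution d ι) : MetricSpace σ.Transversal where
  dist := σ.transversalDist
  dist_self T := by
    refine le_antisymm (le_of_forall_pos_le_add fun ε hε => ?_) ?_
    · refine (csInf_le (σ.transversalDist_bddBelow T T)
        ⟨ε⁻¹, (inv_pos.2 hε).le, rfl, rfl⟩).trans ?_
      rw [zero_add, inv_le_comm₀ (by positivity) hε]
      linarith
    · exact le_csInf (σ.transversalDist_nonempty T T)
        (by rintro c ⟨r, hr, rfl, -⟩; positivity)
  dist_comm T T' := by
    simp only [transversalDist, eq_comm]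
  dist_triangle T T' T'' := by
    have hb : ∀ S S' : σ.Transversal, 0 ≤ σ.transversalDist S S' := fun S S' =>
      le_csInf (σ.transversalDist_nonempty S S')
        (by rintro c ⟨r, hr, rfl, -⟩; positivity)
    change σ.transversalDist T T'' ≤ σ.transversalDist T T' + σ.transversalDist T' T''
    rw [← sub_le_iff_le_add]
    refine le_csInf (σ.transversalDist_nonempty T T') ?_
    rintro c ⟨r, hr, rfl, h⟩
    rw [sub_le_comm]
    refine le_csInf (σ.transversalDist_nonempty T' T'') ?_
    rintro c ⟨r', hr', rfl, h'⟩
    rw [sub_le_iff_le_add]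
    rcases le_total r r' with hrr | hrr
    · refine (csInf_le (σ.transversalDist_bddBelow T T'')
        ⟨r, hr, rfl, h.trans (σ.meeting_ball_mono hrr h')⟩).trans ?_
      have : 0 ≤ (1 + r')⁻¹ := by positivity
      linarith
    · refine (csInf_le (σ.transversalDist_bddBelow T T'')
        ⟨r', hr', rfl, (σ.meeting_ball_mono hrr h).trans h'⟩).trans ?_
      have : 0 ≤ (1 + r)⁻¹ := by positivity
      linarith
  eq_of_dist_eq_zero {T T'} h := by
    have h1 : T.tiling ⊆ T'.tiling := σ.subset_of_transversalDist h
    have h2 : T'.tiling ⊆ T.tiling := by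
      refine σ.subset_of_transversalDist (T := T') (T' := T) ?_
      rw [← h]
      simp only [transversalDist, eq_comm]
    cases T
    cases T'
    congr
    exact h1.antisymm h2

end TileSubstitution

/-- A bi-Hölder homeomorphism: a homeomorphism for which the distance of the images is bounded above
and below by constant multiples of one and the same positive power of the distance. -/
def IsBiHolder {X Y : Type*} [MetricSpace X] [MetricSpace Y] (φ : X ≃ₜ Y) : Prop :=
  ∃ θ c C : ℝ, 0 < θ ∧ 0 < c ∧ 0 < C ∧
    ∀ x y, c * dist x y ^ θ ≤ dist (φ x) (φ y) ∧ dist (φ x) (φ y) ≤ C * dist x y ^ θ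

end

noncomputable section

/-! ### Finite and infinite paths, prefixes -/

namespace StationaryBratteli

variable {V E : Type*} {B : StationaryBratteli V E}

/-! Both sides are compared with the path space: two tilings, or two points of the spectrum, are at
a distance controlled by the depth `n` at which the corresponding paths split.

Tilings. By aperiodicity the substitution is injective on the tiling space (`subst_injOn`). The tile
at the origin therefore has a well-defined sequence of supertiles, which is the Robinson path
`UniqueComposition.path`. By compactness, a ball of radius of order `λ^n` determines the first `n`
edges (`exists_radius_edge_eq`); by border forcing, the first `n` edges determine a ball of radius
of order `λ^n` (`exists_agree_of_pre_eq`). So the path map is a bijection and the distance of two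
tilings is comparable to `λ^(-n)`.

Spectrum. The Dixmier trace measure gives the cylinder of `γ` the mass `w(γ)^d`, that is `ν_{r(γ)}`
times a power of `Λ⁻¹` (`dixmierMeasure_spec`). The mean-zero functions on `[γ]` that are constant
on its one-edge extensions are eigenfunctions, and their eigenvalue is a boundary term at `γ` plus a
sum of one `splitTerm` for each proper prefix of `γ`. These eigenfunctions exhaust the spectrum
(`tailEigenvalues_eq`). Write `s = d(a+1)+2`. For `a > 0` the eigenvalues converge geometrically
along each infinite path to the full series `limitEigenval`, and the `ω`-spectrum is the range of
this continuous function on a compact space (`range_limitEigenval`).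

Comparison. For two paths that split at depth `n` the series agree before the term `n`. Simple edges
make the next vertices differ, so that distinct coordinates of `ν` make the two masses at depth `n +
1` differ by a fixed proportion; the terms `n` then differ by at least a constant times `m^a`, with
`m` the common mass. The tails are at most a constant times `(1-c₀)^(a-1) m^a`, which is negligible
for large `a`. Hence the difference is comparable to `Λ^(-an)` (`exists_limitEigenval_bounds`), and
`θ = a log Λ / log λ` matches the two scales. -/

theorem isChainFrom_map_range (B : StationaryBratteli V E) (n : ℕ) :
    ∀ f : ℕ → E, (∀ k, B.tgt (f k) = B.src (f (k + 1))) →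
      B.IsChainFrom (B.src (f 0)) ((List.range n).map f) := by
  induction n with
  | zero => intro f _; simp [IsChainFrom]
  | succ n ih =>
    intro f hf
    rw [List.range_succ_eq_map, List.map_cons, List.map_map]
    refine ⟨rfl, ?_⟩
    rw [hf 0]
    exact ih (f ∘ Nat.succ) fun k => hf (k + 1)

theorem endpoint_map_range (B : StationaryBratteli V E) (n : ℕ) :
    ∀ f : ℕ → E, (∀ k, B.tgt (f k) = B.src (f (k + 1))) →
      B.endpoint (B.src (f 0)) ((List.range n).map f) = B.src (f n) := by
  induction n with
  | zero => intro f _; simp [endpoint]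
  | succ n ih =>
    intro f hf
    rw [List.range_succ_eq_map, List.map_cons, List.map_map]
    change B.endpoint (B.tgt (f 0)) _ = _
    rw [hf 0]
    exact ih (f ∘ Nat.succ) fun k => hf (k + 1)

namespace InfPath

/-- The `n`-th vertex of an infinite path (the root not counted). -/
def vtx (x : InfPath B) (n : ℕ) : V := B.src (x.edge n)

theorem vtx_zero (x : InfPath B) : x.vtx 0 = x.start := x.src_zero

theorem tgt_edge (x : InfPath B) (n : ℕ) : B.tgt (x.edge n) = x.vtx (n + 1) := x.tgt_eq_src n

theorem isChainFrom (x : InfPath B) (n : ℕ) :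
    B.IsChainFrom x.start ((List.range n).map x.edge) := by
  rw [← x.src_zero]
  exact isChainFrom_map_range B n _ x.tgt_eq_src

theorem endpoint (x : InfPath B) (n : ℕ) :
    B.endpoint x.start ((List.range n).map x.edge) = x.vtx n := by
  rw [← x.src_zero]
  exact endpoint_map_range B n _ x.tgt_eq_src

/-- The prefix of depth `n` of an infinite path. -/
def pre (x : InfPath B) : ℕ → FinPath B
  | 0 => .root
  | n + 1 => .path x.start ((List.range n).map x.edge) (x.isChainFrom n)

@[simp] theorem depth_pre (x : InfPath B) (n : ℕ) : (x.pre n).depth = n := by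
  cases n <;> simp [pre, FinPath.depth]

theorem map_range_inj {f g : ℕ → E} {n : ℕ} :
    (List.range n).map f = (List.range n).map g ↔ ∀ k < n, f k = g k := by
  simp [List.map_inj_left]

theorem pre_succ_eq_iff {x y : InfPath B} {n : ℕ} :
    x.pre (n + 1) = y.pre (n + 1) ↔ x.start = y.start ∧ ∀ k < n, x.edge k = y.edge k := by
  simp only [pre, FinPath.path.injEq, map_range_inj]

theorem pre_eq_of_le {x y : InfPath B} {m n : ℕ} (h : m ≤ n) (hxy : x.pre n = y.pre n) :
    x.pre m = y.pre m := by
  cases m with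
  | zero => rfl
  | succ m =>
    obtain ⟨n, rfl⟩ : ∃ k, n = k + 1 := ⟨n - 1, by omega⟩
    rw [pre_succ_eq_iff] at hxy ⊢
    exact ⟨hxy.1, fun k hk => hxy.2 k (by omega)⟩

theorem ext' {x y : InfPath B} (h : ∀ n, x.pre n = y.pre n) : x = y := by
  have h1 : x.start = y.start := (pre_succ_eq_iff.1 (h 1)).1
  have h2 : x.edge = y.edge := funext fun n => (pre_succ_eq_iff.1 (h (n + 2))).2 n (by omega)
  cases x
  cases y
  simp only at h1 h2
  subst h1 h2
  rfl

theorem exists_split {x y : InfPath B} (hxy : x ≠ y) :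
    ∃ n, x.pre n = y.pre n ∧ x.pre (n + 1) ≠ y.pre (n + 1) := by
  classical
  have hex : ∃ n, x.pre n ≠ y.pre n := by
    by_contra! h
    exact hxy (ext' h)
  have hmin := Nat.find_spec hex
  obtain ⟨n, hn⟩ : ∃ n, Nat.find hex = n + 1 := Nat.exists_eq_succ_of_ne_zero fun h0 => by
    rw [h0] at hmin
    exact hmin rfl
  rw [hn] at hmin
  exact ⟨n, not_not.1 (Nat.find_min hex (by omega : n < Nat.find hex)), hmin⟩

end InfPath

open InfPath

theorem mem_cylinder_iff {x : InfPath B} {γ : FinPath B} :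
    x ∈ B.cylinder γ ↔ x.pre γ.depth = γ := by
  cases γ with
  | root => simp [cylinder, FinPath.depth, pre]
  | path v l h =>
    simp only [cylinder, FinPath.depth, pre, FinPath.path.injEq, Set.mem_ofPred_eq]

theorem mem_cylinder_pre {x y : InfPath B} {n : ℕ} :
    x ∈ B.cylinder (y.pre n) ↔ x.pre n = y.pre n := by
  rw [mem_cylinder_iff, depth_pre]

theorem mem_pairs_iff {p : InfPath B × InfPath B} {γ : FinPath B} :
    p ∈ B.pairs γ ↔ p.1.pre γ.depth = γ ∧ p.2.pre γ.depth = γ ∧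
      p.1.pre (γ.depth + 1) ≠ p.2.pre (γ.depth + 1) := by
  cases γ with
  | root => simp [pairs, FinPath.depth, pre]
  | path v l h =>
    rw [← mem_cylinder_iff, ← mem_cylinder_iff]
    simp only [pairs, Set.mem_ofPred_eq]
    refine and_congr_right fun h1 => and_congr_right fun h2 => not_congr ?_
    rw [mem_cylinder_iff] at h1 h2
    have := h1.trans h2.symm
    simp only [FinPath.depth] at this ⊢
    rw [pre_succ_eq_iff] at this ⊢
    refine ⟨fun h3 => ⟨this.1, fun k hk => ?_⟩, fun h3 => h3.2 _ (by omega)⟩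
    rcases Nat.lt_succ_iff_lt_or_eq.1 hk with hk | rfl
    · exact this.2 k hk
    · exact h3

theorem finite_depth [Finite V] [Finite E] (B : StationaryBratteli V E) (n : ℕ) :
    {γ : FinPath B | γ.depth = n}.Finite := by
  have h1 : ((Set.univ : Set V) ×ˢ {l : List E | l.length ≤ n}).Finite :=
    Set.finite_univ.prod (List.finite_length_le E n)
  have h2 : ({FinPath.root} ∪ {γ : FinPath B | ∃ v l h, γ = .path v l h ∧ l.length ≤ n}).Finite := by
    refine (Set.finite_singleton _).union ?_
    have hfin := h1.to_subtype
    refine (Set.finite_range (fun p : {p : V × List E //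
      p ∈ (Set.univ : Set V) ×ˢ {l : List E | l.length ≤ n}} => (open Classical in
        if h : B.IsChainFrom p.1.1 p.1.2 then FinPath.path p.1.1 p.1.2 h
          else (FinPath.root : FinPath B)))).subset ?_
    rintro γ ⟨v, l, h, rfl, hl⟩
    exact ⟨⟨(v, l), ⟨trivial, hl⟩⟩, dif_pos h⟩
  refine h2.subset ?_
  rintro γ hγ
  cases γ with
  | root => exact Or.inl rfl
  | path v l h =>
    refine Or.inr ⟨v, l, h, rfl, ?_⟩
    simp only [FinPath.depth, Set.mem_ofPred_eq] at hγ
    omega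

instance [Finite V] [Finite E] : Countable (FinPath B) := by
  have : (⋃ n, {γ : FinPath B | γ.depth = n}) = Set.univ := by ext; simp
  rw [← Set.countable_univ_iff, ← this]
  exact Set.countable_iUnion fun n => (finite_depth B n).countable

theorem exists_start (hout : ∀ v, ∃ e, B.src e = v) (v : V) : ∃ x : InfPath B, x.start = v := by
  choose f hf using hout
  let g : ℕ → E := fun n => Nat.rec (f v) (fun _ e => f (B.tgt e)) n
  exact ⟨⟨v, g, hf v, fun n => (hf _).symm⟩, rfl⟩

theorem exists_prefix (hout : ∀ v, ∃ e, B.src e = v) (l : List E) :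
    ∀ v, B.IsChainFrom v l → ∃ x : InfPath B, x.start = v ∧ (List.range l.length).map x.edge = l := by
  induction l with
  | nil =>
    intro v _
    obtain ⟨x, hx⟩ := exists_start hout v
    exact ⟨x, hx, by simp⟩
  | cons e l ih =>
    rintro v ⟨h1, h2⟩
    obtain ⟨x, hx, hl⟩ := ih _ h2
    refine ⟨⟨v, fun n => Nat.casesOn n e x.edge, h1, ?_⟩, rfl, ?_⟩
    · rintro (_ | n)
      · exact hx.symm.trans x.src_zero.symm
      · exact x.tgt_eq_src n
    · rw [List.length_cons, List.range_succ_eq_map, List.map_cons, List.map_map]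
      exact congrArg _ hl

theorem exists_pre_eq (hout : ∀ v, ∃ e, B.src e = v) (γ : FinPath B) (hV : Nonempty V) :
    ∃ x : InfPath B, x.pre γ.depth = γ := by
  cases γ with
  | root =>
    obtain ⟨v⟩ := hV
    obtain ⟨x, -⟩ := exists_start hout v
    exact ⟨x, rfl⟩
  | path v l h =>
    obtain ⟨x, hx⟩ := exists_prefix hout l v h
    exact ⟨x, mem_cylinder_iff.1 hx⟩

/-! ### Topology of the path space -/

theorem isOpen_cylinder (γ : FinPath B) : IsOpen (B.cylinder γ) :=
  TopologicalSpace.isOpen_generateFrom_of_mem ⟨γ, rfl⟩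

theorem compl_cylinder (γ : FinPath B) :
    (B.cylinder γ)ᶜ = ⋃ δ ∈ {δ : FinPath B | δ.depth = γ.depth ∧ δ ≠ γ}, B.cylinder δ := by
  ext x
  simp only [Set.mem_compl_iff, Set.mem_iUnion, mem_cylinder_iff, Set.mem_ofPred_eq, exists_prop]
  constructor
  · intro h
    exact ⟨x.pre γ.depth, ⟨by simp, h⟩, by simp⟩
  · rintro ⟨δ, ⟨h1, h2⟩, h3⟩ h4
    rw [h1, h4] at h3
    exact h2 h3.symm

theorem isClopen_cylinder (γ : FinPath B) : IsClopen (B.cylinder γ) := by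
  refine ⟨⟨?_⟩, isOpen_cylinder γ⟩
  rw [compl_cylinder]
  exact isOpen_biUnion fun δ _ => isOpen_cylinder δ

theorem measurableSet_cylinder (γ : FinPath B) : MeasurableSet (B.cylinder γ) :=
  (isOpen_cylinder γ).measurableSet

instance : T2Space (InfPath B) := by
  refine ⟨fun x y hxy => ?_⟩
  obtain ⟨n, hn⟩ : ∃ n, x.pre n ≠ y.pre n := by
    by_contra! h
    exact hxy (InfPath.ext' h)
  refine ⟨B.cylinder (x.pre n), B.cylinder (y.pre n), isOpen_cylinder _, isOpen_cylinder _,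
    mem_cylinder_pre.2 rfl, mem_cylinder_pre.2 rfl, ?_⟩
  rw [Set.disjoint_left]
  intro z h1 h2
  exact hn ((mem_cylinder_pre.1 h1).symm.trans (mem_cylinder_pre.1 h2))

/-- Convergence means that each prefix is eventually constant. All limits of paths below are taken
in this form. -/
theorem nhds_le_iff (x : InfPath B) (F : Filter (InfPath B)) :
    F ≤ 𝓝 x ↔ ∀ n, ∀ᶠ y in F, y.pre n = x.pre n := by
  rw [TopologicalSpace.nhds_generateFrom]
  simp only [le_iInf_iff, le_principal_iff, Set.mem_ofPred_eq, and_imp]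
  constructor
  · intro h n
    filter_upwards [h (B.cylinder (x.pre n)) (mem_cylinder_pre.2 rfl) ⟨_, rfl⟩] with y hy
    exact mem_cylinder_pre.1 hy
  · rintro h s hx ⟨γ, rfl⟩
    filter_upwards [h γ.depth] with y hy
    rw [mem_cylinder_iff] at hx ⊢
    rw [hy, hx]

/-- The pigeonhole principle behind the compactness arguments, for paths and for tilings alike. -/
theorem _root_.Ultrafilter.exists_eventually_eq {α β : Type*} [Finite β] (F : Ultrafilter α)
    (f : α → β) : ∃ b, ∀ᶠ x in F, f x = b := by
  have h : (⋃ b ∈ (Set.univ : Set β), f ⁻¹' {b}) ∈ F := by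
    have : (⋃ b ∈ (Set.univ : Set β), f ⁻¹' {b}) = Set.univ := by ext; simp
    rw [this]
    exact univ_mem (f := (F : Filter α))
  obtain ⟨b, -, hb⟩ := (Ultrafilter.finite_biUnion_mem_iff Set.finite_univ).1 h
  exact ⟨b, hb⟩

instance [Finite V] [Finite E] : CompactSpace (InfPath B) := by
  refine ⟨isCompact_iff_ultrafilter_le_nhds.2 fun F _ => ?_⟩
  -- The limit path takes in each coordinate the value that is constant along `F`. Its edges are
  -- composable because any two consecutive ones occur together in some actual path.
  obtain ⟨v, hv⟩ := F.exists_eventually_eq fun x => x.start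
  choose e he using fun n => F.exists_eventually_eq fun x : InfPath B => x.edge n
  have h0 : B.src (e 0) = v := by
    obtain ⟨x, h1, h2⟩ := (hv.and (he 0)).exists
    rw [← h1, ← h2, x.src_zero]
  have h1 : ∀ n, B.tgt (e n) = B.src (e (n + 1)) := by
    intro n
    obtain ⟨x, h1, h2⟩ := ((he n).and (he (n + 1))).exists
    rw [← h1, ← h2, x.tgt_eq_src]
  refine ⟨⟨v, e, h0, h1⟩, trivial, (nhds_le_iff _ _).2 fun n => ?_⟩
  cases n with
  | zero => exact Eventually.of_forall fun _ => rfl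
  | succ n =>
    have : ∀ᶠ x : InfPath B in F, ∀ k ∈ Finset.range n, x.edge k = e k :=
      (eventually_all_finset _).2 fun k _ => he k
    filter_upwards [hv, this] with x hx1 hx2
    exact pre_succ_eq_iff.2 ⟨hx1, fun k hk => hx2 k (Finset.mem_range.2 hk)⟩

end StationaryBratteli

namespace StationaryBratteli

variable {V E : Type*} {B : StationaryBratteli V E}

open InfPath

/-! ### The mass of a finite path -/

theorem isChainFrom_append_singleton {e : E} (l : List E) :
    ∀ v, B.IsChainFrom v (l ++ [e]) ↔ B.IsChainFrom v l ∧ B.src e = B.endpoint v l := by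
  induction l with
  | nil => intro v; simp [IsChainFrom, endpoint]
  | cons a l ih =>
    intro v
    simp only [List.cons_append, IsChainFrom, endpoint, ih, and_assoc]

theorem endpoint_append_singleton {e : E} (l : List E) :
    ∀ v, B.endpoint v (l ++ [e]) = B.tgt e := by
  induction l with
  | nil => intro v; rfl
  | cons a l ih => intro v; exact ih _

theorem cylinder_subset_or_disjoint {γ δ : FinPath B} (h : γ.depth ≤ δ.depth)
    {x : InfPath B} (hδ : x ∈ B.cylinder δ) (hγ : x ∈ B.cylinder γ) :
    B.cylinder δ ⊆ B.cylinder γ := by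
  intro y hy
  rw [mem_cylinder_iff] at *
  rw [pre_eq_of_le h (hy.trans hδ.symm), hγ]

theorem pairwise_disjoint_cylinder {γ δ : FinPath B} (h : γ.depth = δ.depth) (hne : γ ≠ δ) :
    Disjoint (B.cylinder γ) (B.cylinder δ) := by
  rw [Set.disjoint_left]
  intro x h1 h2
  rw [mem_cylinder_iff] at h1 h2
  exact hne (by rw [← h1, h, h2])

section

variable [Finite V] [Finite E]

/-- The finite paths with `k` more edges than `γ` that extend `γ`. -/
def desc (γ : FinPath B) (k : ℕ) : Finset (FinPath B) :=
  ((finite_depth B (γ.depth + k)).subset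
    (t := {δ : FinPath B | δ.depth = γ.depth + k ∧ B.cylinder δ ⊆ B.cylinder γ}) fun _ h => h.1).toFinset

theorem mem_desc {γ δ : FinPath B} {k : ℕ} :
    δ ∈ desc γ k ↔ δ.depth = γ.depth + k ∧ B.cylinder δ ⊆ B.cylinder γ := by
  simp [desc]

theorem mem_desc_root {δ : FinPath B} {k : ℕ} : δ ∈ desc (.root : FinPath B) k ↔ δ.depth = k := by
  simp [mem_desc, FinPath.depth, cylinder]

theorem pre_mem_desc {x : InfPath B} {γ : FinPath B} (hx : x.pre γ.depth = γ) (k : ℕ) :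
    x.pre (γ.depth + k) ∈ desc γ k := by
  refine mem_desc.2 ⟨by simp, fun y hy => ?_⟩
  rw [mem_cylinder_pre] at hy
  rw [mem_cylinder_iff, pre_eq_of_le (by omega) hy, hx]

open Classical in
theorem desc_succ (hout : ∀ v, ∃ e, B.src e = v) (hV : Nonempty V) (γ : FinPath B) (k : ℕ) :
    desc γ (k + 1) = (desc γ k).biUnion fun η => desc η 1 := by
  ext δ
  simp only [Finset.mem_biUnion]
  constructor
  · intro h
    obtain ⟨x, hx⟩ := exists_pre_eq hout δ hV
    rw [mem_desc] at h
    have hγ : x.pre γ.depth = γ := mem_cylinder_iff.1 (h.2 (mem_cylinder_iff.2 hx))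
    refine ⟨x.pre (γ.depth + k), pre_mem_desc hγ k, ?_⟩
    have := pre_mem_desc (x := x) (γ := x.pre (γ.depth + k)) (by simp) 1
    rwa [depth_pre, add_assoc, ← h.1, hx] at this
  · rintro ⟨η, h1, h2⟩
    rw [mem_desc] at *
    exact ⟨by omega, h2.2.trans h1.2⟩

theorem disjoint_desc (hout : ∀ v, ∃ e, B.src e = v) (hV : Nonempty V) {η η' : FinPath B}
    (h : η.depth = η'.depth) (hne : η ≠ η') (k : ℕ) : Disjoint (desc η k) (desc η' k) := by
  rw [Finset.disjoint_left]
  intro δ h1 h2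
  obtain ⟨x, hx⟩ := exists_pre_eq hout δ hV
  rw [← mem_cylinder_iff] at hx
  exact Set.disjoint_left.1 (pairwise_disjoint_cylinder h hne) ((mem_desc.1 h1).2 hx)
    ((mem_desc.1 h2).2 hx)

theorem mem_desc_path_one {v : V} {l : List E} {h : B.IsChainFrom v l} {δ : FinPath B}
    (hout : ∀ v, ∃ e, B.src e = v) :
    δ ∈ desc (.path v l h) 1 ↔ ∃ (e : E) (he : B.src e = B.endpoint v l),
      δ = .path v (l ++ [e]) ((isChainFrom_append_singleton l v).2 ⟨h, he⟩) := by
  have hsplit : ∀ (x : InfPath B) (n : ℕ), (List.range (n + 1)).map x.edge =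
      (List.range n).map x.edge ++ [x.edge n] := by
    intro x n
    rw [List.range_succ, List.map_append, List.map_singleton]
  constructor
  · intro hδ
    obtain ⟨x, hx⟩ := exists_pre_eq hout δ ⟨v⟩
    rw [mem_desc] at hδ
    have hxγ := hδ.2 (mem_cylinder_iff.2 hx)
    rw [hδ.1] at hx
    simp only [FinPath.depth] at hx
    obtain ⟨rfl, h2⟩ := hxγ
    refine ⟨x.edge l.length, ?_, ?_⟩
    · rw [← h2, x.endpoint]; simp [vtx]
    · rw [← hx]
      simp only [pre, FinPath.path.injEq, true_and]
      rw [hsplit, h2]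
  · rintro ⟨e, he, rfl⟩
    refine mem_desc.2 ⟨by simp [FinPath.depth], ?_⟩
    rintro x ⟨h1, h2⟩
    refine ⟨h1, ?_⟩
    rw [List.length_append, List.length_singleton, hsplit] at h2
    exact (List.append_inj' h2 rfl).1

end

variable [Fintype V]

/-- The mass of the cylinder of a finite path. -/
def mass (B : StationaryBratteli V E) : FinPath B → ℝ
  | .root => 1
  | .path v l _ => B.pfVector (B.endpoint v l) * (B.pfEigenvalue ^ l.length)⁻¹

theorem mass_pre_succ (x : InfPath B) (n : ℕ) :
    B.mass (x.pre (n + 1)) = B.pfVector (x.vtx n) * (B.pfEigenvalue ^ n)⁻¹ := by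
  simp [mass, pre, x.endpoint]

/-- The properties of the Perron-Frobenius data used below. -/
structure PFData (B : StationaryBratteli V E) : Prop where
  spec : IsPerronFrobenius B.adjacency B.pfEigenvalue B.pfVector
  one_lt : 1 < B.pfEigenvalue

namespace PFData

variable (hB : B.PFData)

include hB

theorem pos (v : V) : 0 < B.pfVector v := hB.spec.1 v

theorem eig_pos : 0 < B.pfEigenvalue := one_pos.trans hB.one_lt

theorem le_one (v : V) : B.pfVector v ≤ 1 := by
  rw [← hB.spec.2.1]
  exact Finset.single_le_sum (fun i _ => (hB.pos i).le) (Finset.mem_univ v)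

theorem nonempty : Nonempty V := by
  by_contra h
  rw [not_nonempty_iff] at h
  have := hB.spec.2.1
  simp at this

theorem exists_lower : ∃ c, 0 < c ∧ c ≤ 1 ∧ ∀ v, c ≤ B.pfVector v := by
  have := hB.nonempty
  obtain ⟨v, hv⟩ := Finite.exists_min B.pfVector
  exact ⟨_, hB.pos v, hB.le_one v, hv⟩

/-- The eigenvector equation `Aν = Λν`, with each entry of `A` spread over the edges that it counts.
This is what makes the mass additive. -/
theorem sum_edges [Fintype E] [DecidableEq V] (w : V) :
    ∑ e with B.src e = w, B.pfVector (B.tgt e) = B.pfEigenvalue * B.pfVector w := by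
  have h := congrFun hB.spec.2.2 w
  rw [Pi.smul_apply, smul_eq_mul, Matrix.mulVec, dotProduct] at h
  rw [← h, ← Finset.sum_fiberwise _ B.tgt]
  refine Finset.sum_congr rfl fun v _ => ?_
  rw [Finset.sum_congr rfl (g := fun _ => B.pfVector v), Finset.sum_const, nsmul_eq_mul]
  · congr 2
    rw [Nat.card_eq_fintype_card, Fintype.card_subtype, Finset.filter_filter]
  · intro e he
    rw [(Finset.mem_filter.1 he).2]

/-- An empty sum over the outgoing edges would contradict `Λ ν_v > 0`. Hence no finite path is a
dead end and every cylinder is nonempty. -/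
theorem out [Finite E] (v : V) : ∃ e, B.src e = v := by
  classical
  have := Fintype.ofFinite E
  have h := hB.sum_edges v
  by_contra! hne
  rw [Finset.filter_eq_empty_iff.2 fun e _ => hne e, Finset.sum_empty] at h
  have := mul_pos hB.eig_pos (hB.pos v)
  linarith

theorem mass_pos (γ : FinPath B) : 0 < B.mass γ := by
  cases γ with
  | root => exact one_pos
  | path v l h => exact mul_pos (hB.pos _) (inv_pos.2 (pow_pos hB.eig_pos _))

/-- The extra factor `Λ` compensates for the root edge, which counts in the depth but brings no
factor `Λ⁻¹`. -/
theorem mass_le (γ : FinPath B) :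
    B.mass γ ≤ B.pfEigenvalue * (B.pfEigenvalue ^ γ.depth)⁻¹ := by
  have hpos := hB.eig_pos
  cases γ with
  | root => simpa [mass, FinPath.depth] using hB.one_lt.le
  | path v l h =>
    have : B.pfEigenvalue * (B.pfEigenvalue ^ (l.length + 1))⁻¹ =
        1 * (B.pfEigenvalue ^ l.length)⁻¹ := by
      rw [pow_succ]; field_simp
    simp only [mass, FinPath.depth, this]
    exact mul_le_mul_of_nonneg_right (hB.le_one _) (by positivity)

theorem le_mass {c : ℝ} (hc1 : c ≤ 1) (hc : ∀ v, c ≤ B.pfVector v) (γ : FinPath B) :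
    c * (B.pfEigenvalue ^ γ.depth)⁻¹ ≤ B.mass γ := by
  have hpos := hB.eig_pos
  cases γ with
  | root => simpa [mass, FinPath.depth] using hc1
  | path v l h =>
    simp only [mass, FinPath.depth]
    refine mul_le_mul (hc _) ?_ (by positivity) (hB.pos _).le
    exact inv_anti₀ (by positivity) (pow_le_pow_right₀ hB.one_lt.le (by omega))

/-- The dimension enters only as an exponent, so all estimates can be made on the mass. -/
theorem weight_eq {d : ℕ} (γ : FinPath B) : B.weight d γ = B.mass γ ^ (1 / (d : ℝ)) := by
  have hpos := hB.eig_pos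
  cases γ with
  | root => simp [weight, mass]
  | path v l h =>
    rw [weight, mass, Real.mul_rpow (hB.pos _).le (by positivity), Real.inv_rpow (by positivity),
      ← Real.rpow_natCast, ← Real.rpow_natCast, ← Real.rpow_mul hpos.le, ← Real.rpow_mul hpos.le,
      ← Real.rpow_neg hpos.le]
    congr 2
    ring

/-- Consistency of the masses: at the root it is the normalization of `ν`, elsewhere the eigenvector
equation. -/
theorem sum_desc_one [Finite E] (γ : FinPath B) : ∑ δ ∈ desc γ 1, B.mass δ = B.mass γ := by
  classical
  have := Fintype.ofFinite E
  have hpos := hB.eig_pos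
  cases γ with
  | root =>
    refine (Finset.sum_bij (s := Finset.univ) (f := B.pfVector)
      (fun v _ => FinPath.path v [] trivial) ?_ ?_ ?_ ?_).symm.trans hB.spec.2.1
    · intro v _
      simp [mem_desc_root, FinPath.depth]
    · intro v _ w _ h
      exact (FinPath.path.inj h).1
    · intro δ hδ
      rw [mem_desc_root] at hδ
      cases δ with
      | root => simp [FinPath.depth] at hδ
      | path v l h =>
        simp only [FinPath.depth, Nat.add_eq_right, List.length_eq_zero_iff] at hδ
        subst hδ
        exact ⟨v, Finset.mem_univ _, rfl⟩
    · intro v _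
      simp [mass, endpoint]
  | path v l h =>
    have h1 : ∑ e with B.src e = B.endpoint v l,
        B.pfVector (B.tgt e) * (B.pfEigenvalue ^ (l.length + 1))⁻¹ = B.mass (.path v l h) := by
      rw [← Finset.sum_mul, hB.sum_edges, mass, pow_succ]
      field_simp
    rw [← h1]
    symm
    refine Finset.sum_bij (fun e he => FinPath.path v (l ++ [e])
      ((isChainFrom_append_singleton l v).2 ⟨h, (Finset.mem_filter.1 he).2⟩)) ?_ ?_ ?_ ?_
    · intro e he
      exact (mem_desc_path_one hB.out).2 ⟨e, (Finset.mem_filter.1 he).2, rfl⟩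
    · intro e he e' he' h
      simpa using h
    · intro δ hδ
      obtain ⟨e, he, rfl⟩ := (mem_desc_path_one hB.out).1 hδ
      exact ⟨e, Finset.mem_filter.2 ⟨Finset.mem_univ _, he⟩, rfl⟩
    · intro e he
      simp [mass, endpoint_append_singleton]

theorem sum_desc [Finite E] (γ : FinPath B) (k : ℕ) : ∑ δ ∈ desc γ k, B.mass δ = B.mass γ := by
  classical
  induction k with
  | zero =>
    have : desc γ 0 = {γ} := by
      ext δ
      rw [mem_desc, Finset.mem_singleton, add_zero]
      constructor
      · rintro ⟨h1, h2⟩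
        obtain ⟨x, hx⟩ := exists_pre_eq hB.out δ hB.nonempty
        have := mem_cylinder_iff.1 (h2 (mem_cylinder_iff.2 hx))
        rw [← hx, h1, this]
      · rintro rfl
        exact ⟨rfl, subset_rfl⟩
    rw [this, Finset.sum_singleton]
  | succ k ih =>
    rw [desc_succ hB.out hB.nonempty, Finset.sum_biUnion, Finset.sum_congr rfl fun η _ =>
      hB.sum_desc_one η, ih]
    intro η hη η' hη' hne
    refine disjoint_desc hB.out hB.nonempty ?_ hne 1
    rw [(mem_desc.1 hη).1, (mem_desc.1 hη').1]

end PFData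

end StationaryBratteli

namespace StationaryBratteli

variable {V E : Type*} {B : StationaryBratteli V E}

open InfPath

/-! ### Existence of a measure with prescribed masses of the cylinders -/

section

variable [Fintype V] [Finite E]

/-- Cylinders are nested or disjoint, so one representative `z` of `δ` decides whether `δ` extends
`γ`. -/
theorem mem_desc_iff_of_pre {γ δ : FinPath B} {k : ℕ} {z : InfPath B} (hz : z.pre δ.depth = δ)
    (hδ : δ.depth = γ.depth + k) : δ ∈ desc γ k ↔ z ∈ B.cylinder γ := by
  rw [mem_desc]
  refine ⟨fun h => h.2 (mem_cylinder_iff.2 hz), fun h => ⟨hδ, ?_⟩⟩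
  exact cylinder_subset_or_disjoint (by omega) (mem_cylinder_iff.2 hz) h

open Classical in
theorem sum_root_filter_mem (z : FinPath B → InfPath B) (hz : ∀ γ, (z γ).pre γ.depth = γ)
    (γ : FinPath B) (k : ℕ) (g : FinPath B → ℝ) :
    ∑ δ ∈ desc (.root : FinPath B) (γ.depth + k), (if z δ ∈ B.cylinder γ then g δ else 0) =
      ∑ δ ∈ desc γ k, g δ := by
  rw [← Finset.sum_filter]
  refine Finset.sum_congr ?_ fun _ _ => rfl
  ext δ
  rw [Finset.mem_filter, mem_desc_root]
  constructor
  · rintro ⟨h1, h2⟩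
    exact (mem_desc_iff_of_pre (hz δ) h1).2 h2
  · intro h
    have h1 := (mem_desc.1 h).1
    exact ⟨h1, (mem_desc_iff_of_pre (hz δ) h1).1 h⟩

/-- Point masses in the cylinders of depth `n` give the right mass to all cylinders of smaller
depth, by consistency. A weak limit along an ultrafilter keeps these values, since the indicator
function of a clopen set is continuous. -/
theorem PFData.exists_measure (hB : B.PFData) : ∃ μ : Measure (InfPath B),
    IsProbabilityMeasure μ ∧ ∀ γ, μ.real (B.cylinder γ) = B.mass γ := by
  classical
  choose z hz using fun γ => exists_pre_eq hB.out γ hB.nonempty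
  let m : ℕ → Measure (InfPath B) := fun n =>
    ∑ δ ∈ desc (.root : FinPath B) n, ENNReal.ofReal (B.mass δ) • Measure.dirac (z δ)
  have hm : ∀ (γ : FinPath B) (k : ℕ), m (γ.depth + k) (B.cylinder γ) =
      ENNReal.ofReal (B.mass γ) := by
    intro γ k
    rw [← hB.sum_desc γ k, ← sum_root_filter_mem z hz, ENNReal.ofReal_sum_of_nonneg]
    · simp only [m, Measure.coe_finsetSum, Finset.sum_apply, Measure.smul_apply, smul_eq_mul]
      refine Finset.sum_congr rfl fun δ _ => ?_
      rw [Measure.dirac_apply' _ (measurableSet_cylinder γ)]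
      by_cases h : z δ ∈ B.cylinder γ <;> simp [h]
    · intro δ _
      split_ifs
      exacts [(hB.mass_pos δ).le, le_rfl]
  have hprob : ∀ n, IsProbabilityMeasure (m n) := by
    intro n
    refine ⟨?_⟩
    have := hm .root n
    simpa [FinPath.depth, cylinder, mass] using this
  let P : ℕ → ProbabilityMeasure (InfPath B) := fun n => ⟨m n, hprob n⟩
  obtain ⟨Q, -, hQ⟩ := isCompact_univ.ultrafilter_le_nhds ((hyperfilter ℕ).map P) (by simp)
  have hQ' : Tendsto P (hyperfilter ℕ) (𝓝 Q) := hQ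
  rw [ProbabilityMeasure.tendsto_iff_forall_integral_tendsto] at hQ'
  refine ⟨Q, inferInstance, fun γ => ?_⟩
  have hcont : Continuous ((B.cylinder γ).indicator fun _ => (1 : ℝ)) :=
    (isClopen_cylinder γ).continuous_indicator continuous_const
  have h := hQ' (BoundedContinuousFunction.mkOfCompact ⟨_, hcont⟩)
  simp only [BoundedContinuousFunction.mkOfCompact_apply, ContinuousMap.coe_mk] at h
  have hi : ∀ ν : Measure (InfPath B), ∫ x, (B.cylinder γ).indicator (fun _ => (1 : ℝ)) x ∂ν =
      ν.real (B.cylinder γ) := fun ν => by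
    rw [integral_indicator (measurableSet_cylinder γ)]; simp
  simp only [hi] at h
  refine tendsto_nhds_unique h (tendsto_const_nhds.congr' ?_)
  have hev : ∀ᶠ n in (hyperfilter ℕ : Filter ℕ), γ.depth ≤ n :=
    (Nat.hyperfilter_le_atTop) (eventually_ge_atTop _)
  filter_upwards [hev] with n hn
  obtain ⟨k, rfl⟩ := Nat.exists_eq_add_of_le hn
  rw [measureReal_def]
  change _ = (m (γ.depth + k) (B.cylinder γ)).toReal
  rw [hm, ENNReal.toReal_ofReal (hB.mass_pos γ).le]

/-- Uniform continuity, measured by the length of the common prefix: counterexamples `x n`, `y n`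
with ever longer common prefixes would converge to the same point along an ultrafilter. -/
theorem exists_modulus (f : C(InfPath B, ℂ)) {ε : ℝ} (hε : 0 < ε) :
    ∃ N, ∀ x y : InfPath B, x.pre N = y.pre N → ‖f x - f y‖ ≤ ε := by
  by_contra! h
  choose x y hxy hf using h
  obtain ⟨a, -, ha⟩ := isCompact_univ.ultrafilter_le_nhds ((hyperfilter ℕ).map x) (by simp)
  have hx : Tendsto x (hyperfilter ℕ) (𝓝 a) := ha
  have hy : Tendsto y (hyperfilter ℕ) (𝓝 a) := by
    refine (nhds_le_iff _ _).2 fun n => ?_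
    have h1 := (nhds_le_iff _ _).1 hx n
    rw [eventually_map] at h1 ⊢
    have hev : ∀ᶠ k in (hyperfilter ℕ : Filter ℕ), n ≤ k :=
      (Nat.hyperfilter_le_atTop) (eventually_ge_atTop _)
    filter_upwards [h1, hev] with k h2 h3
    rw [← h2, pre_eq_of_le h3 (hxy k)]
  have h1 : Tendsto (fun n => ‖f (x n) - f (y n)‖) (hyperfilter ℕ) (𝓝 ‖f a - f a‖) :=
    (((f.continuous.tendsto a).comp hx).sub ((f.continuous.tendsto a).comp hy)).norm
  rw [sub_self, norm_zero] at h1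
  exact absurd (ge_of_tendsto' h1 fun n => (hf n).le) (not_le.2 hε)

/-! ### The zeta function -/

/-- Each depth carries finitely many paths, so a nonnegative sum over all paths may be grouped by
depth. -/
theorem summable_of_summable_depth {g : FinPath B → ℝ} (hg : ∀ γ, 0 ≤ g γ) :
    (Summable g ↔ Summable fun n => ∑ γ ∈ desc (.root : FinPath B) n, g γ) ∧
    (Summable g → ∑' γ, g γ = ∑' n, ∑ γ ∈ desc (.root : FinPath B) n, g γ) := by
  let e := Equiv.sigmaFiberEquiv (FinPath.depth : FinPath B → ℕ)
  have hfin : ∀ n, Finite {γ : FinPath B // γ.depth = n} := fun n => (finite_depth B n).to_subtype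
  have hsum : ∀ n, ∑' γ : {γ : FinPath B // γ.depth = n}, g (e ⟨n, γ⟩) =
      ∑ γ ∈ desc (.root : FinPath B) n, g γ := by
    intro n
    have := Fintype.ofFinite {γ : FinPath B // γ.depth = n}
    rw [tsum_fintype]
    exact (Finset.sum_subtype _ (fun γ => mem_desc_root) g).symm
  constructor
  · rw [← e.summable_iff, summable_sigma_of_nonneg (f := g ∘ e) fun _ => hg _]
    simp only [Function.comp_def, hsum]
    exact ⟨fun h => h.2, fun h => ⟨fun n => Summable.of_finite, h⟩⟩
  · intro h
    have h' := e.summable_iff.2 h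
    rw [← e.tsum_eq, Summable.tsum_sigma' (f := fun p => g (e p)) (fun n => Summable.of_finite) h']
    simp only [hsum]

end

namespace PFData

variable [Fintype V] [Finite E] (hB : B.PFData)

include hB

omit [Finite E] in
theorem weight_rpow {d : ℕ} (t : ℝ) (γ : FinPath B) :
    B.weight d γ ^ t = B.mass γ ^ (t / d) := by
  rw [hB.weight_eq, ← Real.rpow_mul (hB.mass_pos γ).le]
  congr 1
  ring

theorem mass_le_one (γ : FinPath B) : B.mass γ ≤ 1 := by
  obtain ⟨μ, hμ, h⟩ := hB.exists_measure
  rw [← h]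
  exact measureReal_le_one

/-- In `mass^(1+ε) = mass · mass^ε` the first factors add up to the mass of `δ` and the second is a
power of `Λ^(-ε)` up to the constants `c^ε` and `Λ^ε`. Both constants tend to `1` as `ε → 0`, which
makes the Dixmier limit exact and not merely bounded. -/
theorem sum_rpow_bounds {c : ℝ} (hc0 : 0 < c) (hc1 : c ≤ 1) (hc : ∀ v, c ≤ B.pfVector v)
    (δ : FinPath B) (k : ℕ) {ε : ℝ} (hε : 0 ≤ ε) :
    B.mass δ * c ^ ε * ((B.pfEigenvalue ^ (-ε)) ^ (δ.depth + k)) ≤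
        ∑ γ ∈ desc δ k, B.mass γ ^ (1 + ε) ∧
      ∑ γ ∈ desc δ k, B.mass γ ^ (1 + ε) ≤
        B.mass δ * B.pfEigenvalue ^ ε * ((B.pfEigenvalue ^ (-ε)) ^ (δ.depth + k)) := by
  have hpos := hB.eig_pos
  have hpow : ∀ n : ℕ, (B.pfEigenvalue ^ (-ε)) ^ n = ((B.pfEigenvalue ^ n)⁻¹) ^ ε := by
    intro n
    rw [← Real.rpow_natCast, ← Real.rpow_mul hpos.le, Real.inv_rpow (by positivity),
      ← Real.rpow_natCast, ← Real.rpow_mul hpos.le, ← Real.rpow_neg hpos.le]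
    congr 1
    ring
  have hsplit : ∀ γ, B.mass γ ^ (1 + ε) = B.mass γ * B.mass γ ^ ε := fun γ => by
    rw [Real.rpow_add (hB.mass_pos γ), Real.rpow_one]
  rw [hpow]
  simp only [hsplit]
  rw [mul_assoc, mul_assoc, ← Real.mul_rpow hc0.le (by positivity),
    ← Real.mul_rpow hpos.le (by positivity), ← hB.sum_desc δ k, Finset.sum_mul, Finset.sum_mul]
  constructor
  · refine Finset.sum_le_sum fun γ hγ => mul_le_mul_of_nonneg_left ?_ (hB.mass_pos γ).le
    refine Real.rpow_le_rpow (by positivity) ?_ hε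
    rw [← (mem_desc.1 hγ).1]
    exact hB.le_mass hc1 hc γ
  · refine Finset.sum_le_sum fun γ hγ => mul_le_mul_of_nonneg_left ?_ (hB.mass_pos γ).le
    refine Real.rpow_le_rpow (hB.mass_pos γ).le ?_ hε
    rw [← (mem_desc.1 hγ).1]
    exact hB.mass_le γ

-- A geometric series over the depths below `δ`. After multiplication by `1 - q`, both bounds tend
-- to the mass of `δ` as `ε → 0`.
open Classical in
theorem subtree_sum (z : FinPath B → InfPath B) (hz : ∀ γ, (z γ).pre γ.depth = γ)
    {c : ℝ} (hc0 : 0 < c) (hc1 : c ≤ 1) (hc : ∀ v, c ≤ B.pfVector v)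
    (δ : FinPath B) {ε : ℝ} (hε : 0 < ε) :
    let g : FinPath B → ℝ := fun γ =>
      if δ.depth ≤ γ.depth ∧ z γ ∈ B.cylinder δ then B.mass γ ^ (1 + ε) else 0
    let q := B.pfEigenvalue ^ (-ε)
    Summable g ∧ B.mass δ * c ^ ε * q ^ δ.depth ≤ (1 - q) * ∑' γ, g γ ∧
      (1 - q) * ∑' γ, g γ ≤ B.mass δ * B.pfEigenvalue ^ ε * q ^ δ.depth := by
  intro g q
  have hpos := hB.eig_pos
  have hq0 : 0 < q := Real.rpow_pos_of_pos hpos _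
  have hq1 : q < 1 := Real.rpow_lt_one_of_one_lt_of_neg hB.one_lt (by linarith)
  have hg : ∀ γ, 0 ≤ g γ := by
    intro γ
    simp only [g]
    split_ifs
    exacts [(Real.rpow_pos_of_pos (hB.mass_pos γ) _).le, le_rfl]
  let b : ℕ → ℝ := fun n => ∑ γ ∈ desc (.root : FinPath B) n, g γ
  have hb0 : ∀ n < δ.depth, b n = 0 := by
    intro n hn
    refine Finset.sum_eq_zero fun γ hγ => if_neg fun h => ?_
    rw [mem_desc_root] at hγ
    omega
  have hb1 : ∀ k, b (k + δ.depth) = ∑ γ ∈ desc δ k, B.mass γ ^ (1 + ε) := by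
    intro k
    rw [← sum_root_filter_mem z hz, add_comm k]
    refine Finset.sum_congr rfl fun γ hγ => ?_
    rw [mem_desc_root] at hγ
    have : δ.depth ≤ γ.depth := by omega
    simp only [g, this, true_and]
  have hbd := fun k => hB.sum_rpow_bounds hc0 hc1 hc δ k hε.le
  have hgeo : HasSum (fun k => q ^ k) (1 - q)⁻¹ := hasSum_geometric_of_lt_one hq0.le hq1
  have hgl : ∀ a : ℝ, HasSum (fun k => a * q ^ (δ.depth + k)) (a * q ^ δ.depth * (1 - q)⁻¹) := by
    intro a
    simpa only [pow_add, mul_assoc] using hgeo.mul_left (a * q ^ δ.depth)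
  have hsb : Summable fun k => b (k + δ.depth) := by
    refine Summable.of_nonneg_of_le (fun k => Finset.sum_nonneg fun γ _ => hg γ) (fun k => ?_)
      (hgl (B.mass δ * B.pfEigenvalue ^ ε)).summable
    rw [hb1]
    exact (hbd k).2
  have hsb' : Summable b := (summable_nat_add_iff _).1 hsb
  obtain ⟨h1, h2⟩ := summable_of_summable_depth hg
  have hsg : Summable g := h1.2 hsb'
  have htg : ∑' γ, g γ = ∑' k, b (k + δ.depth) := by
    rw [h2 hsg, ← hsb'.sum_add_tsum_nat_add δ.depth,
      Finset.sum_eq_zero fun n hn => hb0 n (Finset.mem_range.1 hn), zero_add]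
  have h1q : 0 < 1 - q := by linarith
  refine ⟨hsg, ?_, ?_⟩
  · rw [← div_le_iff₀' h1q, div_eq_mul_inv, htg, ← (hgl _).tsum_eq]
    exact (hgl _).summable.tsum_le_tsum (fun k => by rw [hb1]; exact (hbd k).1) hsb
  · rw [← le_div_iff₀' h1q, div_eq_mul_inv, htg, ← (hgl _).tsum_eq]
    exact hsb.tsum_le_tsum (fun k => by rw [hb1]; exact (hbd k).2) (hgl _).summable

theorem summable_weight_rpow {d : ℕ} (hd : 0 < d) {t : ℝ} (ht : (d : ℝ) < t) :
    Summable fun γ : FinPath B => B.weight d γ ^ t := by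
  classical
  choose z hz using fun γ => exists_pre_eq hB.out γ hB.nonempty
  obtain ⟨c, hc0, hc1, hc⟩ := hB.exists_lower
  have hd' : (0 : ℝ) < d := by exact_mod_cast hd
  have h := (hB.subtree_sum z hz hc0 hc1 hc .root (ε := t / d - 1)
    (by rw [sub_pos, one_lt_div hd']; exact ht)).1
  simpa [FinPath.depth, cylinder, hB.weight_rpow] using h

/-- For `t ≤ d` every depth contributes at least the total mass `1`, because masses are at most `1`;
for `t > d` the sum is dominated by a geometric series. -/
theorem abscissa_eq {d : ℕ} (hd : 0 < d) : B.abscissa d = d := by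
  have hd' : (0 : ℝ) < d := by exact_mod_cast hd
  have : {t : ℝ | Summable fun γ : FinPath B => B.weight d γ ^ t} = Set.Ioi (d : ℝ) := by
    ext t
    refine ⟨fun h => ?_, fun h => hB.summable_weight_rpow hd h⟩
    by_contra hle
    rw [Set.mem_Ioi, not_lt] at hle
    simp only [Set.mem_ofPred_eq, hB.weight_rpow] at h
    have h0 : ∀ γ : FinPath B, 0 ≤ B.mass γ ^ (t / d) := fun γ =>
      (Real.rpow_pos_of_pos (hB.mass_pos γ) _).le
    have h1 := ((summable_of_summable_depth h0).1.1 h).tendsto_atTop_zero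
    have h2 : ∀ n, (1 : ℝ) ≤ ∑ γ ∈ desc (.root : FinPath B) n, B.mass γ ^ (t / d) := by
      intro n
      calc (1 : ℝ) = ∑ γ ∈ desc (.root : FinPath B) n, B.mass γ := (hB.sum_desc .root n).symm
        _ ≤ _ := Finset.sum_le_sum fun γ _ => by
          conv_lhs => rw [← Real.rpow_one (B.mass γ)]
          exact Real.rpow_le_rpow_of_exponent_ge (hB.mass_pos γ) (hB.mass_le_one γ)
            ((div_le_one hd').2 hle)
    linarith [ge_of_tendsto' h1 h2]
  rw [abscissa, this, csInf_Ioi]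

end PFData

end StationaryBratteli

/-! ### The Dixmier trace measure -/

namespace StationaryBratteli

variable {V E : Type*} {B : StationaryBratteli V E}

open InfPath

variable [Fintype V]

theorem trace_absDiracBlock_mul_repBlock (d : ℕ) (t : ℝ) (γ : FinPath B) (f : InfPath B → ℂ)
    (p : InfPath B × InfPath B) :
    (B.absDiracBlock d t γ * repBlock f p).trace =
      ((B.weight d γ ^ t : ℝ) : ℂ) * (f p.1 + f p.2) := by
  simp [absDiracBlock, repBlock, Matrix.trace, Fin.sum_univ_two, mul_add]

theorem trace_absDiracBlock (d : ℕ) (t : ℝ) (γ : FinPath B) :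
    (B.absDiracBlock d t γ).trace = ((2 * B.weight d γ ^ t : ℝ) : ℂ) := by
  simp [absDiracBlock, Matrix.trace, two_mul]

/-- The quotient of traces whose limit at the abscissa is the Dixmier trace of `f`. -/
def traceQuotient (B : StationaryBratteli V E) (d : ℕ) (τ : FinPath B → InfPath B × InfPath B)
    (f : InfPath B → ℂ) (t : ℝ) : ℂ :=
  (∑' γ, ((B.weight d γ ^ t : ℝ) : ℂ) * (f (τ γ).1 + f (τ γ).2)) /
    ((2 * ∑' γ : FinPath B, B.weight d γ ^ t : ℝ) : ℂ)

theorem traceQuotient_eq (d : ℕ) (τ : FinPath B → InfPath B × InfPath B)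
    (f : InfPath B → ℂ) (t : ℝ) :
    (∑' γ, (B.absDiracBlock d t γ * repBlock f (τ γ)).trace) /
      ∑' γ, (B.absDiracBlock d t γ).trace = B.traceQuotient d τ f t := by
  simp only [trace_absDiracBlock_mul_repBlock, trace_absDiracBlock, traceQuotient]
  rw [← Complex.ofReal_tsum, tsum_mul_left]

namespace PFData

variable [Finite E] (hB : B.PFData) {d : ℕ} (hd : 0 < d)

include hB

omit [Finite E] in
theorem weight_rpow_nonneg (t : ℝ) (γ : FinPath B) : 0 ≤ B.weight d γ ^ t := by
  rw [hB.weight_rpow]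
  exact (Real.rpow_pos_of_pos (hB.mass_pos γ) _).le

include hd

theorem tsum_weight_pos {t : ℝ} (ht : (d : ℝ) < t) :
    0 < ∑' γ : FinPath B, B.weight d γ ^ t := by
  refine (hB.summable_weight_rpow hd ht).tsum_pos (fun γ => hB.weight_rpow_nonneg t γ) .root ?_
  simp [weight]

theorem summable_trace {t : ℝ} (ht : (d : ℝ) < t) (τ : FinPath B → InfPath B × InfPath B)
    {f : InfPath B → ℂ} {K : ℝ} (hf : ∀ x, ‖f x‖ ≤ K) :
    Summable fun γ : FinPath B => ((B.weight d γ ^ t : ℝ) : ℂ) * (f (τ γ).1 + f (τ γ).2) := by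
  refine Summable.of_norm_bounded ((hB.summable_weight_rpow hd ht).mul_right (K + K)) fun γ => ?_
  rw [norm_mul, Complex.norm_real, Real.norm_of_nonneg (hB.weight_rpow_nonneg t γ)]
  exact mul_le_mul_of_nonneg_left ((norm_add_le _ _).trans (add_le_add (hf _) (hf _)))
    (hB.weight_rpow_nonneg t γ)

/-- The quotient is a weighted average of values of `f`, so it is `1`-Lipschitz for the supremum
norm. -/
theorem norm_traceQuotient_sub_le {t : ℝ} (ht : (d : ℝ) < t)
    (τ : FinPath B → InfPath B × InfPath B) {f g : InfPath B → ℂ} {K K' ε : ℝ}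
    (hf : ∀ x, ‖f x‖ ≤ K) (hg : ∀ x, ‖g x‖ ≤ K') (hfg : ∀ x, ‖f x - g x‖ ≤ ε) :
    ‖B.traceQuotient d τ f t - B.traceQuotient d τ g t‖ ≤ ε := by
  have hpos := hB.tsum_weight_pos hd ht
  rw [traceQuotient, traceQuotient, ← sub_div, norm_div, Complex.norm_real,
    Real.norm_of_nonneg (by positivity), div_le_iff₀ (by positivity),
    ← (hB.summable_trace hd ht τ hf).tsum_sub (hB.summable_trace hd ht τ hg)]
  have hs := hB.summable_weight_rpow hd ht
  have : ε * (2 * ∑' γ : FinPath B, B.weight d γ ^ t) =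
      ∑' γ : FinPath B, B.weight d γ ^ t * (ε + ε) := by
    rw [tsum_mul_right]; ring
  rw [this]
  refine tsum_of_norm_bounded (hs.mul_right _).hasSum fun γ => ?_
  rw [← mul_sub, norm_mul, Complex.norm_real, Real.norm_of_nonneg (hB.weight_rpow_nonneg t γ)]
  refine mul_le_mul_of_nonneg_left ?_ (hB.weight_rpow_nonneg t γ)
  rw [add_sub_add_comm]
  exact (norm_add_le _ _).trans (add_le_add (hfg _) (hfg _))

theorem traceQuotient_sum {t : ℝ} (ht : (d : ℝ) < t)
    (τ : FinPath B → InfPath B × InfPath B) {κ : Type*} (s : Finset κ) (a : κ → ℂ)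
    (f : κ → InfPath B → ℂ) (hf : ∀ i x, ‖f i x‖ ≤ 1) :
    B.traceQuotient d τ (fun x => ∑ i ∈ s, a i * f i x) t =
      ∑ i ∈ s, a i * B.traceQuotient d τ (f i) t := by
  simp only [traceQuotient, ← mul_div_assoc]
  rw [← Finset.sum_div, Finset.sum_congr rfl fun i _ => tsum_mul_left.symm,
    ← Summable.tsum_finsetSum fun i _ => (hB.summable_trace hd ht τ (hf i)).mul_left (a i)]
  congr 2
  ext γ
  rw [← Finset.sum_add_distrib, Finset.mul_sum]
  exact Finset.sum_congr rfl fun i _ => by ring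

-- The squeeze between the bounds of `subtree_sum`, with `ε = t/d - 1`.
open Classical in
theorem tendsto_subtree_sum (z : FinPath B → InfPath B) (hz : ∀ γ, (z γ).pre γ.depth = γ)
    (δ : FinPath B) :
    Tendsto (fun t : ℝ => (1 - B.pfEigenvalue ^ (-(t / d - 1))) * ∑' γ : FinPath B,
        if δ.depth ≤ γ.depth ∧ z γ ∈ B.cylinder δ then B.weight d γ ^ t else 0)
      (𝓝[>] (d : ℝ)) (𝓝 (B.mass δ)) := by
  obtain ⟨c, hc0, hc1, hc⟩ := hB.exists_lower
  have hd' : (0 : ℝ) < d := by exact_mod_cast hd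
  have hpos := hB.eig_pos
  have hlim : ∀ b : ℝ, 0 < b → Tendsto (fun t : ℝ => B.mass δ * b ^ (t / d - 1) *
      (B.pfEigenvalue ^ (-(t / d - 1))) ^ δ.depth) (𝓝[>] (d : ℝ)) (𝓝 (B.mass δ)) := by
    intro b hb
    have hcont : Continuous fun t : ℝ => B.mass δ * b ^ (t / d - 1) *
        (B.pfEigenvalue ^ (-(t / d - 1))) ^ δ.depth := by
      have h1 : Continuous fun t : ℝ => b ^ (t / d - 1) :=
        Continuous.rpow (by fun_prop) (by fun_prop) fun _ => Or.inl hb.ne'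
      have h2 : Continuous fun t : ℝ => B.pfEigenvalue ^ (-(t / d - 1)) :=
        Continuous.rpow (by fun_prop) (by fun_prop) fun _ => Or.inl hpos.ne'
      fun_prop
    have := hcont.tendsto d
    simp only [div_self hd'.ne', sub_self, neg_zero, Real.rpow_zero, one_pow, mul_one] at this
    exact this.mono_left nhdsWithin_le_nhds
  have hev : ∀ t ∈ Set.Ioi (d : ℝ), 0 < t / d - 1 := fun t ht => by
    rw [sub_pos, one_lt_div hd']; exact ht
  refine tendsto_of_tendsto_of_tendsto_of_le_of_le' (hlim c hc0) (hlim _ hpos) ?_ ?_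
  all_goals
    filter_upwards [self_mem_nhdsWithin] with t ht
    have h := hB.subtree_sum z hz hc0 hc1 hc δ (hev t ht)
    simp only [add_sub_cancel, ← hB.weight_rpow (d := d)] at h
  · exact h.2.1
  · exact h.2.2

/-- The numerator is twice the sum over the extensions of `δ`, up to the bounded contribution of the
finitely many shorter paths. Multiplied by `1 - q t`, numerator and denominator converge to `2 mass
δ` and `2`, and the error vanishes. -/
theorem tendsto_traceQuotient_indicator {τ : FinPath B → InfPath B × InfPath B}
    (hτ : B.IsChoice τ) (δ : FinPath B) :
    Tendsto (B.traceQuotient d τ ((B.cylinder δ).indicator fun _ => 1)) (𝓝[>] (d : ℝ))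
      (𝓝 (B.mass δ : ℂ)) := by
  classical
  have hpos := hB.eig_pos
  have hd' : (0 : ℝ) < d := by exact_mod_cast hd
  let z : FinPath B → InfPath B := fun γ => (τ γ).1
  have hz : ∀ γ, (z γ).pre γ.depth = γ := fun γ => mem_cylinder_iff.1 (hτ γ).1
  let q : ℝ → ℝ := fun t => B.pfEigenvalue ^ (-(t / d - 1))
  let S : FinPath B → ℝ → ℝ := fun δ t => ∑' γ : FinPath B,
    if δ.depth ≤ γ.depth ∧ z γ ∈ B.cylinder δ then B.weight d γ ^ t else 0
  have hS : ∀ δ, Tendsto (fun t => (1 - q t) * S δ t) (𝓝[>] (d : ℝ)) (𝓝 (B.mass δ)) :=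
    fun δ => hB.tendsto_subtree_sum hd z hz δ
  have hS0 : ∀ t, S .root t = ∑' γ : FinPath B, B.weight d γ ^ t := fun t =>
    tsum_congr fun γ => if_pos ⟨Nat.zero_le _, trivial⟩
  have hq : Tendsto q (𝓝[>] (d : ℝ)) (𝓝 1) := by
    have hcont : Continuous q :=
      Continuous.rpow (by fun_prop) (by fun_prop) fun _ => Or.inl hpos.ne'
    have := hcont.tendsto d
    simp only [q, div_self hd'.ne', sub_self, neg_zero, Real.rpow_zero] at this
    exact this.mono_left nhdsWithin_le_nhds
  let f : InfPath B → ℂ := (B.cylinder δ).indicator fun _ => 1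
  have hf : ∀ x, ‖f x‖ ≤ 1 := fun x => by
    simp only [f, Set.indicator]; split_ifs <;> simp
  have hlow : {γ : FinPath B | γ.depth < δ.depth}.Finite :=
    (Set.Finite.biUnion (Set.finite_lt_nat δ.depth) fun n _ => finite_depth B n).subset
      fun γ hγ => Set.mem_biUnion hγ rfl
  let N : ℝ → ℂ := fun t => ∑' γ, ((B.weight d γ ^ t : ℝ) : ℂ) * (f (τ γ).1 + f (τ γ).2)
  have hN : ∀ t ∈ Set.Ioi (d : ℝ), ‖N t - ((2 * S δ t : ℝ) : ℂ)‖ ≤ hlow.toFinset.card * 2 := by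
    intro t ht
    have hs1 := hB.summable_trace hd ht τ hf
    have hs2 : Summable fun γ : FinPath B =>
        if δ.depth ≤ γ.depth ∧ z γ ∈ B.cylinder δ then B.weight d γ ^ t else 0 := by
      refine Summable.of_nonneg_of_le (fun γ => ?_) (fun γ => ?_) (hB.summable_weight_rpow hd ht)
      all_goals
        have := hB.weight_rpow_nonneg (d := d) t γ
        split_ifs
      all_goals first | exact this | exact le_rfl
    have h2 : ((2 * S δ t : ℝ) : ℂ) = ∑' γ : FinPath B, (((2 *
        if δ.depth ≤ γ.depth ∧ z γ ∈ B.cylinder δ then B.weight d γ ^ t else 0 : ℝ) : ℂ)) := by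
      rw [← Complex.ofReal_tsum, tsum_mul_left]
    have hs3 := (Complex.summable_ofReal.2 (hs2.mul_left 2))
    rw [h2, ← hs1.tsum_sub hs3, tsum_eq_sum (s := hlow.toFinset)]
    · refine norm_sum_le_of_le _ (f := _) (n := fun _ => 2) (fun γ hγ => ?_) |>.trans (by simp)
      have hγ' : γ.depth < δ.depth := by simpa using hγ
      rw [if_neg fun h => absurd h.1 (not_le.2 hγ'), mul_zero, Complex.ofReal_zero, sub_zero,
        norm_mul, Complex.norm_real, Real.norm_of_nonneg (hB.weight_rpow_nonneg t γ)]
      have h1 : B.weight d γ ^ t ≤ 1 := by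
        rw [hB.weight_rpow]
        exact Real.rpow_le_one (hB.mass_pos γ).le (hB.mass_le_one γ)
          (div_nonneg (hd'.le.trans (le_of_lt ht)) hd'.le)
      calc _ ≤ 1 * (1 + 1 : ℝ) := mul_le_mul h1
            ((norm_add_le _ _).trans (add_le_add (hf _) (hf _))) (norm_nonneg _) zero_le_one
        _ = 2 := by norm_num
    · intro γ hγ
      -- From the depth of `δ` on, both points chosen for `γ` have the same prefix as `γ`, so they
      -- lie in `[δ]` together or not at all.
      have hγ' : δ.depth ≤ γ.depth := by simpa using hγ
      have hiff : (τ γ).2 ∈ B.cylinder δ ↔ (τ γ).1 ∈ B.cylinder δ := by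
        have h1 := mem_cylinder_iff.1 (hτ γ).1
        have h2 := mem_cylinder_iff.1 (hτ γ).2.1
        rw [mem_cylinder_iff, mem_cylinder_iff, pre_eq_of_le hγ' (h1.trans h2.symm)]
      simp only [hγ', true_and, f, z, Set.indicator, hiff]
      split_ifs
      · push_cast; ring
      · simp
  have h1q : Tendsto (fun t => ((1 - q t : ℝ) : ℂ)) (𝓝[>] (d : ℝ)) (𝓝 0) := by
    have : Tendsto (fun t => 1 - q t) (𝓝[>] (d : ℝ)) (𝓝 (1 - 1)) := tendsto_const_nhds.sub hq
    rw [sub_self] at this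
    exact_mod_cast (Complex.continuous_ofReal.tendsto 0).comp this
  have hdiff : Tendsto (fun t => ((1 - q t : ℝ) : ℂ) * (N t - ((2 * S δ t : ℝ) : ℂ)))
      (𝓝[>] (d : ℝ)) (𝓝 0) := by
    refine Tendsto.zero_mul_isBoundedUnder_le h1q ?_
    refine ⟨hlow.toFinset.card * 2, ?_⟩
    rw [eventually_map]
    filter_upwards [self_mem_nhdsWithin] with t ht using hN t ht
  have hnum : Tendsto (fun t => ((1 - q t : ℝ) : ℂ) * N t) (𝓝[>] (d : ℝ))
      (𝓝 ((2 * B.mass δ : ℝ) : ℂ)) := by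
    have h := hdiff.add ((Complex.continuous_ofReal.tendsto _).comp ((hS δ).const_mul 2))
    rw [zero_add] at h
    refine h.congr fun t => ?_
    simp only [Function.comp_apply]
    push_cast
    ring
  have hden : Tendsto (fun t => ((1 - q t : ℝ) : ℂ) * ((2 * S .root t : ℝ) : ℂ)) (𝓝[>] (d : ℝ))
      (𝓝 ((2 : ℝ) : ℂ)) := by
    have h := (Complex.continuous_ofReal.tendsto _).comp ((hS .root).const_mul 2)
    simp only [mass, mul_one] at h
    refine h.congr fun t => ?_
    simp only [Function.comp_apply]
    push_cast
    ring
  have h := hnum.div hden (by norm_num)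
  have hval : ((2 * B.mass δ : ℝ) : ℂ) / ((2 : ℝ) : ℂ) = (B.mass δ : ℂ) := by
    push_cast; field_simp
  rw [hval] at h
  refine h.congr' ?_
  filter_upwards [self_mem_nhdsWithin] with t ht
  have hne : ((1 - q t : ℝ) : ℂ) ≠ 0 := by
    rw [Ne, Complex.ofReal_eq_zero]
    have : q t < 1 := Real.rpow_lt_one_of_one_lt_of_neg hB.one_lt
      (by rw [neg_lt_zero, sub_pos, one_lt_div hd']; exact ht)
    linarith
  rw [Pi.div_apply, mul_div_mul_left _ _ hne, hS0]
  rfl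

/-- A continuous function is within `ε/4` of a combination `g` of indicators of cylinders of one
depth, for which the limit is known. -/
theorem isDixmierMeasure {μ : Measure (InfPath B)} (hμ : IsProbabilityMeasure μ)
    (hcyl : ∀ γ, μ.real (B.cylinder γ) = B.mass γ) : B.IsDixmierMeasure d μ := by
  refine ⟨hμ, fun τ hτ f => ?_⟩
  simp only [traceQuotient_eq]
  rw [hB.abscissa_eq hd, Metric.tendsto_nhds]
  intro ε hε
  obtain ⟨N, hN⟩ := exists_modulus f (ε := ε / 4) (by positivity)
  choose z hz using fun γ => exists_pre_eq hB.out γ hB.nonempty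
  let s := desc (.root : FinPath B) N
  let χ : FinPath B → InfPath B → ℂ := fun γ => (B.cylinder γ).indicator fun _ => 1
  let g : InfPath B → ℂ := fun x => ∑ γ ∈ s, f (z γ) * χ γ x
  have hg : ∀ x, g x = f (z (x.pre N)) := by
    intro x
    simp only [g, χ]
    rw [Finset.sum_eq_single (x.pre N)]
    · rw [Set.indicator_of_mem (mem_cylinder_pre.2 rfl), mul_one]
    · intro γ hγ hne
      rw [Set.indicator_of_notMem, mul_zero]
      rw [mem_cylinder_iff, mem_desc_root.1 hγ]
      exact fun h => hne h.symm
    · intro h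
      exact absurd (mem_desc_root.2 (by simp)) h
  have hfg : ∀ x, ‖f x - g x‖ ≤ ε / 4 := fun x => by
    rw [hg]
    refine hN _ _ ?_
    have := hz (x.pre N)
    rw [depth_pre] at this
    exact this.symm
  have hfb : ∀ x, ‖f x‖ ≤ ‖f‖ := f.norm_coe_le_norm
  have hgb : ∀ x, ‖g x‖ ≤ ‖f‖ := fun x => by rw [hg]; exact hfb _
  have hχ : ∀ γ x, ‖χ γ x‖ ≤ 1 := fun γ x => by
    simp only [χ, Set.indicator]; split_ifs <;> simp
  have hχi : ∀ γ, Integrable (χ γ) μ := fun γ =>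
    (integrable_const 1).indicator (measurableSet_cylinder γ)
  have hgi : Integrable g μ := integrable_finsetSum _ fun γ _ => (hχi γ).const_mul _
  have hfi : Integrable f μ :=
    Integrable.of_bound f.continuous.aestronglyMeasurable ‖f‖ (Eventually.of_forall hfb)
  have hint : ‖∫ x, f x ∂μ - ∫ x, g x ∂μ‖ ≤ ε / 4 := by
    rw [← integral_sub hfi hgi]
    simpa using norm_integral_le_of_norm_le_const (μ := μ) (Eventually.of_forall hfg)
  have hgint : ∫ x, g x ∂μ = ∑ γ ∈ s, f (z γ) * (B.mass γ : ℂ) := by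
    simp only [g]
    rw [integral_finsetSum _ fun γ _ => (hχi γ).const_mul _]
    refine Finset.sum_congr rfl fun γ _ => ?_
    rw [integral_const_mul, integral_indicator (measurableSet_cylinder γ)]
    simp [hcyl]
  have hlim : Tendsto (B.traceQuotient d τ g) (𝓝[>] (d : ℝ)) (𝓝 (∫ x, g x ∂μ)) := by
    rw [hgint]
    refine (tendsto_finsetSum s fun γ _ =>
      (hB.tendsto_traceQuotient_indicator hd hτ γ).const_mul (f (z γ))).congr' ?_
    filter_upwards [self_mem_nhdsWithin] with t ht
    exact (hB.traceQuotient_sum hd ht τ s _ χ hχ).symm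
  filter_upwards [self_mem_nhdsWithin, Metric.tendsto_nhds.1 hlim (ε / 4) (by positivity)]
    with t ht h1
  have h2 := hB.norm_traceQuotient_sub_le hd ht τ hfb hgb hfg
  rw [dist_eq_norm] at h1 ⊢
  calc _ = ‖(B.traceQuotient d τ f t - B.traceQuotient d τ g t) +
        (B.traceQuotient d τ g t - ∫ x, g x ∂μ) - (∫ x, f x ∂μ - ∫ x, g x ∂μ)‖ := by
        congr 1; ring
    _ ≤ ε / 4 + ε / 4 + ε / 4 := (norm_sub_le _ _).trans
        (add_le_add ((norm_add_le _ _).trans (add_le_add h2 h1.le)) hint)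
    _ < ε := by linarith

/-- The Dixmier trace measure exists, and the measure of a cylinder is the mass of its path. -/
theorem dixmierMeasure_spec : IsProbabilityMeasure (B.dixmierMeasure d) ∧
    ∀ γ, (B.dixmierMeasure d).real (B.cylinder γ) = B.mass γ := by
  obtain ⟨μ, hμ, hcyl⟩ := hB.exists_measure
  have hex : ∃ μ, B.IsDixmierMeasure d μ := ⟨μ, hB.isDixmierMeasure hd hμ hcyl⟩
  have hspec : B.IsDixmierMeasure d (B.dixmierMeasure d) := by
    rw [dixmierMeasure, dif_pos hex]
    exact hex.choose_spec
  have := hspec.1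
  refine ⟨this, fun δ => ?_⟩
  choose z hz using fun γ => exists_pre_eq hB.out γ hB.nonempty
  -- A choice function must exist for the defining limits to say anything. Where `γ` has one
  -- extension only, any pair in `[γ]` will do.
  obtain ⟨τ, hτ⟩ : ∃ τ, B.IsChoice τ := by
    classical
    refine ⟨fun γ => if h : (B.pairs γ).Nonempty then h.some else (z γ, z γ), fun γ => ?_⟩
    by_cases h : (B.pairs γ).Nonempty
    · have hm := h.some_mem
      simp only [dif_pos h]
      have hm' := mem_pairs_iff.1 hm
      exact ⟨mem_cylinder_iff.2 hm'.1, mem_cylinder_iff.2 hm'.2.1, fun _ => hm⟩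
    · simp only [dif_neg h]
      exact ⟨mem_cylinder_iff.2 (hz γ), mem_cylinder_iff.2 (hz γ), fun h' => absurd h' h⟩
  have hcont : Continuous ((B.cylinder δ).indicator fun _ => (1 : ℂ)) :=
    (isClopen_cylinder δ).continuous_indicator continuous_const
  have h1 := hspec.2 τ hτ ⟨_, hcont⟩
  simp only [traceQuotient_eq] at h1
  rw [hB.abscissa_eq hd] at h1
  have h2 := tendsto_nhds_unique h1 (hB.tendsto_traceQuotient_indicator hd hτ δ)
  simp only [ContinuousMap.coe_mk] at h2
  rw [integral_indicator (measurableSet_cylinder δ)] at h2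
  simpa using h2

end PFData

end StationaryBratteli

/-! ### The Dirichlet form on indicators of cylinders -/

namespace StationaryBratteli

variable {V E : Type*} {B : StationaryBratteli V E}

open InfPath

instance [Finite V] [Finite E] : SecondCountableTopology (InfPath B) :=
  ⟨⟨Set.range B.cylinder, Set.countable_range _, rfl⟩⟩

/-- The indicator function of the cylinder of the prefix of depth `n` of `z`. -/
def cylInd (z : InfPath B) (n : ℕ) : InfPath B → ℂ :=
  (B.cylinder (z.pre n)).indicator fun _ => 1

theorem cylInd_apply_of_eq {z x : InfPath B} {n : ℕ} (h : x.pre n = z.pre n) : cylInd z n x = 1 :=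
  Set.indicator_of_mem (mem_cylinder_pre.2 h) _

theorem cylInd_apply_of_ne {z x : InfPath B} {n : ℕ} (h : x.pre n ≠ z.pre n) : cylInd z n x = 0 :=
  Set.indicator_of_notMem (fun h' => h (mem_cylinder_pre.1 h')) _

theorem pairs_eq_diff [Finite V] [Finite E] (γ : FinPath B) :
    B.pairs γ = (B.cylinder γ ×ˢ B.cylinder γ) \
      ⋃ δ ∈ desc γ 1, B.cylinder δ ×ˢ B.cylinder δ := by
  ext p
  rw [mem_pairs_iff, Set.mem_sdiff, Set.mem_prod, mem_cylinder_iff, mem_cylinder_iff, ← and_assoc]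
  refine and_congr_right fun h => not_congr ?_
  simp only [Set.mem_iUnion, Set.mem_prod, exists_prop]
  constructor
  · intro h'
    exact ⟨_, pre_mem_desc h.1 1, mem_cylinder_pre.2 rfl, mem_cylinder_pre.2 h'.symm⟩
  · rintro ⟨δ, hδ, h1, h2⟩
    rw [mem_cylinder_iff, (mem_desc.1 hδ).1] at h1 h2
    rw [h1, h2]

theorem measurableSet_pairs [Finite V] [Finite E] (γ : FinPath B) :
    MeasurableSet (B.pairs γ) := by
  rw [pairs_eq_diff]
  exact ((measurableSet_cylinder γ).prod (measurableSet_cylinder γ)).diff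
    (Finset.measurableSet_biUnion _ fun δ _ =>
      (measurableSet_cylinder δ).prod (measurableSet_cylinder δ))

variable [Fintype V]

/-- The coefficient of `γ` in the Dirichlet form. -/
def coeff (B : StationaryBratteli V E) (d : ℕ) (s : ℝ) (γ : FinPath B) : ℝ :=
  B.weight d γ ^ s * ((B.weight d γ)⁻¹ * (B.weight d γ)⁻¹) *
    (((B.dixmierMeasure d).prod (B.dixmierMeasure d)).real (B.pairs γ))⁻¹

/-- The integral of the product of the differences over the pairs that split at `γ`. -/
def diffIntegral (B : StationaryBratteli V E) (d : ℕ) (γ : FinPath B) (f g : InfPath B → ℂ) : ℂ :=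
  ∫ p in B.pairs γ, (starRingEnd ℂ) (f p.1 - f p.2) * (g p.1 - g p.2)
    ∂((B.dixmierMeasure d).prod (B.dixmierMeasure d))

/-- The commutator is antidiagonal, with entries plus and minus the difference of values divided by
`w`, so the trace is twice the product of differences and the factor `1/2` cancels. -/
theorem energyTerm_eq [Finite E] (d : ℕ) (s : ℝ) (f g : InfPath B → ℂ) (γ : FinPath B) :
    B.energyTerm d s f g γ = (B.coeff d s γ : ℂ) * B.diffIntegral d γ f g := by
  have h : ∀ p : InfPath B × InfPath B, (1 / 2 : ℂ) * (B.absDiracBlock d s γ *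
      (B.diracBlock d γ * repBlock f p - repBlock f p * B.diracBlock d γ)ᴴ *
      (B.diracBlock d γ * repBlock g p - repBlock g p * B.diracBlock d γ)).trace =
      ((B.weight d γ ^ s * ((B.weight d γ)⁻¹ * (B.weight d γ)⁻¹) : ℝ) : ℂ) *
        ((starRingEnd ℂ) (f p.1 - f p.2) * (g p.1 - g p.2)) := by
    intro p
    simp only [absDiracBlock, diracBlock, repBlock, Matrix.trace, Fin.sum_univ_two, Matrix.diag,
      Matrix.mul_apply, Matrix.conjTranspose_apply, Matrix.sub_apply, Matrix.smul_apply,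
      Matrix.diagonal_apply, Matrix.one_apply, Matrix.of_apply, Matrix.cons_val', Matrix.cons_val_zero,
      Matrix.cons_val_one, smul_eq_mul]
    simp
    ring
  simp only [energyTerm, h]
  -- Conditioning is restriction divided by the mass of `B.pairs γ`. If that mass is zero, both
  -- sides vanish, because `∞` and the real inverse of `0` are both read as `0`.
  rw [integral_const_mul, ProbabilityTheory.cond, integral_smul_measure, coeff, diffIntegral,
    ENNReal.toReal_inv, Complex.real_smul, measureReal_def]
  push_cast
  ring

theorem diffIntegral_congr [Finite E] {d : ℕ} [SFinite (B.dixmierMeasure d)] {f f' g g' : InfPath B → ℂ}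
    (hf : f =ᵐ[B.dixmierMeasure d] f') (hg : g =ᵐ[B.dixmierMeasure d] g') (γ : FinPath B) :
    B.diffIntegral d γ f g = B.diffIntegral d γ f' g' := by
  have h1 : ∀ {u v : InfPath B → ℂ}, u =ᵐ[B.dixmierMeasure d] v →
      ∀ᵐ p ∂((B.dixmierMeasure d).prod (B.dixmierMeasure d)), u p.1 = v p.1 ∧ u p.2 = v p.2 :=
    fun h => (Measure.quasiMeasurePreserving_fst.ae h).and (Measure.quasiMeasurePreserving_snd.ae h)
  refine integral_congr_ae (ae_restrict_of_ae ?_)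
  filter_upwards [h1 hf, h1 hg] with p h2 h3
  rw [h2.1, h2.2, h3.1, h3.2]

theorem conj_diffIntegral (d : ℕ) (γ : FinPath B) (f g : InfPath B → ℂ) :
    (starRingEnd ℂ) (B.diffIntegral d γ f g) = B.diffIntegral d γ g f := by
  rw [diffIntegral, ← integral_conj, diffIntegral]
  refine integral_congr_ae (Eventually.of_forall fun p => ?_)
  simp only [map_mul, Complex.conj_conj]
  ring

theorem conj_dirichletForm [Finite E] (d : ℕ) (s : ℝ) (f g : B.L2 d) :
    (starRingEnd ℂ) (B.dirichletForm d s f g) = B.dirichletForm d s g f := by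
  rw [dirichletForm, dirichletForm, Complex.conj_tsum]
  refine tsum_congr fun γ => ?_
  rw [energyTerm_eq, energyTerm_eq, map_mul, Complex.conj_ofReal, conj_diffIntegral]

/-- The indicator of the cylinder of `z.pre n` separates the points of a pair only if they split at
a proper prefix of `z.pre n`. -/
theorem diffIntegral_cylInd_of_ne (d : ℕ) (z : InfPath B) (n : ℕ) (f : InfPath B → ℂ)
    {η : FinPath B} (h : ∀ k < n, z.pre k ≠ η) [Finite E] :
    B.diffIntegral d η (cylInd z n) f = 0 := by
  rw [diffIntegral]
  refine (setIntegral_congr_fun (measurableSet_pairs η) (g := fun _ => 0) fun p hp => ?_).trans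
    (by simp)
  obtain ⟨h1, h2, -⟩ := mem_pairs_iff.1 hp
  have heq : cylInd z n p.1 = cylInd z n p.2 := by
    rcases lt_or_ge η.depth n with hn | hn
    · have hne := h _ hn
      rw [cylInd_apply_of_ne, cylInd_apply_of_ne]
      · exact fun h' => hne ((pre_eq_of_le hn.le h').symm.trans h2)
      · exact fun h' => hne ((pre_eq_of_le hn.le h').symm.trans h1)
    · have h3 := pre_eq_of_le hn (h1.trans h2.symm)
      by_cases h4 : p.1.pre n = z.pre n
      · rw [cylInd_apply_of_eq h4, cylInd_apply_of_eq (h3.symm.trans h4)]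
      · rw [cylInd_apply_of_ne h4, cylInd_apply_of_ne fun h5 => h4 (h3.trans h5)]
  simp [heq]

section

variable [Finite E] {d : ℕ} [IsProbabilityMeasure (B.dixmierMeasure d)]

/-- For a pair that splits at `z.pre k`, if one point lies in `A = [z.pre n]`, the other lies in `C
= [z.pre k] \ [z.pre (k+1)]`. Only the rectangles `A × C` and `C × A` contribute, and each one
factors by Fubini. -/
theorem diffIntegral_cylInd (z : InfPath B) {k n : ℕ} (hk : k < n) {f : InfPath B → ℂ}
    (hf : Integrable f (B.dixmierMeasure d)) :
    B.diffIntegral d (z.pre k) (cylInd z n) f =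
      2 * ((((B.dixmierMeasure d).real (B.cylinder (z.pre k)) -
          (B.dixmierMeasure d).real (B.cylinder (z.pre (k + 1))) : ℝ) : ℂ) *
          ∫ x in B.cylinder (z.pre n), f x ∂(B.dixmierMeasure d) -
        (((B.dixmierMeasure d).real (B.cylinder (z.pre n)) : ℝ) : ℂ) *
          (∫ x in B.cylinder (z.pre k), f x ∂(B.dixmierMeasure d) -
            ∫ x in B.cylinder (z.pre (k + 1)), f x ∂(B.dixmierMeasure d))) := by
  set μ := B.dixmierMeasure d with hμ
  set A := B.cylinder (z.pre n)
  set C := B.cylinder (z.pre k) \ B.cylinder (z.pre (k + 1))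
  have hsub : B.cylinder (z.pre (k + 1)) ⊆ B.cylinder (z.pre k) := fun x hx =>
    mem_cylinder_pre.2 (pre_eq_of_le (Nat.le_succ k) (mem_cylinder_pre.1 hx))
  have hA : MeasurableSet A := measurableSet_cylinder _
  have hC : MeasurableSet C := (measurableSet_cylinder _).diff (measurableSet_cylinder _)
  have hCm : μ.real C = μ.real (B.cylinder (z.pre k)) - μ.real (B.cylinder (z.pre (k + 1))) :=
    measureReal_sdiff hsub (measurableSet_cylinder _)
  have hCi : ∫ x in C, f x ∂μ = ∫ x in B.cylinder (z.pre k), f x ∂μ -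
      ∫ x in B.cylinder (z.pre (k + 1)), f x ∂μ :=
    setIntegral_sdiff (measurableSet_cylinder _) hf.integrableOn hsub
  rw [← hCm, ← hCi]
  let a : InfPath B → ℂ := A.indicator fun _ => 1
  let c : InfPath B → ℂ := C.indicator fun _ => 1
  have hai : ∫ x, a x ∂μ = (μ.real A : ℂ) := by
    simp only [a]
    rw [integral_indicator hA]; simp
  have hci : ∫ x, c x ∂μ = (μ.real C : ℂ) := by
    simp only [c]
    rw [integral_indicator hC]; simp
  have hafi : ∫ x, a x * f x ∂μ = ∫ x in A, f x ∂μ := by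
    rw [← integral_indicator hA]
    refine integral_congr_ae (Eventually.of_forall fun x => ?_)
    by_cases hx : x ∈ A <;> simp [a, hx]
  have hcfi : ∫ x, c x * f x ∂μ = ∫ x in C, f x ∂μ := by
    rw [← integral_indicator hC]
    refine integral_congr_ae (Eventually.of_forall fun x => ?_)
    by_cases hx : x ∈ C <;> simp [c, hx]
  have haI : Integrable a μ := (integrable_const 1).indicator hA
  have hcI : Integrable c μ := (integrable_const 1).indicator hC
  have hafI : Integrable (fun x => a x * f x) μ := by
    refine (hf.indicator hA).congr (Eventually.of_forall fun x => ?_)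
    by_cases hx : x ∈ A <;> simp [a, hx]
  have hcfI : Integrable (fun x => c x * f x) μ := by
    refine (hf.indicator hC).congr (Eventually.of_forall fun x => ?_)
    by_cases hx : x ∈ C <;> simp [c, hx]
  -- The integrand as a sum of products of functions of one variable. Off `B.pairs (z.pre k)` both
  -- products of indicators vanish.
  have hkey : ∀ p : InfPath B × InfPath B, (B.pairs (z.pre k)).indicator (fun p =>
      (starRingEnd ℂ) (cylInd z n p.1 - cylInd z n p.2) * (f p.1 - f p.2)) p =
      (a p.1 * f p.1) * c p.2 - a p.1 * (c p.2 * f p.2) +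
        (c p.1 * (a p.2 * f p.2) - (c p.1 * f p.1) * a p.2) := by
    intro p
    have hcA : ∀ x, x ∈ A ↔ x.pre n = z.pre n := fun x => mem_cylinder_pre
    have hcC : ∀ x, x ∈ C ↔ x.pre k = z.pre k ∧ x.pre (k + 1) ≠ z.pre (k + 1) := fun x => by
      simp only [C, Set.mem_sdiff, mem_cylinder_pre, Ne]
    have ha : ∀ x, cylInd z n x = a x := fun x => rfl
    by_cases hp : p ∈ B.pairs (z.pre k)
    · rw [Set.indicator_of_mem hp, ha, ha]
      rw [mem_pairs_iff, depth_pre] at hp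
      obtain ⟨h1, h2, h3⟩ := hp
      by_cases hp1 : p.1.pre n = z.pre n
      · have hc1 : p.1.pre (k + 1) = z.pre (k + 1) := pre_eq_of_le hk hp1
        have hc2 : p.2.pre (k + 1) ≠ z.pre (k + 1) := fun h => h3 (hc1.trans h.symm)
        have hp2 : p.2.pre n ≠ z.pre n := fun h => hc2 (pre_eq_of_le hk h)
        simp [a, c, hcA, hcC, hp1, hp2, hc1, hc2, h2]
      · by_cases hp2 : p.2.pre n = z.pre n
        · have hc2 : p.2.pre (k + 1) = z.pre (k + 1) := pre_eq_of_le hk hp2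
          have hc1 : p.1.pre (k + 1) ≠ z.pre (k + 1) := fun h => h3 (h.trans hc2.symm)
          simp [a, c, hcA, hcC, hp1, hp2, hc1, hc2, h1]
        · simp [a, hcA, hp1, hp2]
    · rw [Set.indicator_of_notMem hp]
      rw [mem_pairs_iff, depth_pre] at hp
      have hcontr : ∀ x y : InfPath B, x.pre n = z.pre n → y ∈ C →
          x.pre k = z.pre k ∧ y.pre k = z.pre k ∧ x.pre (k + 1) ≠ y.pre (k + 1) := by
        intro x y hx hy
        rw [hcC] at hy
        exact ⟨pre_eq_of_le hk.le hx, hy.1, fun h => hy.2 (h.symm.trans (pre_eq_of_le hk hx))⟩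
      have h1 : a p.1 * c p.2 = 0 := by
        by_cases h1 : p.1 ∈ A
        · by_cases h2 : p.2 ∈ C
          · exact absurd (hcontr _ _ ((hcA _).1 h1) h2) hp
          · simp [c, h2]
        · simp [a, h1]
      have h2 : c p.1 * a p.2 = 0 := by
        by_cases h1 : p.2 ∈ A
        · by_cases h2 : p.1 ∈ C
          · obtain ⟨h3, h4, h5⟩ := hcontr _ _ ((hcA _).1 h1) h2
            exact absurd ⟨h4, h3, h5.symm⟩ hp
          · simp [c, h2]
        · simp [a, h1]
      linear_combination (-(f p.1) + f p.2) * h1 + (f p.1 - f p.2) * h2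
  rw [diffIntegral, ← integral_indicator (measurableSet_pairs _)]
  simp_rw [hkey]
  have i1 := hafI.mul_prod hcI
  have i2 := haI.mul_prod hcfI
  have i3 := hcI.mul_prod hafI
  have i4 := hcfI.mul_prod haI
  refine (integral_add (i1.sub i2) (i3.sub i4)).trans ?_
  rw [integral_sub' i1 i2, integral_sub' i3 i4,
    integral_prod_mul (fun x => a x * f x) c, integral_prod_mul a (fun x => c x * f x),
    integral_prod_mul c (fun x => a x * f x), integral_prod_mul (fun x => c x * f x) a,
    hai, hci, hafi, hcfi]
  ring

theorem integrable_conj_diff_mul {h f : InfPath B → ℂ} {K : ℝ}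
    (hh : AEStronglyMeasurable h (B.dixmierMeasure d)) (hK : ∀ x, ‖h x‖ ≤ K)
    (hf : Integrable f (B.dixmierMeasure d)) :
    Integrable (fun p : InfPath B × InfPath B =>
      (starRingEnd ℂ) (h p.1 - h p.2) * (f p.1 - f p.2))
      ((B.dixmierMeasure d).prod (B.dixmierMeasure d)) := by
  have hf2 : Integrable (fun p : InfPath B × InfPath B => f p.1 - f p.2)
      ((B.dixmierMeasure d).prod (B.dixmierMeasure d)) :=
    (hf.comp_fst _).sub (hf.comp_snd _)
  refine hf2.bdd_mul (c := K + K) ?_ (Eventually.of_forall fun p => ?_)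
  · exact Complex.continuous_conj.comp_aestronglyMeasurable
      (hh.comp_fst.sub hh.comp_snd)
  · rw [RCLike.norm_conj]
    exact (norm_sub_le _ _).trans (add_le_add (hK _) (hK _))

theorem diffIntegral_sub_mul {h h' f : InfPath B → ℂ} {K : ℝ} (a : ℝ)
    (hh : AEStronglyMeasurable h (B.dixmierMeasure d)) (hK : ∀ x, ‖h x‖ ≤ K)
    (hh' : AEStronglyMeasurable h' (B.dixmierMeasure d)) (hK' : ∀ x, ‖h' x‖ ≤ K)
    (hf : Integrable f (B.dixmierMeasure d)) (η : FinPath B) :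
    B.diffIntegral d η (fun x => h x - (a : ℂ) * h' x) f =
      B.diffIntegral d η h f - (a : ℂ) * B.diffIntegral d η h' f := by
  rw [diffIntegral, diffIntegral, diffIntegral, ← integral_const_mul, ← integral_sub
    (integrable_conj_diff_mul hh hK hf).integrableOn
    ((integrable_conj_diff_mul hh' hK' hf).integrableOn.const_mul _)]
  refine integral_congr_ae (Eventually.of_forall fun p => ?_)
  simp only [map_sub, map_mul, Complex.conj_ofReal]
  ring

end

end StationaryBratteli

/-! ### Eigenfunctions and eigenvalues of the Laplacians -/

namespace StationaryBratteli

variable {V E : Type*} {B : StationaryBratteli V E}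

open InfPath

variable [Fintype V]

/-- The contribution of the split of `z` at depth `k` to the eigenvalues. -/
def splitTerm (B : StationaryBratteli V E) (d : ℕ) (s : ℝ) (z : InfPath B) (k : ℕ) : ℝ :=
  2 * B.coeff d s (z.pre k) * (B.mass (z.pre k) - B.mass (z.pre (k + 1)))

/-- The eigenvalue of the Laplacian that belongs to the prefix of depth `n` of `z`. -/
def eigenval (B : StationaryBratteli V E) (d : ℕ) (s : ℝ) (z : InfPath B) (n : ℕ) : ℝ :=
  2 * B.coeff d s (z.pre n) * B.mass (z.pre n) + ∑ k ∈ Finset.range n, B.splitTerm d s z k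

/-- The indicator function of the cylinder of a prefix, as an element of `L²`. -/
def cylLp (d : ℕ) [IsFiniteMeasure (B.dixmierMeasure d)] (z : InfPath B) (n : ℕ) : B.L2 d :=
  indicatorConstLp 2 (measurableSet_cylinder (z.pre n)) (measure_ne_top _ _) (1 : ℂ)

/-- The eigenfunction supported by the prefix of depth `n` of `z` that takes one value on the
prefix of depth `n + 1` and another one on the rest. -/
def eigenLp (d : ℕ) [IsFiniteMeasure (B.dixmierMeasure d)] (z : InfPath B) (n : ℕ) : B.L2 d :=
  cylLp d z (n + 1) - ((B.mass (z.pre (n + 1)) / B.mass (z.pre n) : ℝ) : ℂ) • cylLp d z n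

theorem cylLp_ae (d : ℕ) [IsFiniteMeasure (B.dixmierMeasure d)] (z : InfPath B) (n : ℕ) :
    (cylLp d z n : InfPath B → ℂ) =ᵐ[B.dixmierMeasure d] cylInd z n :=
  indicatorConstLp_coeFn

theorem eigenLp_ae (d : ℕ) [IsFiniteMeasure (B.dixmierMeasure d)] (z : InfPath B) (n : ℕ) :
    (eigenLp d z n : InfPath B → ℂ) =ᵐ[B.dixmierMeasure d] fun x => cylInd z (n + 1) x -
      ((B.mass (z.pre (n + 1)) / B.mass (z.pre n) : ℝ) : ℂ) * cylInd z n x := by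
  filter_upwards [Lp.coeFn_sub (cylLp d z (n + 1))
    (((B.mass (z.pre (n + 1)) / B.mass (z.pre n) : ℝ) : ℂ) • cylLp d z n),
    Lp.coeFn_smul ((B.mass (z.pre (n + 1)) / B.mass (z.pre n) : ℝ) : ℂ) (cylLp d z n),
    cylLp_ae d z n, cylLp_ae d z (n + 1)] with x h1 h2 h3 h4
  rw [eigenLp, h1, Pi.sub_apply, h2, Pi.smul_apply, h3, h4, smul_eq_mul]

theorem inner_cylLp (d : ℕ) [IsFiniteMeasure (B.dixmierMeasure d)] (z : InfPath B) (n : ℕ)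
    (f : B.L2 d) :
    inner ℂ (cylLp d z n) f = ∫ x in B.cylinder (z.pre n), f x ∂(B.dixmierMeasure d) :=
  L2.inner_indicatorConstLp_one _ _ f

theorem inner_eigenLp (d : ℕ) [IsFiniteMeasure (B.dixmierMeasure d)] (z : InfPath B) (n : ℕ)
    (f : B.L2 d) :
    inner ℂ (eigenLp d z n) f =
      ∫ x in B.cylinder (z.pre (n + 1)), f x ∂(B.dixmierMeasure d) -
        ((B.mass (z.pre (n + 1)) / B.mass (z.pre n) : ℝ) : ℂ) *
          ∫ x in B.cylinder (z.pre n), f x ∂(B.dixmierMeasure d) := by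
  rw [eigenLp, inner_sub_left, inner_smul_left, inner_cylLp, inner_cylLp, Complex.conj_ofReal]

theorem integrable_L2 {d : ℕ} [IsFiniteMeasure (B.dixmierMeasure d)] (f : B.L2 d) :
    Integrable f (B.dixmierMeasure d) :=
  (Lp.memLp f).integrable one_le_two

theorem energyTerm_eigenLp_of_ne [Finite E] {d : ℕ} [IsProbabilityMeasure (B.dixmierMeasure d)]
    (s : ℝ) (z : InfPath B) (n : ℕ) (f : B.L2 d) {η : FinPath B} (h : ∀ k ≤ n, z.pre k ≠ η) :
    B.energyTerm d s (eigenLp d z n) f η = 0 := by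
  rw [energyTerm_eq, diffIntegral_congr (eigenLp_ae d z n) (ae_eq_refl f),
    diffIntegral_sub_mul (K := 1), diffIntegral_cylInd_of_ne, diffIntegral_cylInd_of_ne]
  · simp
  · exact fun k hk => h k hk.le
  · exact fun k hk => h k (by omega)
  · exact (aestronglyMeasurable_const.indicator (measurableSet_cylinder _))
  · intro x; simp only [cylInd, Set.indicator]; split_ifs <;> simp
  · exact (aestronglyMeasurable_const.indicator (measurableSet_cylinder _))
  · intro x; simp only [cylInd, Set.indicator]; split_ifs <;> simp
  · exact integrable_L2 f

namespace PFData

variable [Finite E] (hB : B.PFData) {d : ℕ} (hd : 0 < d)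

include hB hd

/-- The coefficient in `eigenLp` makes its mean zero. For `k < n` this cancels the terms with the
integrals of `f` over `[z.pre k]` and `[z.pre (k+1)]`. For `k = n` only the smaller cylinder
contributes, and its value is `2 mass(z.pre n)` times the inner product, up to the coefficient of
the form. -/
theorem energyTerm_eigenLp [IsProbabilityMeasure (B.dixmierMeasure d)]
    (s : ℝ) (z : InfPath B) {n k : ℕ} (hk : k ≤ n) (f : B.L2 d) :
    B.energyTerm d s (eigenLp d z n) f (z.pre k) =
      ((if k < n then B.splitTerm d s z k else 2 * B.coeff d s (z.pre n) * B.mass (z.pre n) : ℝ) : ℂ)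
        * inner ℂ (eigenLp d z n) f := by
  have hcyl := (hB.dixmierMeasure_spec hd).2
  have hne : ∀ j, (B.mass (z.pre j) : ℂ) ≠ 0 := fun j => by
    exact_mod_cast (hB.mass_pos _).ne'
  rw [energyTerm_eq, diffIntegral_congr (eigenLp_ae d z n) (ae_eq_refl f),
    diffIntegral_sub_mul (K := 1), diffIntegral_cylInd z (by omega : k < n + 1) (integrable_L2 f),
    inner_eigenLp]
  · rcases hk.lt_or_eq with hk | rfl
    · rw [diffIntegral_cylInd z hk (integrable_L2 f)]
      simp only [hcyl, hk, if_true, splitTerm]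
      have := hne n
      push_cast
      field_simp
      ring
    · rw [diffIntegral_cylInd_of_ne]
      · simp only [hcyl, lt_irrefl, if_false]
        have := hne k
        push_cast
        field_simp
        ring
      · intro j hj h
        have := congrArg FinPath.depth h
        simp only [depth_pre] at this
        omega
  · exact (aestronglyMeasurable_const.indicator (measurableSet_cylinder _))
  · intro x; simp only [cylInd, Set.indicator]; split_ifs <;> simp
  · exact (aestronglyMeasurable_const.indicator (measurableSet_cylinder _))
  · intro x; simp only [cylInd, Set.indicator]; split_ifs <;> simp
  · exact integrable_L2 f

/-- Only the prefixes of `z` of depth at most `n` contribute, so the sum is finite and the form can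
be evaluated against any `f` in `L²`, of finite energy or not. -/
theorem hasSum_energyTerm_eigenLp [IsProbabilityMeasure (B.dixmierMeasure d)]
    (s : ℝ) (z : InfPath B) (n : ℕ) (f : B.L2 d) :
    HasSum (B.energyTerm d s (eigenLp d z n) f)
      ((B.eigenval d s z n : ℂ) * inner ℂ (eigenLp d z n) f) := by
  classical
  have h : HasSum (B.energyTerm d s (eigenLp d z n) f) _ := hasSum_sum_of_ne_finset_zero
    (s := (Finset.range (n + 1)).image z.pre) (fun η hη => energyTerm_eigenLp_of_ne s z n f
      fun k hk h => hη (Finset.mem_image.2 ⟨k, Finset.mem_range.2 (by omega), h⟩))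
  convert h using 1
  rw [Finset.sum_image, Finset.sum_congr rfl fun k hk => hB.energyTerm_eigenLp hd s z
    (Nat.lt_succ_iff.1 (Finset.mem_range.1 hk)) f, ← Finset.sum_mul]
  · congr 1
    rw [Finset.sum_range_succ, if_neg (lt_irrefl n), Finset.sum_congr rfl fun k hk => by
      rw [if_pos (Finset.mem_range.1 hk)], eigenval]
    push_cast
    ring
  · intro k _ j _ h
    simpa using congrArg FinPath.depth h

theorem eigenLp_mem_formDomain [IsProbabilityMeasure (B.dixmierMeasure d)]
    (s : ℝ) (z : InfPath B) (n : ℕ) : eigenLp d z n ∈ B.formDomain d s :=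
  (hB.hasSum_energyTerm_eigenLp hd s z n _).summable

theorem dirichletForm_eigenLp [IsProbabilityMeasure (B.dixmierMeasure d)]
    (s : ℝ) (z : InfPath B) (n : ℕ) (f : B.L2 d) :
    B.dirichletForm d s (eigenLp d z n) f =
      (B.eigenval d s z n : ℂ) * inner ℂ (eigenLp d z n) f :=
  (hB.hasSum_energyTerm_eigenLp hd s z n f).tsum_eq

theorem eigenLp_mem_laplacianGraph [IsProbabilityMeasure (B.dixmierMeasure d)]
    (s : ℝ) (z : InfPath B) (n : ℕ) :
    (eigenLp d z n, (B.eigenval d s z n : ℂ) • eigenLp d z n) ∈ B.laplacianGraph d s := by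
  refine ⟨hB.eigenLp_mem_formDomain hd s z n, fun h _ => ?_⟩
  rw [← conj_dirichletForm, hB.dirichletForm_eigenLp hd, map_mul, inner_conj_symm,
    Complex.conj_ofReal, inner_smul_right]

omit hd in
-- A sibling of `z.pre (n+1)` takes a positive share of the mass.
theorem mass_lt_of_mem_pairs {z : InfPath B} {n : ℕ} (h : (B.pairs (z.pre n)).Nonempty) :
    B.mass (z.pre (n + 1)) < B.mass (z.pre n) := by
  obtain ⟨p, hp⟩ := h
  rw [mem_pairs_iff, depth_pre] at hp
  obtain ⟨y, hy1, hy2⟩ : ∃ y : InfPath B, y.pre n = z.pre n ∧ y.pre (n + 1) ≠ z.pre (n + 1) := by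
    by_cases h : p.1.pre (n + 1) = z.pre (n + 1)
    · exact ⟨p.2, hp.2.1, fun h' => hp.2.2 (h.trans h'.symm)⟩
    · exact ⟨p.1, hp.1, h⟩
  have hz := pre_mem_desc (x := z) (γ := z.pre n) (by simp) 1
  have hy := pre_mem_desc (x := y) (γ := z.pre n) (by simpa using hy1) 1
  rw [depth_pre] at hz hy
  have h2 : ({z.pre (n + 1), y.pre (n + 1)} : Set (FinPath B)).Finite := by simp
  have := Finset.sum_le_sum_of_subset_of_nonneg (f := B.mass) (s := h2.toFinset)
    (t := desc (z.pre n) 1) (fun γ hγ => by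
      simp only [Set.Finite.mem_toFinset, Set.mem_insert_iff, Set.mem_singleton_iff] at hγ
      rcases hγ with rfl | rfl
      exacts [hz, hy]) (fun γ _ _ => (hB.mass_pos γ).le)
  rw [hB.sum_desc] at this
  classical
  have h3 : h2.toFinset = {z.pre (n + 1), y.pre (n + 1)} := by ext; simp
  rw [h3, Finset.sum_pair hy2.symm] at this
  linarith [hB.mass_pos (y.pre (n + 1))]

omit [Finite E] hB hd in
theorem setIntegral_cylLp [IsProbabilityMeasure (B.dixmierMeasure d)] (z : InfPath B) (m : ℕ)
    (γ : FinPath B) : ∫ x in B.cylinder γ, cylLp d z m x ∂(B.dixmierMeasure d) =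
      ((B.dixmierMeasure d).real (B.cylinder (z.pre m) ∩ B.cylinder γ) : ℂ) := by
  rw [cylLp, setIntegral_indicatorConstLp (measurableSet_cylinder γ)]
  simp

omit [Fintype V] [Finite E] hB hd in
theorem cylinder_pre_subset (z : InfPath B) {m n : ℕ} (h : m ≤ n) :
    B.cylinder (z.pre n) ⊆ B.cylinder (z.pre m) := fun _ hx =>
  mem_cylinder_pre.2 (pre_eq_of_le h (mem_cylinder_pre.1 hx))

theorem eigenLp_ne_zero [IsProbabilityMeasure (B.dixmierMeasure d)] {z : InfPath B} {n : ℕ}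
    (h : (B.pairs (z.pre n)).Nonempty) : eigenLp d z n ≠ 0 := by
  intro h0
  have hcyl := (hB.dixmierMeasure_spec hd).2
  have h1 := inner_eigenLp d z n (cylLp d z (n + 1))
  rw [h0, inner_zero_left, setIntegral_cylLp, setIntegral_cylLp, Set.inter_self,
    Set.inter_eq_left.2 (cylinder_pre_subset z (Nat.le_succ n)), hcyl] at h1
  norm_cast at h1
  have h2 := hB.mass_lt_of_mem_pairs h
  have h3 := hB.mass_pos (z.pre (n + 1))
  have h4 : B.mass (z.pre (n + 1)) / B.mass (z.pre n) < 1 := (div_lt_one (h3.trans h2)).2 h2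
  nlinarith

/-- The eigenfunction is supported by `[z.pre n]`, where its mean is zero, and a cylinder of depth
at most `n` contains `[z.pre n]` or misses it. -/
theorem setIntegral_eigenLp [IsProbabilityMeasure (B.dixmierMeasure d)] (z : InfPath B) {n : ℕ}
    {γ : FinPath B} (h : γ.depth ≤ n) :
    ∫ x in B.cylinder γ, eigenLp d z n x ∂(B.dixmierMeasure d) = 0 := by
  have hcyl := (hB.dixmierMeasure_spec hd).2
  obtain ⟨y, hy⟩ := exists_pre_eq hB.out γ hB.nonempty
  have h1 := inner_eigenLp d z n (cylLp d y γ.depth)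
  rw [setIntegral_cylLp, setIntegral_cylLp, hy] at h1
  rw [← hy, ← inner_cylLp, ← inner_conj_symm, h1, map_eq_zero]
  by_cases hz : z.pre γ.depth = γ
  · have hsub : B.cylinder (z.pre n) ⊆ B.cylinder γ := by
      conv_rhs => rw [← hz]
      exact cylinder_pre_subset z h
    rw [Set.inter_eq_right.2 hsub,
      Set.inter_eq_right.2 ((cylinder_pre_subset z (Nat.le_succ n)).trans hsub), hcyl, hcyl]
    have := (hB.mass_pos (z.pre n)).ne'
    norm_cast
    field_simp
    ring
  · have hdis : ∀ m, n ≤ m → B.cylinder γ ∩ B.cylinder (z.pre m) = ∅ := by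
      intro m hm
      rw [← Set.disjoint_iff_inter_eq_empty, Set.disjoint_left]
      intro x h1 h2
      rw [mem_cylinder_iff] at h1
      rw [mem_cylinder_pre] at h2
      exact hz ((pre_eq_of_le (h.trans hm) h2).symm.trans h1)
    rw [hdis n le_rfl, hdis (n + 1) (Nat.le_succ n)]
    simp

omit hB hd in
theorem setIntegral_eq_sum [IsProbabilityMeasure (B.dixmierMeasure d)] (f : B.L2 d)
    (γ : FinPath B) (k : ℕ) : ∫ x in B.cylinder γ, f x ∂(B.dixmierMeasure d) =
      ∑ δ ∈ desc γ k, ∫ x in B.cylinder δ, f x ∂(B.dixmierMeasure d) := by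
  have hU : B.cylinder γ = ⋃ δ ∈ desc γ k, B.cylinder δ := by
    refine subset_antisymm (fun x hx => ?_) (Set.iUnion₂_subset fun δ hδ => (mem_desc.1 hδ).2)
    exact Set.mem_biUnion (pre_mem_desc (mem_cylinder_iff.1 hx) k) (mem_cylinder_pre.2 rfl)
  rw [hU, integral_biUnion_finset _ fun δ _ => measurableSet_cylinder δ]
  · intro δ hδ δ' hδ' hne
    exact pairwise_disjoint_cylinder ((mem_desc.1 hδ).1.trans (mem_desc.1 hδ').1.symm) hne
  · exact fun δ _ => (integrable_L2 f).integrableOn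

-- Long cylinders determine the integrals over all cylinders, since a short one is a finite disjoint
-- union of long ones. The cylinders form a π-system that generates the Borel sets.
omit hB hd in
theorem eq_zero_of_setIntegral_cylinder [IsProbabilityMeasure (B.dixmierMeasure d)] {f : B.L2 d}
    (n : ℕ) (hf : ∀ γ : FinPath B, n ≤ γ.depth →
      ∫ x in B.cylinder γ, f x ∂(B.dixmierMeasure d) = 0) : f = 0 := by
  have hall : ∀ γ : FinPath B, ∫ x in B.cylinder γ, f x ∂(B.dixmierMeasure d) = 0 := by
    intro γ
    rw [setIntegral_eq_sum f γ n]
    exact Finset.sum_eq_zero fun δ hδ => hf δ (by rw [(mem_desc.1 hδ).1]; omega)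
  have huniv : ∫ x, f x ∂(B.dixmierMeasure d) = 0 := by
    have := hall .root
    simpa [cylinder] using this
  have hint := integrable_L2 f
  rw [Lp.eq_zero_iff_ae_eq_zero]
  refine hint.ae_eq_zero_of_forall_setIntegral_eq_zero fun s hs _ => ?_
  have hgen : (inferInstance : MeasurableSpace (InfPath B)) =
      MeasurableSpace.generateFrom (Set.range B.cylinder) := by
    rw [← borel_eq_generateFrom_of_subbasis (s := Set.range B.cylinder) rfl]
    exact BorelSpace.measurable_eq
  have hpi : IsPiSystem (Set.range B.cylinder) := by
    rintro _ ⟨γ, rfl⟩ _ ⟨δ, rfl⟩ ⟨x, h1, h2⟩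
    rcases le_total γ.depth δ.depth with h | h
    · exact ⟨δ, (Set.inter_eq_right.2 (cylinder_subset_or_disjoint h h2 h1)).symm⟩
    · exact ⟨γ, (Set.inter_eq_left.2 (cylinder_subset_or_disjoint h h1 h2)).symm⟩
  induction s, hs using MeasurableSpace.induction_on_inter hgen hpi with
  | empty => simp
  | basic t ht =>
    obtain ⟨γ, rfl⟩ := ht
    exact hall γ
  | compl t ht ih =>
    have := integral_add_compl ht hint
    rwa [ih (measure_lt_top _ _), zero_add, huniv] at this
  | iUnion g hdis hg ih =>
    rw [integral_iUnion hg hdis hint.integrableOn]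
    simp [fun i => ih i (measure_lt_top _ _)]

/-- No eigenvalue is missed. An eigenfunction `f` whose eigenvalue is not in the list is orthogonal
to all `eigenLp z k` with `k ≥ n` and branching `z.pre k`. Hence a vanishing integral over a
cylinder is inherited by its one-edge extensions, and `f = 0`. -/
theorem tailEigenvalues_eq (s : ℝ) (n : ℕ) : B.tailEigenvalues d s n =
    {c | ∃ (z : InfPath B) (k : ℕ), n ≤ k ∧ (B.pairs (z.pre k)).Nonempty ∧
      B.eigenval d s z k = c} := by
  have hprob := (hB.dixmierMeasure_spec hd).1
  have hcyl := (hB.dixmierMeasure_spec hd).2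
  ext c
  constructor
  · rintro ⟨f, hf0, ⟨-, hf⟩, horth⟩
    by_contra hc
    simp only [Set.mem_ofPred_eq, not_exists, not_and] at hc
    have hstep : ∀ (z : InfPath B) (k : ℕ), n ≤ k →
        ∫ x in B.cylinder (z.pre k), f x ∂(B.dixmierMeasure d) = 0 →
        ∫ x in B.cylinder (z.pre (k + 1)), f x ∂(B.dixmierMeasure d) = 0 := by
      intro z k hk h0
      by_cases hp : (B.pairs (z.pre k)).Nonempty
      · have h1 := hf _ (hB.eigenLp_mem_formDomain hd s z k)
        rw [hB.dirichletForm_eigenLp hd, inner_smul_right, mul_eq_mul_right_iff] at h1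
        rcases h1 with h1 | h1
        · exact absurd (by exact_mod_cast h1) (hc z k hk hp)
        · rwa [inner_eigenLp, h0, mul_zero, sub_zero] at h1
      -- Without branching, `[z.pre k]` and `[z.pre (k+1)]` are the same set.
      · have heq : B.cylinder (z.pre (k + 1)) = B.cylinder (z.pre k) := by
          refine subset_antisymm (cylinder_pre_subset z (Nat.le_succ k)) fun x hx => ?_
          rw [mem_cylinder_pre] at hx ⊢
          by_contra hne
          exact hp ⟨(x, z), mem_pairs_iff.2 (by simpa using ⟨hx, hne⟩)⟩
        rw [heq, h0]
    refine hf0 (eq_zero_of_setIntegral_cylinder n fun γ hγ => ?_)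
    obtain ⟨z, hz⟩ := exists_pre_eq hB.out γ hB.nonempty
    rw [← hz]
    exact Nat.le_induction (horth _ (by simp)) (fun k hk ih => hstep z k hk ih) _ hγ
  · rintro ⟨z, k, hk, hp, rfl⟩
    exact ⟨eigenLp d z k, hB.eigenLp_ne_zero hd hp, hB.eigenLp_mem_laplacianGraph hd s z k,
      fun γ hγ => hB.setIntegral_eigenLp hd z (hγ.le.trans hk)⟩

end PFData

end StationaryBratteli

/-! ### The `ω`-spectrum as an image of the path space -/

namespace StationaryBratteli

variable {V E : Type*} {B : StationaryBratteli V E}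

open InfPath

/-- Two edges with the same source and different names have different targets when edges are simple;
at the root this holds by construction of the diagram. -/
theorem vtx_ne_of_split (hs : B.SimpleEdges) {z y : InfPath B} {n : ℕ} (h : z.pre n = y.pre n)
    (h' : z.pre (n + 1) ≠ y.pre (n + 1)) : z.vtx n ≠ y.vtx n := by
  intro hv
  cases n with
  | zero =>
    rw [vtx_zero, vtx_zero] at hv
    exact h' (pre_succ_eq_iff.2 ⟨hv, fun k hk => absurd hk (Nat.not_lt_zero k)⟩)
  | succ n =>
    have hsrc : z.vtx n = y.vtx n := by
      simp only [pre, FinPath.path.injEq] at h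
      rw [← z.endpoint, ← y.endpoint, h.1, h.2]
    rw [← tgt_edge, ← tgt_edge] at hv
    rw [pre_succ_eq_iff] at h
    refine h' (pre_succ_eq_iff.2 ⟨h.1, fun k hk => ?_⟩)
    rcases Nat.lt_succ_iff_lt_or_eq.1 hk with hk | rfl
    · exact h.2 k hk
    · exact hs _ _ hsrc hv

variable [Fintype V]

/-- The point of the `ω`-spectrum that belongs to an infinite path. -/
def limitEigenval (B : StationaryBratteli V E) (d : ℕ) (s : ℝ) (z : InfPath B) : ℝ :=
  ∑' k, B.splitTerm d s z k

theorem splitTerm_congr {d : ℕ} {s : ℝ} {z y : InfPath B} {n k : ℕ} (h : z.pre n = y.pre n)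
    (hk : k < n) : B.splitTerm d s z k = B.splitTerm d s y k := by
  rw [splitTerm, splitTerm, pre_eq_of_le hk h, pre_eq_of_le hk.le h]

namespace PFData

variable [Finite E] (hB : B.PFData) {d : ℕ} (hd : 0 < d)

include hB

omit [Finite E] in
theorem mass_pre_succ_ge {c : ℝ} (hc0 : 0 < c) (hc : ∀ v, c ≤ B.pfVector v)
    (z : InfPath B) (n : ℕ) :
    c / B.pfEigenvalue * B.mass (z.pre n) ≤ B.mass (z.pre (n + 1)) := by
  have hpos := hB.eig_pos
  have h1 := hB.mass_le (z.pre n)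
  rw [depth_pre] at h1
  calc c / B.pfEigenvalue * B.mass (z.pre n)
      ≤ c / B.pfEigenvalue * (B.pfEigenvalue * (B.pfEigenvalue ^ n)⁻¹) := by gcongr
    _ = c * (B.pfEigenvalue ^ n)⁻¹ := by field_simp
    _ ≤ B.mass (z.pre (n + 1)) := by
      rw [mass_pre_succ]
      exact mul_le_mul_of_nonneg_right (hc _) (by positivity)

omit [Finite E] in
theorem mass_pre_add_le {c : ℝ} (hc0 : 0 < c) (hc1 : c ≤ 1) (hc : ∀ v, c ≤ B.pfVector v)
    (z : InfPath B) (n k : ℕ) :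
    B.mass (z.pre (n + k)) ≤ B.pfEigenvalue / c * (B.pfEigenvalue⁻¹) ^ k * B.mass (z.pre n) := by
  have hpos := hB.eig_pos
  have h1 := hB.mass_le (z.pre (n + k))
  have h2 := hB.le_mass hc1 hc (z.pre n)
  rw [depth_pre] at h1 h2
  calc _ ≤ _ := h1
    _ = B.pfEigenvalue / c * (B.pfEigenvalue⁻¹) ^ k * (c * (B.pfEigenvalue ^ n)⁻¹) := by
      rw [pow_add, inv_pow]; field_simp
    _ ≤ _ := by gcongr

include hd

theorem mass_antitone (z : InfPath B) : Antitone fun n => B.mass (z.pre n) := by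
  have hprob := (hB.dixmierMeasure_spec hd).1
  intro m n hmn
  simp only [← (hB.dixmierMeasure_spec hd).2]
  exact measureReal_mono (cylinder_pre_subset z hmn)

omit [Finite E] in
theorem coeff_eq (s : ℝ) (γ : FinPath B) : B.coeff d s γ = B.mass γ ^ ((s - 2) / d) *
    (((B.dixmierMeasure d).prod (B.dixmierMeasure d)).real (B.pairs γ))⁻¹ := by
  have hd' : (0 : ℝ) < d := by exact_mod_cast hd
  rw [coeff, hB.weight_rpow, hB.weight_eq, ← Real.rpow_neg (hB.mass_pos γ).le,
    ← Real.rpow_add (hB.mass_pos γ), ← Real.rpow_add (hB.mass_pos γ)]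
  congr 2
  ring

/-- The exponent `s = d(a+1)+2` turns `w^(s-2)` into `mass^(a+1)`. The measure of `B.pairs γ` is
comparable to `mass²` as soon as `γ` branches, because every one-edge extension keeps the proportion
`c/Λ` of the mass. So `coeff · mass` is comparable to `mass^a`. -/
theorem coeff_bounds {c : ℝ} (hc0 : 0 < c) (hc : ∀ v, c ≤ B.pfVector v)
    (a : ℝ) (γ : FinPath B) :
    0 ≤ B.coeff d (d * (a + 1) + 2) γ ∧ B.coeff d (d * (a + 1) + 2) γ * B.mass γ ≤
        ((c / B.pfEigenvalue) ^ 2)⁻¹ * B.mass γ ^ a ∧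
      ((B.pairs γ).Nonempty → B.mass γ ^ a ≤ B.coeff d (d * (a + 1) + 2) γ * B.mass γ) := by
  have hd' : (d : ℝ) ≠ 0 := by exact_mod_cast hd.ne'
  have hprob := (hB.dixmierMeasure_spec hd).1
  have hcyl := (hB.dixmierMeasure_spec hd).2
  have hpos := hB.eig_pos
  have hm := hB.mass_pos γ
  have hma : 0 < B.mass γ ^ a := Real.rpow_pos_of_pos hm a
  have hexp : (d * (a + 1) + 2 - 2) / (d : ℝ) = a + 1 := by field_simp; ring
  rw [hB.coeff_eq hd, hexp, Real.rpow_add hm, Real.rpow_one]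
  set P := ((B.dixmierMeasure d).prod (B.dixmierMeasure d)).real (B.pairs γ) with hP
  have hP0 : 0 ≤ P := measureReal_nonneg
  have hPle : P ≤ B.mass γ * B.mass γ := by
    rw [← hcyl γ, ← measureReal_prod_prod]
    refine measureReal_mono fun p hp => ?_
    rw [mem_pairs_iff] at hp
    exact ⟨mem_cylinder_iff.2 hp.1, mem_cylinder_iff.2 hp.2.1⟩
  have hPge : (B.pairs γ).Nonempty → (c / B.pfEigenvalue) ^ 2 * (B.mass γ * B.mass γ) ≤ P := by
    rintro ⟨p, hp⟩
    rw [mem_pairs_iff] at hp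
    obtain ⟨h1, h2, h3⟩ := hp
    have hsub : B.cylinder (p.1.pre (γ.depth + 1)) ×ˢ B.cylinder (p.2.pre (γ.depth + 1)) ⊆
        B.pairs γ := by
      rintro ⟨x, y⟩ ⟨hx, hy⟩
      rw [mem_cylinder_pre] at hx hy
      refine mem_pairs_iff.2 ⟨(pre_eq_of_le (Nat.le_succ _) hx).trans h1,
        (pre_eq_of_le (Nat.le_succ _) hy).trans h2, ?_⟩
      simp only [] at hx hy ⊢
      rw [hx, hy]
      exact h3
    refine le_trans ?_ (measureReal_mono hsub)
    rw [measureReal_prod_prod, hcyl, hcyl]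
    have e1 := hB.mass_pre_succ_ge hc0 hc p.1 γ.depth
    have e2 := hB.mass_pre_succ_ge hc0 hc p.2 γ.depth
    rw [h1] at e1
    rw [h2] at e2
    have e0 := (hB.mass_pos (p.1.pre (γ.depth + 1))).le
    calc _ = (c / B.pfEigenvalue * B.mass γ) * (c / B.pfEigenvalue * B.mass γ) := by ring
      _ ≤ _ := by gcongr
  refine ⟨by positivity, ?_, fun hne => ?_⟩
  · by_cases hne : (B.pairs γ).Nonempty
    · have hPpos : 0 < P := lt_of_lt_of_le (by positivity) (hPge hne)
      calc B.mass γ ^ a * B.mass γ * P⁻¹ * B.mass γ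
          = B.mass γ ^ a * (B.mass γ * B.mass γ) * P⁻¹ := by ring
        _ ≤ B.mass γ ^ a * (B.mass γ * B.mass γ) *
            ((c / B.pfEigenvalue) ^ 2 * (B.mass γ * B.mass γ))⁻¹ := by
          gcongr
          exact hPge hne
        _ = _ := by field_simp
    · rw [Set.not_nonempty_iff_eq_empty] at hne
      -- Without branching the coefficient is the inverse of `0`, read as `0`, and the upper bound
      -- is trivial.
      have : P = 0 := by rw [hP, hne, measureReal_empty]
      rw [this]
      simp only [inv_zero, mul_zero, zero_mul]
      positivity
  · have hPpos : 0 < P := lt_of_lt_of_le (by positivity) (hPge hne)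
    calc B.mass γ ^ a = B.mass γ ^ a * (B.mass γ * B.mass γ) * (B.mass γ * B.mass γ)⁻¹ := by
          field_simp
      _ ≤ B.mass γ ^ a * (B.mass γ * B.mass γ) * P⁻¹ := by gcongr
      _ = _ := by ring

theorem splitTerm_bounds {c : ℝ} (hc0 : 0 < c) (hc : ∀ v, c ≤ B.pfVector v)
    (a : ℝ) (z : InfPath B) (k : ℕ) :
    0 ≤ B.splitTerm d (d * (a + 1) + 2) z k ∧ B.splitTerm d (d * (a + 1) + 2) z k ≤
        2 * ((c / B.pfEigenvalue) ^ 2)⁻¹ * B.mass (z.pre k) ^ a := by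
  obtain ⟨h1, h2, -⟩ := hB.coeff_bounds hd hc0 hc a (z.pre k)
  have h3 : B.mass (z.pre (k + 1)) ≤ B.mass (z.pre k) := hB.mass_antitone hd z (Nat.le_succ k)
  have h4 := hB.mass_pos (z.pre (k + 1))
  rw [splitTerm]
  constructor
  · exact mul_nonneg (by positivity) (by linarith)
  · nlinarith [mul_nonneg h1 h4.le]

omit hd [Finite E] in
theorem mass_rpow_bounds {c : ℝ} (hc0 : 0 < c) (hc1 : c ≤ 1) (hc : ∀ v, c ≤ B.pfVector v)
    {a : ℝ} (ha : 0 < a) (z : InfPath B) (n : ℕ) :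
    c ^ a * (B.pfEigenvalue ^ (-a)) ^ n ≤ B.mass (z.pre n) ^ a ∧
      B.mass (z.pre n) ^ a ≤ B.pfEigenvalue ^ a * (B.pfEigenvalue ^ (-a)) ^ n := by
  have hpos := hB.eig_pos
  have hpow : (B.pfEigenvalue ^ (-a)) ^ n = ((B.pfEigenvalue ^ n)⁻¹) ^ a := by
    rw [← Real.rpow_natCast, ← Real.rpow_mul hpos.le, Real.inv_rpow (by positivity),
      ← Real.rpow_natCast, ← Real.rpow_mul hpos.le, ← Real.rpow_neg hpos.le]
    congr 1
    ring
  rw [hpow, ← Real.mul_rpow hc0.le (by positivity), ← Real.mul_rpow hpos.le (by positivity)]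
  have h1 := hB.mass_le (z.pre n)
  have h2 := hB.le_mass hc1 hc (z.pre n)
  rw [depth_pre] at h1 h2
  exact ⟨Real.rpow_le_rpow (by positivity) h2 ha.le,
    Real.rpow_le_rpow (hB.mass_pos _).le h1 ha.le⟩

/-- The eigenvalues along an infinite path converge geometrically. -/
theorem exists_eigenval_approx {a : ℝ} (ha : 0 < a) : ∃ K : ℝ, 0 < K ∧ ∀ z : InfPath B,
    Summable (B.splitTerm d (d * (a + 1) + 2) z) ∧ ∀ n,
      |B.eigenval d (d * (a + 1) + 2) z n - B.limitEigenval d (d * (a + 1) + 2) z| ≤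
        K * (B.pfEigenvalue ^ (-a)) ^ n := by
  obtain ⟨c, hc0, hc1, hc⟩ := hB.exists_lower
  have hpos := hB.eig_pos
  set q := B.pfEigenvalue ^ (-a) with hq
  have hq0 : 0 < q := Real.rpow_pos_of_pos hpos _
  have hq1 : q < 1 := Real.rpow_lt_one_of_one_lt_of_neg hB.one_lt (by linarith)
  have h1q : 0 < 1 - q := by linarith
  set M := 2 * ((c / B.pfEigenvalue) ^ 2)⁻¹ * B.pfEigenvalue ^ a with hM
  have hM0 : 0 < M := by positivity
  -- `M` bounds the boundary term of `eigenval`, and `M * (1 - q)⁻¹` the tail of the series that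
  -- `eigenval` lacks.
  refine ⟨M + M * (1 - q)⁻¹, by positivity, fun z => ?_⟩
  have hterm : ∀ k, B.splitTerm d (d * (a + 1) + 2) z k ≤ M * q ^ k := fun k => by
    refine (hB.splitTerm_bounds hd hc0 hc a z k).2.trans ?_
    rw [hM, mul_assoc _ (B.pfEigenvalue ^ a)]
    exact mul_le_mul_of_nonneg_left (hB.mass_rpow_bounds hc0 hc1 hc ha z k).2 (by positivity)
  have hgeo : HasSum (fun k => q ^ k) (1 - q)⁻¹ := hasSum_geometric_of_lt_one hq0.le hq1
  have hnn : ∀ k, 0 ≤ B.splitTerm d (d * (a + 1) + 2) z k := fun k =>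
    (hB.splitTerm_bounds hd hc0 hc a z k).1
  have hsum : Summable (B.splitTerm d (d * (a + 1) + 2) z) :=
    Summable.of_nonneg_of_le hnn hterm (hgeo.summable.mul_left M)
  refine ⟨hsum, fun n => ?_⟩
  rw [eigenval, limitEigenval, ← hsum.sum_add_tsum_nat_add n]
  have hT0 : 0 ≤ ∑' k, B.splitTerm d (d * (a + 1) + 2) z (k + n) :=
    tsum_nonneg fun k => hnn _
  have hT1 : ∑' k, B.splitTerm d (d * (a + 1) + 2) z (k + n) ≤ M * (1 - q)⁻¹ * q ^ n := by
    have h : HasSum (fun k => M * q ^ (k + n)) (M * (1 - q)⁻¹ * q ^ n) := by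
      simpa only [pow_add, mul_assoc] using (hgeo.mul_right (q ^ n)).mul_left M
    rw [← h.tsum_eq]
    exact ((summable_nat_add_iff n).2 hsum).tsum_le_tsum (fun k => hterm _) h.summable
  obtain ⟨h1, h2, -⟩ := hB.coeff_bounds hd hc0 hc a (z.pre n)
  have h3 : 2 * B.coeff d (d * (a + 1) + 2) (z.pre n) * B.mass (z.pre n) ≤ M * q ^ n := by
    have := mul_le_mul_of_nonneg_left (hB.mass_rpow_bounds hc0 hc1 hc ha z n).2
      (by positivity : 0 ≤ 2 * ((c / B.pfEigenvalue) ^ 2)⁻¹)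
    rw [← mul_assoc, ← hM] at this
    linarith
  have h4 : 0 ≤ 2 * B.coeff d (d * (a + 1) + 2) (z.pre n) * B.mass (z.pre n) := by
    have := (hB.mass_pos (z.pre n)).le
    positivity
  have h5 : 0 ≤ M * q ^ n := by positivity
  have h6 : 0 ≤ M * (1 - q)⁻¹ * q ^ n := by positivity
  rw [abs_le]
  constructor <;> linarith

/-- A path that no longer branched would have constant mass, while masses decay like `Λ^(-k)`. -/
theorem exists_pairs_nonempty (z : InfPath B) (n : ℕ) :
    ∃ k, n ≤ k ∧ (B.pairs (z.pre k)).Nonempty := by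
  by_contra! h
  have hcyl := (hB.dixmierMeasure_spec hd).2
  have hconst : ∀ k, n ≤ k → B.mass (z.pre k) = B.mass (z.pre n) := by
    intro k hk
    induction k, hk using Nat.le_induction with
    | base => rfl
    | succ k hk ih =>
      rw [← ih, ← hcyl, ← hcyl]
      congr 1
      refine subset_antisymm (cylinder_pre_subset z (Nat.le_succ k)) fun x hx => ?_
      rw [mem_cylinder_pre] at hx ⊢
      by_contra hne
      have : (x, z) ∈ B.pairs (z.pre k) := mem_pairs_iff.2 (by simpa using ⟨hx, hne⟩)
      rw [h k hk] at this
      exact this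
  have hlim : Tendsto (fun k : ℕ => B.pfEigenvalue * (B.pfEigenvalue ^ k)⁻¹) atTop (𝓝 0) := by
    have h1 := (tendsto_pow_atTop_nhds_zero_of_lt_one (inv_pos.2 hB.eig_pos).le
      (inv_lt_one_of_one_lt₀ hB.one_lt)).const_mul B.pfEigenvalue
    rw [mul_zero] at h1
    exact h1.congr fun k => by rw [inv_pow]
  have hge : ∀ᶠ k in atTop, B.mass (z.pre n) ≤ B.pfEigenvalue * (B.pfEigenvalue ^ k)⁻¹ := by
    filter_upwards [eventually_ge_atTop n] with k hk
    have := hB.mass_le (z.pre k)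
    rwa [depth_pre, hconst k hk] at this
  exact absurd (ge_of_tendsto hlim hge) (not_le.2 (hB.mass_pos _))

/-- The distance of the points of the `ω`-spectrum that belong to two paths that split
at depth `n`. -/
theorem exists_limitEigenval_bounds (hs : B.SimpleEdges) (hinj : Function.Injective B.pfVector) :
    ∃ a₀ : ℝ, 0 < a₀ ∧ ∀ a, a₀ < a → ∃ c C : ℝ, 0 < c ∧ 0 < C ∧ ∀ (z y : InfPath B) (n : ℕ),
      z.pre n = y.pre n → z.pre (n + 1) ≠ y.pre (n + 1) →
      c * (B.pfEigenvalue ^ (-a)) ^ n ≤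
          |B.limitEigenval d (d * (a + 1) + 2) z - B.limitEigenval d (d * (a + 1) + 2) y| ∧
        |B.limitEigenval d (d * (a + 1) + 2) z - B.limitEigenval d (d * (a + 1) + 2) y| ≤
          C * (B.pfEigenvalue ^ (-a)) ^ n := by
  classical
  obtain ⟨c, hc0, hc1, hc⟩ := hB.exists_lower
  have hprob := (hB.dixmierMeasure_spec hd).1
  have hcyl := (hB.dixmierMeasure_spec hd).2
  have hpos := hB.eig_pos
  have hL1 := hB.one_lt
  have hlt := hB.one_lt
  set L := B.pfEigenvalue with hL
  -- `g` is the least gap between coordinates of `ν`. This is where their being distinct is used.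
  obtain ⟨g, hg0, hg⟩ : ∃ g, 0 < g ∧ ∀ u v, u ≠ v → g ≤ |B.pfVector u - B.pfVector v| := by
    by_cases hex : ∃ p : V × V, p.1 ≠ p.2
    · obtain ⟨p0, hp0⟩ := hex
      obtain ⟨p, hp, hmin⟩ := Finset.exists_min_image
        (Finset.univ.filter fun p : V × V => p.1 ≠ p.2)
        (fun p => |B.pfVector p.1 - B.pfVector p.2|) ⟨p0, by simpa using hp0⟩
      refine ⟨_, abs_pos.2 (sub_ne_zero.2 (hinj.ne (Finset.mem_filter.1 hp).2)),
        fun u v huv => hmin (u, v) (by simpa using huv)⟩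
    · push Not at hex
      exact ⟨1, one_pos, fun u v huv => absurd (hex (u, v)) huv⟩
  -- Each one-edge extension has at least the proportion `c0` of the mass, so at a branching path
  -- each one has at most the proportion `1 - c0`.
  set c0 := c / L with hc0'
  have hc0pos : 0 < c0 := by positivity
  have hc0lt : c0 < 1 := by rw [hc0', div_lt_one hpos]; linarith
  set M := 2 * (c0 ^ 2)⁻¹ with hM
  have hM0 : 0 < M := by positivity
  have hLinv : L⁻¹ < 1 := inv_lt_one_of_one_lt₀ hL1
  set K := M * (L / c) * (1 - L⁻¹)⁻¹ with hK
  have hK0 : 0 < K := by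
    have : 0 < 1 - L⁻¹ := by linarith
    positivity
  have hlim := (tendsto_rpow_atTop_of_base_lt_one (1 - c0) (by linarith) (by linarith)).const_mul K
  rw [mul_zero] at hlim
  -- The threshold for `a`: beyond it the tails are below `g/L · m^a`, half of the guaranteed
  -- difference at the split.
  obtain ⟨b₀, hb₀⟩ := eventually_atTop.1 (hlim.eventually_lt_const (show (0 : ℝ) < g / L by positivity))
  refine ⟨max 1 (b₀ + 1), by positivity, fun a ha => ?_⟩
  have ha1 : 1 < a := (le_max_left _ _).trans_lt ha
  have ha0 : 0 < a := by linarith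
  have hsmall : K * (1 - c0) ^ (a - 1) < g / L :=
    hb₀ _ (by have := (le_max_right 1 (b₀ + 1)).trans_lt ha; linarith)
  refine ⟨g / L * c ^ a, (M + g / L) * L ^ a, by positivity, by positivity,
    fun z y n hzy hne => ?_⟩
  set S := B.splitTerm d (d * (a + 1) + 2) with hS
  set m := B.mass (z.pre n) with hm
  have hmpos : 0 < m := hB.mass_pos _
  have hmy : B.mass (y.pre n) = m := by rw [← hzy]
  -- the part of the sum beyond the split
  have htail : ∀ x : InfPath B, B.mass (x.pre n) = m → B.mass (x.pre (n + 1)) ≤ (1 - c0) * m →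
      0 ≤ ∑' k, S x (k + (n + 1)) ∧ ∑' k, S x (k + (n + 1)) ≤ g / L * m ^ a := by
    intro x hx0 hx1
    have hnn : ∀ k, 0 ≤ S x k := fun k => (hB.splitTerm_bounds hd hc0 hc a x k).1
    have hterm : ∀ k, S x (k + (n + 1)) ≤
        M * (L / c) * (1 - c0) ^ (a - 1) * m ^ a * (L⁻¹) ^ k := by
      intro k
      refine (hB.splitTerm_bounds hd hc0 hc a x _).2.trans ?_
      set mk := B.mass (x.pre (k + (n + 1))) with hmk
      have hmkpos : 0 < mk := hB.mass_pos _
      have h1 : mk ≤ (1 - c0) * m :=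
        (hB.mass_antitone hd x (by omega : n + 1 ≤ k + (n + 1))).trans hx1
      have h2 : mk ≤ L / c * (L⁻¹) ^ k * m := by
        have h3 := hB.mass_pre_add_le hc0 hc1 hc x n (k + 1)
        rw [hx0, show n + (k + 1) = k + (n + 1) by ring] at h3
        refine h3.trans ?_
        have : (L⁻¹) ^ (k + 1) ≤ (L⁻¹) ^ k :=
          pow_le_pow_of_le_one (by positivity) hLinv.le (Nat.le_succ k)
        gcongr
      -- In `mk^a = mk^(a-1) · mk` the first factor supplies the small constant `(1-c0)^(a-1)`, the
      -- second the geometric decay in `k`, at a rate independent of `a`.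
      have h4 : mk ^ a ≤ ((1 - c0) * m) ^ (a - 1) * (L / c * (L⁻¹) ^ k * m) := by
        have : mk ^ a = mk ^ (a - 1) * mk := by
          conv_rhs => rw [← Real.rpow_one mk, ← Real.rpow_mul hmkpos.le, one_mul,
            ← Real.rpow_add hmkpos, sub_add_cancel]
        rw [this]
        exact mul_le_mul (Real.rpow_le_rpow hmkpos.le h1 (by linarith)) h2 hmkpos.le
          (Real.rpow_nonneg (by nlinarith) _)
      have h5 : m ^ a = m ^ (a - 1) * m := by
        conv_rhs => rw [← Real.rpow_one m, ← Real.rpow_mul hmpos.le, one_mul,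
          ← Real.rpow_add hmpos, sub_add_cancel]
      rw [Real.mul_rpow (by linarith) hmpos.le] at h4
      calc 2 * (c0 ^ 2)⁻¹ * mk ^ a
          ≤ M * ((1 - c0) ^ (a - 1) * m ^ (a - 1) * (L / c * (L⁻¹) ^ k * m)) :=
            mul_le_mul_of_nonneg_left h4 hM0.le
        _ = _ := by rw [h5]; ring
    have hgeo : HasSum (fun k => M * (L / c) * (1 - c0) ^ (a - 1) * m ^ a * (L⁻¹) ^ k)
        (M * (L / c) * (1 - c0) ^ (a - 1) * m ^ a * (1 - L⁻¹)⁻¹) :=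
      (hasSum_geometric_of_lt_one (by positivity) hLinv).mul_left _
    have hsum : Summable fun k => S x (k + (n + 1)) :=
      Summable.of_nonneg_of_le (fun k => hnn _) hterm hgeo.summable
    refine ⟨tsum_nonneg fun k => hnn _, (hsum.tsum_le_tsum hterm hgeo.summable).trans ?_⟩
    rw [hgeo.tsum_eq]
    calc _ = K * (1 - c0) ^ (a - 1) * m ^ a := by rw [hK]; ring
      _ ≤ _ := mul_le_mul_of_nonneg_right hsmall.le (Real.rpow_nonneg hmpos.le _)
  -- the children have smaller mass
  have hchild : ∀ x w : InfPath B, x.pre n = w.pre n → x.pre (n + 1) ≠ w.pre (n + 1) →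
      B.mass (x.pre n) = m → B.mass (x.pre (n + 1)) ≤ (1 - c0) * m := by
    intro x w hxw hxw' hxm
    have h1 : B.mass (x.pre (n + 1)) + B.mass (w.pre (n + 1)) ≤ m := by
      rw [← hcyl, ← hcyl, ← hxm, ← hcyl, ← measureReal_union]
      · refine measureReal_mono (Set.union_subset (cylinder_pre_subset x (Nat.le_succ n)) ?_)
        rw [hxw]
        exact cylinder_pre_subset w (Nat.le_succ n)
      · exact pairwise_disjoint_cylinder (by simp) hxw'
      · exact measurableSet_cylinder _
    have h2 := hB.mass_pre_succ_ge hc0 hc w n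
    rw [← hxw, hxm] at h2
    linarith
  obtain ⟨hTz0, hTz1⟩ := htail z rfl (hchild z y hzy hne rfl)
  obtain ⟨hTy0, hTy1⟩ := htail y hmy (hchild y z hzy.symm hne.symm hmy)
  have hexp : ∀ x : InfPath B, B.limitEigenval d (d * (a + 1) + 2) x =
      (∑ k ∈ Finset.range n, S x k + S x n) + ∑' k, S x (k + (n + 1)) := by
    intro x
    obtain ⟨_, -, hsx⟩ := hB.exists_eigenval_approx hd ha0
    rw [limitEigenval, ← (hsx x).1.sum_add_tsum_nat_add (n + 1), Finset.sum_range_succ]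
  have hcommon : ∑ k ∈ Finset.range n, S z k = ∑ k ∈ Finset.range n, S y k :=
    Finset.sum_congr rfl fun k hk => splitTerm_congr hzy (Finset.mem_range.1 hk)
  obtain ⟨hG0, hG1, hG2⟩ := hB.coeff_bounds hd hc0 hc a (z.pre n)
  set G := B.coeff d (d * (a + 1) + 2) (z.pre n) with hG
  have hGne := hG2 ⟨(z, y), mem_pairs_iff.2 (by simpa using ⟨hzy.symm, hne⟩)⟩
  -- The coefficient belongs to the common prefix, so the terms at the split differ only by the
  -- masses of the two extensions.
  have hmain : S z n - S y n = 2 * G * (B.mass (y.pre (n + 1)) - B.mass (z.pre (n + 1))) := by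
    rw [hS, splitTerm, splitTerm, ← hzy]
    ring
  have hgap : g / L * m ≤ |B.mass (y.pre (n + 1)) - B.mass (z.pre (n + 1))| := by
    rw [mass_pre_succ, mass_pre_succ, ← sub_mul, abs_mul,
      abs_of_pos (inv_pos.2 (pow_pos hpos n))]
    have h1 := hB.mass_le (z.pre n)
    rw [depth_pre] at h1
    calc g / L * m ≤ g / L * (L * (L ^ n)⁻¹) := by gcongr
      _ = g * (L ^ n)⁻¹ := by field_simp
      _ ≤ _ := by
        gcongr
        exact hg _ _ (vtx_ne_of_split hs hzy hne).symm
  have hgap' : |B.mass (y.pre (n + 1)) - B.mass (z.pre (n + 1))| ≤ m := by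
    have h1 := hB.mass_antitone hd z (Nat.le_succ n)
    have h2 := hB.mass_antitone hd y (Nat.le_succ n)
    simp only [hmy] at h2
    have h3 := hB.mass_pos (z.pre (n + 1))
    have h4 := hB.mass_pos (y.pre (n + 1))
    rw [abs_le]
    constructor <;> linarith
  have hma : 0 < m ^ a := Real.rpow_pos_of_pos hmpos a
  have hmainlow : 2 * (g / L * m ^ a) ≤ |S z n - S y n| := by
    rw [hmain, abs_mul, abs_of_nonneg (by positivity)]
    calc 2 * (g / L * m ^ a) ≤ 2 * (g / L * (G * m)) := by gcongr
      _ = 2 * G * (g / L * m) := by ring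
      _ ≤ _ := by gcongr
  have hmainup : |S z n - S y n| ≤ M * m ^ a := by
    rw [hmain, abs_mul, abs_of_nonneg (by positivity)]
    calc _ ≤ 2 * G * m := by gcongr
      _ = 2 * (G * m) := by ring
      _ ≤ 2 * ((c0 ^ 2)⁻¹ * m ^ a) := by gcongr
      _ = _ := by rw [hM]; ring
  have hdiff : B.limitEigenval d (d * (a + 1) + 2) z - B.limitEigenval d (d * (a + 1) + 2) y =
      (S z n - S y n) + (∑' k, S z (k + (n + 1)) - ∑' k, S y (k + (n + 1))) := by
    rw [hexp, hexp, hcommon]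
    ring
  -- Both tails lie in the interval from `0` to `g/L · m^a`, so their difference costs this amount
  -- once, and half of `hmainlow` survives.
  have htd : |∑' k, S z (k + (n + 1)) - ∑' k, S y (k + (n + 1))| ≤ g / L * m ^ a := by
    rw [abs_le]
    constructor <;> linarith
  obtain ⟨hb1, hb2⟩ := hB.mass_rpow_bounds hc0 hc1 hc ha0 z n
  rw [hdiff]
  constructor
  · have h1 := abs_sub_abs_le_abs_sub (S z n - S y n)
      (-(∑' k, S z (k + (n + 1)) - ∑' k, S y (k + (n + 1))))
    rw [abs_neg, sub_neg_eq_add] at h1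
    calc g / L * c ^ a * (L ^ (-a)) ^ n = g / L * (c ^ a * (L ^ (-a)) ^ n) := by ring
      _ ≤ g / L * m ^ a := by gcongr
      _ ≤ _ := by linarith
  · calc _ ≤ (M + g / L) * m ^ a := by
          refine (abs_add_le _ _).trans ?_
          linarith
      _ ≤ (M + g / L) * (L ^ a * (L ^ (-a)) ^ n) := by gcongr
      _ = _ := by ring

/-- Each path branches infinitely often and its eigenvalues converge to its limit, so the range lies
in the `ω`-spectrum. Conversely, eigenvalues of great depth are uniformly close to the range, which
is closed as the continuous image of a compact space. -/
theorem range_limitEigenval {a : ℝ} (ha : 0 < a) {C : ℝ}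
    (hC : ∀ (z y : InfPath B) (n : ℕ), z.pre n = y.pre n → z.pre (n + 1) ≠ y.pre (n + 1) →
      |B.limitEigenval d (d * (a + 1) + 2) z - B.limitEigenval d (d * (a + 1) + 2) y| ≤
          C * (B.pfEigenvalue ^ (-a)) ^ n) :
    Set.range (B.limitEigenval d (d * (a + 1) + 2)) = B.omegaSpectrum d (d * (a + 1) + 2) := by
  have hpos := hB.eig_pos
  obtain ⟨K, hK0, hK⟩ := hB.exists_eigenval_approx hd ha
  set q := B.pfEigenvalue ^ (-a) with hq
  have hq0 : 0 < q := Real.rpow_pos_of_pos hpos _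
  have hq1 : q < 1 := Real.rpow_lt_one_of_one_lt_of_neg hB.one_lt (by linarith)
  have hqlim : ∀ D : ℝ, Tendsto (fun n : ℕ => D * q ^ n) atTop (𝓝 0) := fun D => by
    have := (tendsto_pow_atTop_nhds_zero_of_lt_one hq0.le hq1).const_mul D
    rwa [mul_zero] at this
  set F := B.limitEigenval d (d * (a + 1) + 2) with hF
  have hcont : Continuous F := by
    rw [continuous_iff_continuousAt]
    intro x
    rw [ContinuousAt, Metric.tendsto_nhds]
    intro ε hε
    obtain ⟨N, hN⟩ := eventually_atTop.1 ((hqlim C).eventually_lt_const hε)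
    filter_upwards [(nhds_le_iff x (𝓝 x)).1 le_rfl N] with y hy
    by_cases hxy : y = x
    · rwa [hxy, dist_self]
    · obtain ⟨n, h1, hmin⟩ := InfPath.exists_split hxy
      have hNn : N ≤ n := by
        by_contra hlt
        exact hmin (pre_eq_of_le (by omega) hy)
      rw [Real.dist_eq]
      exact (hC y x n h1 hmin).trans_lt (hN n hNn)
  have hclosed : IsClosed (Set.range F) := (isCompact_range hcont).isClosed
  refine subset_antisymm ?_ fun r hr => ?_
  · rintro _ ⟨z, rfl⟩
    refine Set.mem_iInter.2 fun n => Metric.mem_closure_iff.2 fun ε hε => ?_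
    obtain ⟨N, hN⟩ := eventually_atTop.1 ((hqlim K).eventually_lt_const hε)
    obtain ⟨k, hk, hkp⟩ := hB.exists_pairs_nonempty hd z (max n N)
    refine ⟨_, (hB.tailEigenvalues_eq hd _ n).symm.subset
      ⟨z, k, (le_max_left _ _).trans hk, hkp, rfl⟩, ?_⟩
    rw [dist_comm, Real.dist_eq]
    exact ((hK z).2 k).trans_lt (hN k ((le_max_right _ _).trans hk))
  · rw [← hclosed.closure_eq]
    refine Metric.mem_closure_iff.2 fun ε hε => ?_
    obtain ⟨N, hN⟩ := eventually_atTop.1 ((hqlim K).eventually_lt_const (half_pos hε))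
    obtain ⟨b, hb, hrb⟩ := Metric.mem_closure_iff.1 (Set.mem_iInter.1 hr N) (ε / 2) (half_pos hε)
    rw [hB.tailEigenvalues_eq hd] at hb
    obtain ⟨z, k, hk, -, rfl⟩ := hb
    refine ⟨F z, ⟨z, rfl⟩,
      (dist_triangle r (B.eigenval d (d * (a + 1) + 2) z k) (F z)).trans_lt ?_⟩
    have h1 := ((hK z).2 k).trans_lt (hN k hk)
    rw [← Real.dist_eq] at h1
    linarith

end PFData

end StationaryBratteli

namespace TileSubstitution

variable {d : ℕ} {ι : Type*} (σ : TileSubstitution d ι)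

/-! ### Tiles -/

theorem mem_tileSupp {t : ι × EuclideanSpace ℝ (Fin d)} {p : EuclideanSpace ℝ (Fin d)} :
    p ∈ σ.tileSupp t ↔ p - t.2 ∈ σ.supp t.1 := Iff.rfl

theorem tileSupp_eq (t : ι × EuclideanSpace ℝ (Fin d)) :
    σ.tileSupp t = Homeomorph.subRight t.2 ⁻¹' σ.supp t.1 := rfl

theorem interior_tileSupp (t : ι × EuclideanSpace ℝ (Fin d)) :
    interior (σ.tileSupp t) = {p | p - t.2 ∈ interior (σ.supp t.1)} := by
  rw [tileSupp_eq, ← Homeomorph.preimage_interior]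
  rfl

theorem closure_interior_tileSupp (t : ι × EuclideanSpace ℝ (Fin d)) :
    closure (interior (σ.tileSupp t)) = σ.tileSupp t := by
  rw [tileSupp_eq, ← Homeomorph.preimage_interior, ← Homeomorph.preimage_closure,
    σ.closure_interior_supp]

theorem puncture_mem_interior (t : ι × EuclideanSpace ℝ (Fin d)) :
    t.2 ∈ interior (σ.tileSupp t) := by
  rw [interior_tileSupp, Set.mem_ofPred_eq, sub_self]
  exact σ.zero_mem_interior _

theorem puncture_mem (t : ι × EuclideanSpace ℝ (Fin d)) : t.2 ∈ σ.tileSupp t :=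
  interior_subset (σ.puncture_mem_interior t)

theorem mem_tileSupp_add {i : ι} {x v p : EuclideanSpace ℝ (Fin d)} :
    p + v ∈ σ.tileSupp (i, x + v) ↔ p ∈ σ.tileSupp (i, x) := by
  simp [mem_tileSupp]

theorem exists_supp_bound [Finite ι] : ∃ R, 0 < R ∧ ∀ i, ∀ p ∈ σ.supp i, ‖p‖ ≤ R := by
  have : Bornology.IsBounded (⋃ i, σ.supp i) :=
    (Bornology.isBounded_iUnion).2 fun i => (σ.isCompact_supp i).isBounded
  obtain ⟨R, hR0, hR⟩ := this.exists_pos_norm_le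
  exact ⟨R, hR0, fun i p hp => hR p (Set.mem_iUnion.2 ⟨i, hp⟩)⟩

theorem exists_inradius [Finite ι] : ∃ ρ, 0 < ρ ∧ ∀ i, Metric.ball 0 ρ ⊆ σ.supp i := by
  have h : ∀ i, ∀ᶠ r in 𝓝[>] (0 : ℝ), Metric.ball 0 r ⊆ σ.supp i := fun i => by
    obtain ⟨ρ, hρ, h⟩ := Metric.mem_nhds_iff.1
      (mem_interior_iff_mem_nhds.1 (σ.zero_mem_interior i))
    filter_upwards [Ioo_mem_nhdsGT hρ] with r hr
    exact (Metric.ball_subset_ball hr.2.le).trans h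
  obtain ⟨r, hr, hr0⟩ := ((eventually_all.2 h).and self_mem_nhdsWithin).exists
  exact ⟨r, hr0, hr⟩

/-- A set of tiles with pairwise disjoint interiors. -/
def IsPacking (T : Set (ι × EuclideanSpace ℝ (Fin d))) : Prop :=
  ∀ t ∈ T, ∀ t' ∈ T, t ≠ t' → Disjoint (interior (σ.tileSupp t)) (interior (σ.tileSupp t'))

variable {σ}

theorem IsTiling.isPacking {T : Set (ι × EuclideanSpace ℝ (Fin d))} (h : σ.IsTiling T) :
    σ.IsPacking T := h.2

theorem IsTiling.exists_mem {T : Set (ι × EuclideanSpace ℝ (Fin d))} (h : σ.IsTiling T)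
    (p : EuclideanSpace ℝ (Fin d)) : ∃ t ∈ T, p ∈ σ.tileSupp t := by
  have : p ∈ ⋃ t ∈ T, σ.tileSupp t := h.1 ▸ Set.mem_univ p
  simpa using this

/-- A tile is the closure of its interior. So a point interior to one tile and merely contained in
the other already makes the interiors meet. -/
theorem IsPacking.eq_of_mem {T : Set (ι × EuclideanSpace ℝ (Fin d))} (h : σ.IsPacking T)
    {t t' : ι × EuclideanSpace ℝ (Fin d)} (ht : t ∈ T) (ht' : t' ∈ T)
    {p : EuclideanSpace ℝ (Fin d)} (hp : p ∈ interior (σ.tileSupp t)) (hp' : p ∈ σ.tileSupp t') :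
    t = t' := by
  by_contra hne
  rw [← closure_interior_tileSupp, mem_closure_iff] at hp'
  obtain ⟨q, hq, hq'⟩ := hp' _ isOpen_interior hp
  exact Set.disjoint_left.1 (h t ht t' ht' hne) hq hq'

theorem isPacking_singleton (t : ι × EuclideanSpace ℝ (Fin d)) : σ.IsPacking {t} := by
  rintro _ rfl _ rfl h
  exact absurd rfl h

/-- A tiling leaves no room: the puncture of an additional tile would be covered already. -/
theorem IsTiling.eq_of_subset {T T' : Set (ι × EuclideanSpace ℝ (Fin d))} (hT : σ.IsTiling T)
    (hT' : σ.IsTiling T') (h : T ⊆ T') : T = T' := by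
  refine h.antisymm fun t ht => ?_
  obtain ⟨t', ht', hp⟩ := hT.exists_mem t.2
  rwa [hT'.isPacking.eq_of_mem ht (h ht') (σ.puncture_mem_interior t) hp]

/-! ### Translations -/

theorem mem_translate {v : EuclideanSpace ℝ (Fin d)} {T : Set (ι × EuclideanSpace ℝ (Fin d))}
    {t : ι × EuclideanSpace ℝ (Fin d)} : t ∈ translate v T ↔ (t.1, t.2 - v) ∈ T := by
  constructor
  · rintro ⟨s, hs, rfl⟩
    simpa using hs
  · intro h
    exact ⟨_, h, by simp⟩

theorem translate_mono {v : EuclideanSpace ℝ (Fin d)} {T T' : Set (ι × EuclideanSpace ℝ (Fin d))}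
    (h : T ⊆ T') : translate v T ⊆ translate v T' := Set.image_mono h

theorem translate_translate (v w : EuclideanSpace ℝ (Fin d))
    (T : Set (ι × EuclideanSpace ℝ (Fin d))) :
    translate v (translate w T) = translate (w + v) T := by
  ext t
  simp only [mem_translate]
  rw [sub_sub, add_comm v w]

theorem translate_zero (T : Set (ι × EuclideanSpace ℝ (Fin d))) : translate 0 T = T := by
  ext t
  simp [mem_translate]

theorem translate_neg_translate (v : EuclideanSpace ℝ (Fin d))
    (T : Set (ι × EuclideanSpace ℝ (Fin d))) : translate (-v) (translate v T) = T := by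
  rw [translate_translate, add_neg_cancel, translate_zero]

theorem translate_singleton (v : EuclideanSpace ℝ (Fin d)) (t : ι × EuclideanSpace ℝ (Fin d)) :
    translate v {t} = {(t.1, t.2 + v)} := Set.image_singleton

theorem interior_tileSupp_translate {i : ι} {x v p : EuclideanSpace ℝ (Fin d)} :
    p ∈ interior (σ.tileSupp (i, x - v)) ↔ p + v ∈ interior (σ.tileSupp (i, x)) := by
  simp only [interior_tileSupp, Set.mem_ofPred_eq]
  rw [sub_sub_eq_add_sub]

theorem IsPacking.translate {T : Set (ι × EuclideanSpace ℝ (Fin d))} (h : σ.IsPacking T)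
    (v : EuclideanSpace ℝ (Fin d)) : σ.IsPacking (translate v T) := by
  intro t ht t' ht' hne
  rw [mem_translate] at ht ht'
  have hne' : (t.1, t.2 - v) ≠ (t'.1, t'.2 - v) := fun h' => hne (by
    simp only [Prod.mk.injEq, sub_left_inj] at h'
    exact Prod.ext h'.1 h'.2)
  have hd := h _ ht _ ht' hne'
  rw [Set.disjoint_left] at hd ⊢
  intro p hp hp'
  have : p - v + v = p := sub_add_cancel p v
  rw [← this] at hp hp'
  exact hd (interior_tileSupp_translate.2 hp) (interior_tileSupp_translate.2 hp')

theorem IsTiling.translate {T : Set (ι × EuclideanSpace ℝ (Fin d))} (h : σ.IsTiling T)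
    (v : EuclideanSpace ℝ (Fin d)) : σ.IsTiling (translate v T) := by
  refine ⟨Set.eq_univ_of_forall fun p => ?_, h.isPacking.translate v⟩
  obtain ⟨t, ht, hp⟩ := h.exists_mem (p - v)
  refine Set.mem_biUnion (x := (t.1, t.2 + v)) (mem_translate.2 (by simpa using ht)) ?_
  rw [mem_tileSupp] at hp ⊢
  simpa [sub_sub, add_comm] using hp

theorem translate_mem_tilingSpace {T : Set (ι × EuclideanSpace ℝ (Fin d))}
    (h : T ∈ σ.tilingSpace) (v : EuclideanSpace ℝ (Fin d)) : translate v T ∈ σ.tilingSpace := by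
  classical
  refine ⟨h.1.translate v, fun P hP => ?_⟩
  obtain ⟨i, n, w, hw⟩ := h.2 (P.image fun t => (t.1, t.2 - v)) (by
    intro t ht
    simp only [Finset.coe_image, Set.mem_image, Finset.mem_coe] at ht
    obtain ⟨s, hs, rfl⟩ := ht
    exact mem_translate.1 (hP hs))
  refine ⟨i, n, w + v, fun t ht => ?_⟩
  have := hw (Finset.mem_coe.2 (Finset.mem_image_of_mem _ ht))
  rw [mem_translate] at this ⊢
  simpa [sub_sub, add_comm] using this

/-! ### Substitution -/

theorem subst_mono {T T' : Set (ι × EuclideanSpace ℝ (Fin d))} (h : T ⊆ T') :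
    σ.subst T ⊆ σ.subst T' := by
  rintro t ⟨p, hp, q, hq, rfl⟩
  exact ⟨p, h hp, q, hq, rfl⟩

theorem iterate_subst_mono {T T' : Set (ι × EuclideanSpace ℝ (Fin d))} (h : T ⊆ T') (n : ℕ) :
    σ.subst^[n] T ⊆ σ.subst^[n] T' := by
  induction n generalizing T T' with
  | zero => exact h
  | succ n ih => exact ih (subst_mono h)

theorem subst_translate (v : EuclideanSpace ℝ (Fin d)) (T : Set (ι × EuclideanSpace ℝ (Fin d))) :
    σ.subst (translate v T) = translate (σ.lam • v) (σ.subst T) := by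
  ext t
  rw [mem_translate]
  constructor
  · rintro ⟨p, hp, q, hq, rfl⟩
    exact ⟨_, mem_translate.1 hp, q, hq, Prod.ext rfl (by rw [smul_sub]; exact add_sub_right_comm _ _ _)⟩
  · rintro ⟨p, hp, q, hq, h⟩
    refine ⟨(p.1, p.2 + v), mem_translate.2 (by simpa using hp), q, hq, ?_⟩
    rw [Prod.mk.injEq] at h
    refine Prod.ext h.1 ?_
    rw [sub_eq_iff_eq_add.1 h.2, smul_add]
    exact add_right_comm _ _ _

theorem iterate_subst_translate (v : EuclideanSpace ℝ (Fin d)) (n : ℕ) :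
    ∀ T : Set (ι × EuclideanSpace ℝ (Fin d)),
      σ.subst^[n] (translate v T) = translate (σ.lam ^ n • v) (σ.subst^[n] T) := by
  induction n with
  | zero => intro T; simp
  | succ n ih =>
    intro T
    rw [Function.iterate_succ_apply', ih, subst_translate, ← Function.iterate_succ_apply' σ.subst,
      smul_smul, ← pow_succ']

theorem iterate_subst_singleton (t : ι × EuclideanSpace ℝ (Fin d)) (n : ℕ) :
    σ.subst^[n] {t} = translate (σ.lam ^ n • t.2) (σ.subst^[n] {(t.1, 0)}) := by
  rw [← iterate_subst_translate, translate_singleton, zero_add]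

theorem mem_subst {T : Set (ι × EuclideanSpace ℝ (Fin d))} {t : ι × EuclideanSpace ℝ (Fin d)} :
    t ∈ σ.subst T ↔ ∃ a ∈ T, t ∈ σ.subst {a} := by
  constructor
  · rintro ⟨p, hp, q, hq, rfl⟩
    exact ⟨p, hp, p, rfl, q, hq, rfl⟩
  · rintro ⟨a, ha, h⟩
    exact subst_mono (Set.singleton_subset_iff.2 ha) h

theorem mem_iterate_subst (n : ℕ) : ∀ {T : Set (ι × EuclideanSpace ℝ (Fin d))}
    {t : ι × EuclideanSpace ℝ (Fin d)}, t ∈ σ.subst^[n] T ↔ ∃ a ∈ T, t ∈ σ.subst^[n] {a} := by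
  induction n with
  | zero => intro T t; simp
  | succ n ih =>
    intro T t
    constructor
    · intro h
      rw [Function.iterate_succ_apply, ih] at h
      obtain ⟨b, hb, hb'⟩ := h
      obtain ⟨a, ha, ha'⟩ := mem_subst.1 hb
      refine ⟨a, ha, ?_⟩
      rw [Function.iterate_succ_apply, ih]
      exact ⟨b, ha', hb'⟩
    · rintro ⟨a, ha, h⟩
      exact iterate_subst_mono (Set.singleton_subset_iff.2 ha) _ h

theorem iterate_subst_subset_of_mem {T : Set (ι × EuclideanSpace ℝ (Fin d))}
    {t : ι × EuclideanSpace ℝ (Fin d)} {k : ℕ} (h : t ∈ σ.subst^[k] T) (n : ℕ) :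
    σ.subst^[n] {t} ⊆ σ.subst^[n + k] T := by
  rw [Function.iterate_add_apply]
  exact iterate_subst_mono (Set.singleton_subset_iff.2 h) n

variable (σ) in
theorem lam_pos : 0 < σ.lam := one_pos.trans σ.one_lt_lam

variable (σ) in
theorem lam_pow_pos (n : ℕ) : 0 < σ.lam ^ n := pow_pos σ.lam_pos n

variable (σ) in
theorem lam_pow_ne (n : ℕ) : σ.lam ^ n ≠ 0 := (σ.lam_pow_pos n).ne'

theorem exists_subst_mem {a : ι × EuclideanSpace ℝ (Fin d)} {p : EuclideanSpace ℝ (Fin d)}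
    (hp : p ∈ σ.tileSupp a) : ∃ t ∈ σ.subst {a}, σ.lam • p ∈ σ.tileSupp t := by
  have h : σ.lam • (p - a.2) ∈ (fun p => σ.lam • p) '' σ.supp a.1 := ⟨_, hp, rfl⟩
  rw [← σ.sub_cover] at h
  simp only [Set.mem_iUnion, exists_prop] at h
  obtain ⟨q, hq, h⟩ := h
  refine ⟨_, ⟨a, rfl, q, hq, rfl⟩, ?_⟩
  rw [mem_tileSupp]
  simpa [smul_sub, sub_sub] using h

theorem tileSupp_of_mem_subst {a t : ι × EuclideanSpace ℝ (Fin d)} (ht : t ∈ σ.subst {a})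
    {p : EuclideanSpace ℝ (Fin d)} (hp : p ∈ σ.tileSupp t) : σ.lam⁻¹ • p ∈ σ.tileSupp a := by
  obtain ⟨a, rfl, q, hq, rfl⟩ := ht
  rw [mem_tileSupp] at hp
  have h : p - σ.lam • a.2 ∈ ⋃ t ∈ σ.sub a.1, {p | p - t.2 ∈ σ.supp t.1} := by
    refine Set.mem_biUnion (x := q) hq ?_
    simpa [sub_sub] using hp
  rw [σ.sub_cover] at h
  obtain ⟨r, hr, h⟩ := h
  have : σ.lam⁻¹ • p - a.2 = r := by
    have hl := σ.lam_pos.ne'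
    rw [eq_sub_iff_add_eq] at h
    simp only at h
    rw [← h, smul_add, smul_smul, smul_smul, inv_mul_cancel₀ hl, one_smul, one_smul,
      add_sub_cancel_right]
  rw [mem_tileSupp, this]
  exact hr

theorem exists_iterate_subst_mem (n : ℕ) {T : Set (ι × EuclideanSpace ℝ (Fin d))}
    {a : ι × EuclideanSpace ℝ (Fin d)} (ha : a ∈ T)
    {p : EuclideanSpace ℝ (Fin d)} (hp : p ∈ σ.tileSupp a) :
    ∃ t ∈ σ.subst^[n] T, σ.lam ^ n • p ∈ σ.tileSupp t := by
  induction n with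
  | zero => exact ⟨a, ha, by simpa using hp⟩
  | succ n ih =>
    obtain ⟨t, ht, h⟩ := ih
    obtain ⟨s, hs, h'⟩ := exists_subst_mem h
    refine ⟨s, ?_, ?_⟩
    · rw [Function.iterate_succ_apply']
      exact subst_mono (Set.singleton_subset_iff.2 ht) hs
    · rwa [smul_smul, ← pow_succ'] at h'

theorem tileSupp_of_mem_iterate_subst (n : ℕ) {a t : ι × EuclideanSpace ℝ (Fin d)}
    (ht : t ∈ σ.subst^[n] {a}) {p : EuclideanSpace ℝ (Fin d)} (hp : p ∈ σ.tileSupp t) :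
    (σ.lam ^ n)⁻¹ • p ∈ σ.tileSupp a := by
  induction n generalizing t p with
  | zero =>
    obtain rfl : t = a := ht
    simpa using hp
  | succ n ih =>
    rw [Function.iterate_succ_apply', mem_subst] at ht
    obtain ⟨b, hb, ht⟩ := ht
    have := ih hb (tileSupp_of_mem_subst ht hp)
    rwa [smul_smul, ← mul_inv, ← pow_succ] at this

theorem interior_of_mem_iterate_subst (n : ℕ) {a t : ι × EuclideanSpace ℝ (Fin d)}
    (ht : t ∈ σ.subst^[n] {a}) {p : EuclideanSpace ℝ (Fin d)}
    (hp : p ∈ interior (σ.tileSupp t)) : (σ.lam ^ n)⁻¹ • p ∈ interior (σ.tileSupp a) := by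
  let e := Homeomorph.smulOfNeZero (α := EuclideanSpace ℝ (Fin d)) ((σ.lam ^ n)⁻¹)
    (inv_ne_zero (σ.lam_pow_ne n))
  have h1 : σ.tileSupp t ⊆ e ⁻¹' σ.tileSupp a := fun q hq =>
    tileSupp_of_mem_iterate_subst n ht hq
  have h2 := interior_mono h1 hp
  rw [← Homeomorph.preimage_interior] at h2
  exact h2

theorem IsPacking.subst {T : Set (ι × EuclideanSpace ℝ (Fin d))} (h : σ.IsPacking T) :
    σ.IsPacking (σ.subst T) := by
  intro t ht t' ht' hne
  rw [Set.disjoint_left]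
  intro p hp hp'
  rw [mem_subst] at ht ht'
  obtain ⟨a, ha, hta⟩ := ht
  obtain ⟨a', ha', hta'⟩ := ht'
  have h1 := interior_of_mem_iterate_subst 1 hta hp
  have h2 := interior_of_mem_iterate_subst 1 hta' hp'
  obtain rfl := h.eq_of_mem ha ha' h1 (interior_subset h2)
  obtain ⟨_, rfl, q, hq, rfl⟩ := hta
  obtain ⟨a, rfl, q', hq', rfl⟩ := hta'
  have hne' : q ≠ q' := by rintro rfl; exact hne rfl
  have hd := σ.sub_disjoint _ q hq q' hq' hne'
  have hmem : ∀ q : ι × EuclideanSpace ℝ (Fin d),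
      p ∈ interior (σ.tileSupp (q.1, σ.lam • a.2 + q.2)) →
      p - σ.lam • a.2 ∈ interior {p | p - q.2 ∈ σ.supp q.1} := by
    intro q hp
    change _ ∈ interior (σ.tileSupp q)
    rw [interior_tileSupp] at hp ⊢
    simpa [sub_sub] using hp
  exact Set.disjoint_left.1 hd (hmem q hp) (hmem q' hp')

theorem IsPacking.iterate_subst {T : Set (ι × EuclideanSpace ℝ (Fin d))} (h : σ.IsPacking T)
    (n : ℕ) : σ.IsPacking (σ.subst^[n] T) := by
  induction n with
  | zero => exact h
  | succ n ih =>
    rw [Function.iterate_succ_apply']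
    exact ih.subst

theorem IsTiling.iterate_subst {T : Set (ι × EuclideanSpace ℝ (Fin d))} (h : σ.IsTiling T)
    (n : ℕ) : σ.IsTiling (σ.subst^[n] T) := by
  refine ⟨Set.eq_univ_of_forall fun p => ?_, h.isPacking.iterate_subst n⟩
  obtain ⟨a, ha, hp⟩ := h.exists_mem ((σ.lam ^ n)⁻¹ • p)
  obtain ⟨t, ht, hp'⟩ := exists_iterate_subst_mem n ha hp
  rw [smul_inv_smul₀ (σ.lam_pow_ne n)] at hp'
  exact Set.mem_biUnion ht hp'

theorem IsPacking.parent_unique {T : Set (ι × EuclideanSpace ℝ (Fin d))} (h : σ.IsPacking T)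
    {n : ℕ} {a a' t : ι × EuclideanSpace ℝ (Fin d)} (ha : a ∈ T) (ha' : a' ∈ T)
    (ht : t ∈ σ.subst^[n] {a}) (ht' : t ∈ σ.subst^[n] {a'}) : a = a' :=
  h.eq_of_mem ha ha' (interior_of_mem_iterate_subst n ht (σ.puncture_mem_interior t))
    (tileSupp_of_mem_iterate_subst n ht' (σ.puncture_mem t))

/-- A tile of a tiling whose interior meets an inflated tile belongs to the substitution of that
tile. -/
theorem IsPacking.mem_iterate_subst {W : Set (ι × EuclideanSpace ℝ (Fin d))} (h : σ.IsPacking W)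
    {n : ℕ} {a t : ι × EuclideanSpace ℝ (Fin d)} (ha : σ.subst^[n] {a} ⊆ W) (ht : t ∈ W)
    {p : EuclideanSpace ℝ (Fin d)} (hp : p ∈ interior (σ.tileSupp t))
    (hp' : (σ.lam ^ n)⁻¹ • p ∈ σ.tileSupp a) : t ∈ σ.subst^[n] {a} := by
  obtain ⟨u, hu, hpu⟩ := exists_iterate_subst_mem n (Set.mem_singleton a) hp'
  rw [smul_inv_smul₀ (σ.lam_pow_ne n)] at hpu
  rwa [h.eq_of_mem ht (ha hu) hp hpu]

/-- A finite patch of the substituted tiling comes from the finite patch of the parents of its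
tiles. -/
theorem subst_mem_tilingSpace {T : Set (ι × EuclideanSpace ℝ (Fin d))} (h : T ∈ σ.tilingSpace) :
    σ.subst T ∈ σ.tilingSpace := by
  classical
  refine ⟨h.1.iterate_subst 1, fun P hP => ?_⟩
  have hex : ∀ t : P, ∃ a ∈ T, (t : ι × EuclideanSpace ℝ (Fin d)) ∈ σ.subst {a} :=
    fun t => mem_subst.1 (hP t.2)
  choose f hf hf' using hex
  obtain ⟨i, n, v, hv⟩ := h.2 (Finset.univ.image f) (by
    intro t ht
    simp only [Finset.coe_image, Set.mem_image] at ht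
    obtain ⟨s, -, rfl⟩ := ht
    exact hf s)
  refine ⟨i, n + 1, σ.lam • v, fun t ht => ?_⟩
  rw [Function.iterate_succ_apply', ← subst_translate]
  refine subst_mono (Set.singleton_subset_iff.2 (hv ?_)) (hf' ⟨t, ht⟩)
  exact Finset.mem_coe.2 (Finset.mem_image_of_mem _ (Finset.mem_univ _))

theorem iterate_subst_mem_tilingSpace {T : Set (ι × EuclideanSpace ℝ (Fin d))}
    (h : T ∈ σ.tilingSpace) (n : ℕ) : σ.subst^[n] T ∈ σ.tilingSpace := by
  induction n with
  | zero => exact h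
  | succ n ih =>
    rw [Function.iterate_succ_apply']
    exact subst_mem_tilingSpace ih

/-! ### Consequences of primitivity -/

theorem exists_mem_of_pow_ne_zero [Fintype ι] [DecidableEq ι] (k : ℕ) :
    ∀ i j, (σ.bratteli.adjacency ^ k) i j ≠ 0 → ∃ x, (i, x) ∈ σ.subst^[k] {(j, 0)} := by
  induction k with
  | zero =>
    intro i j h
    rw [pow_zero, Matrix.one_apply] at h
    obtain rfl : i = j := by
      by_contra hne
      exact h (if_neg hne)
    exact ⟨0, rfl⟩
  | succ k ih =>
    intro i j h
    rw [pow_succ, Matrix.mul_apply] at h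
    obtain ⟨l, -, hl⟩ := Finset.exists_ne_zero_of_sum_ne_zero h
    obtain ⟨x, hx⟩ := ih i l (left_ne_zero_of_mul hl)
    have h2 := right_ne_zero_of_mul hl
    rw [StationaryBratteli.adjacency, Nat.cast_ne_zero, Nat.card_ne_zero] at h2
    obtain ⟨⟨⟨⟨j', ⟨⟨l', y⟩, hy⟩⟩, h3, h4⟩⟩, -⟩ := h2
    simp only [bratteli] at h3 h4
    subst h3 h4
    have hmem : (l', y) ∈ σ.subst {(j', (0 : EuclideanSpace ℝ (Fin d)))} :=
      ⟨_, rfl, (l', y), hy, by simp⟩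
    refine ⟨x + σ.lam ^ k • y, iterate_subst_subset_of_mem (k := 1) hmem k ?_⟩
    rw [iterate_subst_singleton, mem_translate]
    simpa using hx

/-- After `m - k` substitutions some tile is present, whatever its type, and `k` more substitutions
of it produce all types. -/
theorem Primitive.exists_mem [Fintype ι] (h : σ.Primitive) :
    ∃ k, 0 < k ∧ ∀ m, k ≤ m → ∀ i j, ∃ x, (i, x) ∈ σ.subst^[m] {(j, 0)} := by
  classical
  obtain ⟨k, hk, hpos⟩ := h.exists_pos_pow
  refine ⟨k, hk, fun m hm i j => ?_⟩
  obtain ⟨m, rfl⟩ := Nat.exists_eq_add_of_le hm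
  obtain ⟨⟨l, y⟩, hl, -⟩ := exists_iterate_subst_mem (σ := σ) m (Set.mem_singleton (j, 0))
    (σ.puncture_mem (j, 0))
  obtain ⟨x, hx⟩ := exists_mem_of_pow_ne_zero (σ := σ) k i l (by convert (hpos i l).ne')
  refine ⟨x + σ.lam ^ k • y, iterate_subst_subset_of_mem hl k ?_⟩
  rw [iterate_subst_singleton, mem_translate]
  simpa using hx

end TileSubstitution

/-! ### Finiteness of patches -/

theorem TotallyBounded.finite_of_separated {X : Type*} [PseudoMetricSpace X] {S : Set X}
    (hS : TotallyBounded S) {ε : ℝ} (hε : 0 < ε)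
    (hsep : ∀ x ∈ S, ∀ y ∈ S, dist x y < ε → x = y) : S.Finite := by
  obtain ⟨t, ht, hcov⟩ := Metric.totallyBounded_iff.1 hS (ε / 2) (half_pos hε)
  have hsub : S ⊆ ⋃ y ∈ t, S ∩ Metric.ball y (ε / 2) := fun x hx => by
    obtain ⟨y, hy, hxy⟩ := Set.mem_iUnion₂.1 (hcov hx)
    exact Set.mem_biUnion hy ⟨hx, hxy⟩
  refine (ht.biUnion fun y _ => Set.Subsingleton.finite ?_).subset hsub
  rintro a ⟨ha, ha'⟩ b ⟨hb, hb'⟩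
  refine hsep a ha b hb ((dist_triangle_right a b y).trans_lt ?_)
  rw [Metric.mem_ball] at ha' hb'
  linarith

namespace TileSubstitution

variable {d : ℕ} {ι : Type*} {σ : TileSubstitution d ι}

theorem IsPacking.eq_of_puncture {T : Set (ι × EuclideanSpace ℝ (Fin d))} (h : σ.IsPacking T)
    {i j : ι} {x : EuclideanSpace ℝ (Fin d)} (hi : (i, x) ∈ T) (hj : (j, x) ∈ T) : i = j :=
  (Prod.ext_iff.1 (h.eq_of_mem hi hj (σ.puncture_mem_interior (i, x)) (σ.puncture_mem (j, x)))).1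

theorem norm_sub_le_of_mem_tileSupp {R : ℝ} (hR : ∀ i, ∀ p ∈ σ.supp i, ‖p‖ ≤ R)
    {t : ι × EuclideanSpace ℝ (Fin d)} {p : EuclideanSpace ℝ (Fin d)} (hp : p ∈ σ.tileSupp t) :
    ‖p - t.2‖ ≤ R := hR _ _ hp

/-- The punctures of a packing are separated by a common inradius of the prototiles, and those of
the tiles that meet a ball stay bounded. -/
theorem IsPacking.finite_meeting [Finite ι] {T : Set (ι × EuclideanSpace ℝ (Fin d))}
    (h : σ.IsPacking T) (r : ℝ) : (σ.meeting T (Metric.ball 0 r)).Finite := by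
  obtain ⟨R, hR0, hR⟩ := σ.exists_supp_bound
  obtain ⟨ρ, hρ0, hρ⟩ := σ.exists_inradius
  have hinj : Set.InjOn Prod.snd (σ.meeting T (Metric.ball 0 r)) := by
    rintro ⟨i, x⟩ ⟨hi, -⟩ ⟨j, y⟩ ⟨hj, -⟩ hxy
    obtain rfl : x = y := hxy
    rw [h.eq_of_puncture hi hj]
  refine Set.Finite.of_finite_image (TotallyBounded.finite_of_separated (ε := ρ) ?_ hρ0 ?_) hinj
  · refine (isCompact_closedBall (0 : EuclideanSpace ℝ (Fin d)) (r + R)).totallyBounded.subset ?_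
    rintro _ ⟨t, ⟨-, p, hp, hp'⟩, rfl⟩
    have h1 := norm_sub_le_of_mem_tileSupp hR hp
    rw [mem_ball_zero_iff] at hp'
    rw [mem_closedBall_zero_iff]
    calc ‖t.2‖ = ‖p - (p - t.2)‖ := by rw [sub_sub_cancel]
      _ ≤ ‖p‖ + ‖p - t.2‖ := norm_sub_le _ _
      _ ≤ r + R := by linarith
  · rintro _ ⟨t, ht, rfl⟩ _ ⟨t', ht', rfl⟩ hd
    refine congrArg Prod.snd (h.eq_of_mem ht.1 ht'.1 (σ.puncture_mem_interior t) ?_)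
    refine hρ t'.1 ?_
    rwa [mem_ball_zero_iff, ← dist_eq_norm]

/-! ### Agreement of tilings on balls -/

variable (σ) in
/-- Two sets of tiles have the same tiles meeting the open ball of radius `r` at the origin. -/
def Agree (r : ℝ) (T T' : Set (ι × EuclideanSpace ℝ (Fin d))) : Prop :=
  σ.meeting T (Metric.ball 0 r) = σ.meeting T' (Metric.ball 0 r)

namespace Agree

variable {r r' : ℝ} {T T' T'' : Set (ι × EuclideanSpace ℝ (Fin d))}

theorem symm (h : σ.Agree r T T') : σ.Agree r T' T := Eq.symm h

theorem trans (h : σ.Agree r T T') (h' : σ.Agree r T' T'') : σ.Agree r T T'' := Eq.trans h h'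

theorem mono (h : σ.Agree r' T T') (hr : r ≤ r') : σ.Agree r T T' := σ.meeting_ball_mono hr h

theorem mem (h : σ.Agree r T T') {t : ι × EuclideanSpace ℝ (Fin d)} (ht : t ∈ T)
    {p : EuclideanSpace ℝ (Fin d)} (hp : p ∈ σ.tileSupp t) (hr : ‖p‖ < r) : t ∈ T' :=
  (h.subset ⟨ht, p, hp, mem_ball_zero_iff.2 hr⟩).1

theorem of_forall (h : ∀ t ∈ T, ∀ p ∈ σ.tileSupp t, ‖p‖ < r → t ∈ T')
    (h' : ∀ t ∈ T', ∀ p ∈ σ.tileSupp t, ‖p‖ < r → t ∈ T) : σ.Agree r T T' := by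
  ext t
  constructor
  · rintro ⟨ht, p, hp, hp'⟩
    exact ⟨h t ht p hp (mem_ball_zero_iff.1 hp'), p, hp, hp'⟩
  · rintro ⟨ht, p, hp, hp'⟩
    exact ⟨h' t ht p hp (mem_ball_zero_iff.1 hp'), p, hp, hp'⟩

/-- One inclusion suffices when `T` covers: a tile of `T'` that meets the ball has an interior point
there, and the tile of `T` at this point belongs to `T'` too. -/
theorem of_subset (hT : σ.IsTiling T) (hT' : σ.IsPacking T')
    (h : ∀ t ∈ T, ∀ p ∈ σ.tileSupp t, ‖p‖ < r → t ∈ T') : σ.Agree r T T' := by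
  refine of_forall h fun t ht p hp hr => ?_
  have hp0 := hp
  rw [← closure_interior_tileSupp, mem_closure_iff] at hp
  obtain ⟨q, hq, hq'⟩ := hp (Metric.ball 0 r) Metric.isOpen_ball (mem_ball_zero_iff.2 hr)
  obtain ⟨u, hu, hqu⟩ := hT.exists_mem q
  rwa [hT'.eq_of_mem ht (h u hu q hqu (mem_ball_zero_iff.1 hq)) hq' hqu]

theorem eq (h : ∀ r, σ.Agree r T T') : T = T' := by
  refine Set.Subset.antisymm (fun t ht => ?_) fun t ht => ?_
  · exact (h (‖t.2‖ + 1)).mem ht (σ.puncture_mem t) (by linarith)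
  · exact (h (‖t.2‖ + 1)).symm.mem ht (σ.puncture_mem t) (by linarith)

theorem iterate_subst (h : σ.Agree r T T') (n : ℕ) :
    σ.Agree (σ.lam ^ n * r) (σ.subst^[n] T) (σ.subst^[n] T') := by
  have key : ∀ {T T' : Set (ι × EuclideanSpace ℝ (Fin d))}, σ.Agree r T T' →
      ∀ t ∈ σ.subst^[n] T, ∀ p ∈ σ.tileSupp t, ‖p‖ < σ.lam ^ n * r → t ∈ σ.subst^[n] T' := by
    intro T T' h t ht p hp hr
    obtain ⟨a, ha, hta⟩ := (mem_iterate_subst n).1 ht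
    refine (mem_iterate_subst n).2 ⟨a, h.mem ha (tileSupp_of_mem_iterate_subst n hta hp) ?_, hta⟩
    rw [norm_smul, norm_inv, Real.norm_of_nonneg (σ.lam_pow_pos n).le,
      inv_mul_lt_iff₀ (σ.lam_pow_pos n)]
    exact hr
  exact of_forall (key h) (key h.symm)

theorem translate (v : EuclideanSpace ℝ (Fin d)) (h : σ.Agree (r + ‖v‖) T T') :
    σ.Agree r (translate v T) (translate v T') := by
  have key : ∀ {T T' : Set (ι × EuclideanSpace ℝ (Fin d))}, σ.Agree (r + ‖v‖) T T' →
      ∀ t ∈ TileSubstitution.translate v T, ∀ p ∈ σ.tileSupp t, ‖p‖ < r →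
        t ∈ TileSubstitution.translate v T' := by
    intro T T' h t ht p hp hr
    rw [mem_translate] at ht ⊢
    refine h.mem ht (p := p - v) ?_ ((norm_sub_le _ _).trans_lt (by linarith))
    rw [mem_tileSupp] at hp ⊢
    simpa using hp
  exact of_forall (key h) (key h.symm)

end Agree

/-! ### Existence of tilings -/

/-- The seed of a tiling: a copy of `i` in its own substitution, at distance at least `1` from the
outside of the inflated prototile. It is found inside the tile at the centre of a supertile. -/
theorem exists_nested_step [Fintype ι] [Nonempty ι] (hprim : σ.Primitive) :
    ∃ (i : ι) (N : ℕ) (x : EuclideanSpace ℝ (Fin d)), 0 < N ∧ (i, x) ∈ σ.subst^[N] {(i, 0)} ∧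
      ∀ p ∈ σ.tileSupp (i, x), ∀ q, ‖q - p‖ < 1 → (σ.lam ^ N)⁻¹ • q ∈ σ.supp i := by
  obtain ⟨R, hR0, hR⟩ := σ.exists_supp_bound
  obtain ⟨ρ, hρ0, hρ⟩ := σ.exists_inradius
  obtain ⟨i⟩ := ‹Nonempty ι›
  obtain ⟨m, hm0, hm⟩ := hprim.exists_mem
  -- The inflated prototile must contain the ball of radius `2R + 1`: `R` for the puncture `y` of
  -- the central tile, `R` for a point of that tile, `1` for the margin.
  obtain ⟨k, hk⟩ := pow_unbounded_of_one_lt ((2 * R + 1) / ρ) σ.one_lt_lam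
  rw [div_lt_iff₀ hρ0] at hk
  obtain ⟨⟨j, y⟩, hj, h0⟩ := exists_iterate_subst_mem (σ := σ) k (Set.mem_singleton (i, 0))
    (σ.puncture_mem (i, 0))
  obtain ⟨z, hz⟩ := hm m le_rfl i j
  have hx : (i, z + σ.lam ^ m • y) ∈ σ.subst^[m] {(j, y)} := by
    rw [iterate_subst_singleton, mem_translate]
    simpa using hz
  refine ⟨i, m + k, z + σ.lam ^ m • y, by omega, iterate_subst_subset_of_mem hj m hx, ?_⟩
  intro p hp q hq
  have hp' := tileSupp_of_mem_iterate_subst m hx hp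
  have h1 := norm_sub_le_of_mem_tileSupp hR hp'
  have h2 := norm_sub_le_of_mem_tileSupp hR h0
  rw [smul_zero, zero_sub, norm_neg] at h2
  simp only at h1 h2
  have hl := σ.lam_pow_pos m
  have hl1 : 1 ≤ σ.lam ^ m := one_le_pow₀ σ.one_lt_lam.le
  have h3 : ‖(σ.lam ^ m)⁻¹ • q - (σ.lam ^ m)⁻¹ • p‖ < 1 := by
    rw [← smul_sub, norm_smul, norm_inv, Real.norm_of_nonneg hl.le, inv_mul_lt_iff₀ hl]
    linarith
  have h4 : ‖(σ.lam ^ m)⁻¹ • q‖ < σ.lam ^ k * ρ := by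
    calc ‖(σ.lam ^ m)⁻¹ • q‖ = ‖((σ.lam ^ m)⁻¹ • q - (σ.lam ^ m)⁻¹ • p) +
          ((σ.lam ^ m)⁻¹ • p - y) + y‖ := by congr 1; abel
      _ ≤ ‖(σ.lam ^ m)⁻¹ • q - (σ.lam ^ m)⁻¹ • p‖ + ‖(σ.lam ^ m)⁻¹ • p - y‖ + ‖y‖ :=
        norm_add₃_le
      _ < _ := by linarith
  refine hρ i ?_
  rw [mem_ball_zero_iff, pow_add, mul_comm, mul_inv, ← smul_smul, norm_smul, norm_inv,
    Real.norm_of_nonneg (σ.lam_pow_pos k).le, inv_mul_lt_iff₀ (σ.lam_pow_pos k)]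
  exact h4

theorem tilingSpace_nonempty [Fintype ι] [Nonempty ι] (hprim : σ.Primitive) :
    σ.tilingSpace.Nonempty := by
  obtain ⟨i, N, x, hN, hx, hxs⟩ := exists_nested_step hprim
  -- `b k` is the position of the initial tile in the supertile of order `N * k`. Moving it to the
  -- origin makes the supertiles nested.
  let b : ℕ → EuclideanSpace ℝ (Fin d) := fun k =>
    Nat.rec 0 (fun k v => σ.lam ^ (N * k) • x + v) k
  have hb : ∀ k, b (k + 1) = σ.lam ^ (N * k) • x + b k := fun k => rfl
  let P : ℕ → Set (ι × EuclideanSpace ℝ (Fin d)) := fun k =>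
    translate (-b k) (σ.subst^[N * k] {(i, 0)})
  have hstep : ∀ k, P k ⊆ P (k + 1) := by
    intro k
    have h1 : translate (σ.lam ^ (N * k) • x) (σ.subst^[N * k] {(i, 0)}) ⊆
        σ.subst^[N * (k + 1)] {(i, 0)} := by
      have := iterate_subst_subset_of_mem hx (N * k)
      rwa [iterate_subst_singleton, ← Nat.mul_succ] at this
    have h2 := translate_mono (v := -b (k + 1)) h1
    rw [translate_translate, hb] at h2
    simpa [P, hb] using h2
  have hmono : Monotone P := monotone_nat_of_le_succ hstep
  have hpack : ∀ k, σ.IsPacking (P k) := fun k =>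
    ((isPacking_singleton _).iterate_subst _).translate _
  -- The margin `1` of the seed becomes `λ^(N k)` after inflation, so the union of the supertiles is
  -- the whole space.
  have hcov : ∀ k, ∀ q, ‖q‖ < σ.lam ^ (N * k) → ∃ t ∈ P (k + 1), q ∈ σ.tileSupp t := by
    intro k q hq
    have h0 : (i, (0 : EuclideanSpace ℝ (Fin d))) ∈ P k := hmono (Nat.zero_le k) (by
      simp [P, mem_translate, b])
    have h1 : (σ.lam ^ (N * k))⁻¹ • b k ∈ σ.supp i := by
      rw [mem_translate] at h0
      have := tileSupp_of_mem_iterate_subst _ h0 (σ.puncture_mem _)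
      simpa [mem_tileSupp] using this
    have hl := σ.lam_pow_pos (N * k)
    have h2 := hxs (x + (σ.lam ^ (N * k))⁻¹ • b k) (by simpa [mem_tileSupp] using h1)
      (x + (σ.lam ^ (N * k))⁻¹ • b k + (σ.lam ^ (N * k))⁻¹ • q) (by
        rw [add_sub_cancel_left, norm_smul, norm_inv, Real.norm_of_nonneg hl.le,
          inv_mul_lt_iff₀ hl, mul_one]
        exact hq)
    obtain ⟨t, ht, h3⟩ := exists_iterate_subst_mem (σ := σ) (N * (k + 1))
      (Set.mem_singleton (i, (0 : EuclideanSpace ℝ (Fin d))))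
      (show _ ∈ σ.tileSupp (i, 0) by rw [mem_tileSupp, sub_zero]; exact h2)
    refine ⟨(t.1, t.2 - b (k + 1)), ?_, ?_⟩
    · simpa [P, mem_translate] using ht
    · rw [mem_tileSupp] at h3 ⊢
      rw [smul_smul, Nat.mul_succ, pow_add, mul_assoc, mul_inv_cancel₀ (σ.lam_pow_ne N), mul_one,
        smul_add, smul_add, smul_inv_smul₀ hl.ne', smul_inv_smul₀ hl.ne'] at h3
      rw [hb]
      convert h3 using 1
      rw [sub_sub_eq_add_sub, add_comm q]
  refine ⟨⋃ k, P k, ⟨Set.eq_univ_of_forall fun q => ?_, ?_⟩, fun F hF => ?_⟩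
  · obtain ⟨k, hk⟩ := pow_unbounded_of_one_lt ‖q‖ σ.one_lt_lam
    obtain ⟨t, ht, hq⟩ := hcov k q (hk.trans_le (pow_le_pow_right₀ σ.one_lt_lam.le
      (Nat.le_mul_of_pos_left k hN)))
    exact Set.mem_biUnion (Set.mem_iUnion.2 ⟨_, ht⟩) hq
  · intro t ht t' ht'
    obtain ⟨k, hk⟩ := Set.mem_iUnion.1 ht
    obtain ⟨k', hk'⟩ := Set.mem_iUnion.1 ht'
    exact hpack (max k k') t (hmono (le_max_left _ _) hk) t' (hmono (le_max_right _ _) hk')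
  · have hex : ∀ t : F, ∃ k, (t : ι × EuclideanSpace ℝ (Fin d)) ∈ P k :=
      fun t => Set.mem_iUnion.1 (hF t.2)
    choose f hf using hex
    refine ⟨i, N * Finset.univ.sup f, -b (Finset.univ.sup f), fun t ht => ?_⟩
    exact hmono (Finset.le_sup (Finset.mem_univ ⟨t, ht⟩)) (hf ⟨t, ht⟩)

theorem exists_tiling_mem [Fintype ι] [Nonempty ι] (hprim : σ.Primitive) (i : ι) :
    ∃ T ∈ σ.tilingSpace, (i, (0 : EuclideanSpace ℝ (Fin d))) ∈ T := by
  obtain ⟨T, hT⟩ := tilingSpace_nonempty hprim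
  obtain ⟨⟨j, y⟩, hj, -⟩ := hT.1.exists_mem 0
  obtain ⟨k, -, hk⟩ := hprim.exists_mem
  obtain ⟨x, hx⟩ := hk k le_rfl i j
  have hmem : (i, x + σ.lam ^ k • y) ∈ σ.subst^[k] T := by
    refine (mem_iterate_subst k).2 ⟨_, hj, ?_⟩
    rw [iterate_subst_singleton, mem_translate]
    simpa using hx
  refine ⟨translate (-(x + σ.lam ^ k • y)) (σ.subst^[k] T),
    translate_mem_tilingSpace (iterate_subst_mem_tilingSpace hT k) _, ?_⟩
  rw [mem_translate]
  simpa using hmem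

/-! ### Compactness of the transversal -/

/-- By finite local complexity the patch of radius `n` takes finitely many values, so it is constant
along the ultrafilter. The union of these patches is a tiling of the transversal, because covering,
packing and admissibility are local. -/
theorem exists_transversal_limit [Finite ι] (hflc : σ.FiniteLocalComplexity) {α : Type*}
    (F : Ultrafilter α) (T : α → σ.Transversal) :
    ∃ S : σ.Transversal, ∀ r, ∀ᶠ k in F, σ.Agree r (T k).tiling S.tiling := by
  have hex : ∀ n : ℕ, ∃ P, ∀ᶠ k in F, σ.meeting (T k).tiling (Metric.ball 0 n) = P := by
    intro n
    have := (hflc n).to_subtype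
    obtain ⟨P, hP⟩ := F.exists_eventually_eq fun k => (⟨_, ⟨T k, rfl⟩⟩ :
      Set.range fun T : σ.Transversal => σ.meeting T.tiling (Metric.ball 0 n))
    exact ⟨P, hP.mono fun k hk => congrArg Subtype.val hk⟩
  choose P hP using hex
  have hmem : ∀ t n, t ∈ P n → ∀ᶠ k in F, t ∈ (T k).tiling := by
    intro t n ht
    filter_upwards [hP n] with k hk
    rw [← hk] at ht
    exact ht.1
  let S := ⋃ n, P n
  have hag : ∀ n : ℕ, ∀ᶠ k in F, σ.Agree n (T k).tiling S := by
    intro n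
    have hS : σ.meeting S (Metric.ball 0 n) = P n := by
      ext t
      constructor
      · rintro ⟨ht, p, hp, hr⟩
        obtain ⟨m, hm⟩ := Set.mem_iUnion.1 ht
        obtain ⟨k, h1, h2⟩ := ((hmem t m hm).and (hP n)).exists
        rw [← h2]
        exact ⟨h1, p, hp, hr⟩
      · intro ht
        refine ⟨Set.mem_iUnion.2 ⟨n, ht⟩, ?_⟩
        obtain ⟨k, hk⟩ := (hP n).exists
        rw [← hk] at ht
        exact ht.2
    filter_upwards [hP n] with k hk
    rw [Agree, hk, hS]
  have hSmem : ∀ t ∈ S, ∀ᶠ k in F, t ∈ (T k).tiling := by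
    intro t ht
    obtain ⟨m, hm⟩ := Set.mem_iUnion.1 ht
    exact hmem t m hm
  have htiling : σ.IsTiling S := by
    refine ⟨Set.eq_univ_of_forall fun p => ?_, fun t ht t' ht' => ?_⟩
    · obtain ⟨n, hn⟩ := exists_nat_gt ‖p‖
      obtain ⟨k, hk⟩ := (hag n).exists
      obtain ⟨t, ht, hp⟩ := (T k).mem_tilingSpace.1.exists_mem p
      exact Set.mem_biUnion (hk.mem ht hp hn) hp
    · obtain ⟨k, h1, h2⟩ := ((hSmem t ht).and (hSmem t' ht')).exists
      exact (T k).mem_tilingSpace.1.2 t h1 t' h2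
  obtain ⟨i, hi⟩ := F.exists_eventually_eq fun k => (T k).puncture.choose
  refine ⟨⟨S, ⟨htiling, fun Q hQ => ?_⟩, ⟨i, ?_⟩⟩, fun r => ?_⟩
  · have : ∀ᶠ k in F, ∀ t ∈ Q, t ∈ (T k).tiling :=
      (eventually_all_finset _).2 fun t ht => hSmem t (hQ ht)
    obtain ⟨k, hk⟩ := this.exists
    exact (T k).mem_tilingSpace.2 Q fun t ht => hk t ht
  · obtain ⟨k, h1, h2⟩ := (hi.and (hag 1)).exists
    have := (T k).puncture.choose_spec
    rw [h1] at this
    exact h2.mem this (σ.puncture_mem _) (by simp)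
  · obtain ⟨n, hn⟩ := exists_nat_ge r
    filter_upwards [hag n] with k hk using hk.mono hn

/-! ### Every tiling is a substitution -/

theorem exists_subst_agree [Fintype ι] [Nonempty ι] (hprim : σ.Primitive)
    {T : Set (ι × EuclideanSpace ℝ (Fin d))} (hT : T ∈ σ.tilingSpace) (r : ℝ) :
    ∃ U ∈ σ.tilingSpace, σ.Agree r T (σ.subst U) := by
  have hfin := hT.1.isPacking.finite_meeting r
  obtain ⟨i, n, v, hv⟩ := hT.2 hfin.toFinset (by
    rw [Set.Finite.coe_toFinset]
    exact fun t ht => ht.1)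
  rw [Set.Finite.coe_toFinset] at hv
  obtain ⟨k, hk0, hk⟩ := hprim.exists_mem
  obtain ⟨y, hy⟩ := hk k le_rfl i i
  obtain ⟨U, hU, hiU⟩ := exists_tiling_mem hprim i
  have h1 : σ.subst^[n] {(i, y)} ⊆ σ.subst^[n + k] U :=
    (iterate_subst_subset_of_mem hy n).trans
      (iterate_subst_mono (Set.singleton_subset_iff.2 hiU) _)
  rw [iterate_subst_singleton] at h1
  have h2 := translate_mono (v := v - σ.lam ^ n • y) h1
  -- As `k` is positive, one substitution can be split off, and the large tiling is a substitution.
  obtain ⟨l, rfl⟩ : ∃ l, k = l + 1 := ⟨k - 1, by omega⟩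
  have hl := σ.lam_pos.ne'
  have h3 : translate (v - σ.lam ^ n • y) (σ.subst^[n + (l + 1)] U) =
      σ.subst (translate (σ.lam⁻¹ • (v - σ.lam ^ n • y)) (σ.subst^[n + l] U)) := by
    rw [subst_translate, smul_inv_smul₀ hl, ← add_assoc, Function.iterate_succ_apply']
  rw [translate_translate, add_sub_cancel, h3] at h2
  have hU' := translate_mem_tilingSpace (iterate_subst_mem_tilingSpace hU (n + l))
    (σ.lam⁻¹ • (v - σ.lam ^ n • y))
  exact ⟨_, hU', Agree.of_subset hT.1 (hU'.1.isPacking.subst) fun t ht p hp hr =>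
    h2 (hv ⟨ht, p, hp, mem_ball_zero_iff.2 hr⟩)⟩

/-- Compactness: `T` agrees with substitutions of `U k` on growing balls. Recentred at the parent of
the tile at the origin, which has finitely many possible positions, the `U k` have a limit, and its
substitution is `T` up to translation. -/
theorem exists_subst_eq [Fintype ι] [Nonempty ι] (hprim : σ.Primitive)
    (hflc : σ.FiniteLocalComplexity) {T : Set (ι × EuclideanSpace ℝ (Fin d))}
    (hT : T ∈ σ.tilingSpace) : ∃ S ∈ σ.tilingSpace, σ.subst S = T := by
  obtain ⟨⟨v, x⟩, hv, -⟩ := hT.1.exists_mem 0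
  have hl := σ.lam_pos.ne'
  set T₀ := translate (-x) T with hT₀
  have hT₀m : T₀ ∈ σ.tilingSpace := translate_mem_tilingSpace hT _
  have hv0 : (v, (0 : EuclideanSpace ℝ (Fin d))) ∈ T₀ := by
    rw [hT₀, mem_translate]
    simpa using hv
  choose U hU hUag using fun k : ℕ => exists_subst_agree hprim hT₀m ((k : ℝ) + 1)
  have hpar : ∀ k, ∃ e : Σ i : ι, {t : ι × EuclideanSpace ℝ (Fin d) // t ∈ σ.sub i},
      (e.1, -(σ.lam⁻¹ • e.2.1.2)) ∈ U k := by
    intro k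
    have h1 : (v, (0 : EuclideanSpace ℝ (Fin d))) ∈ σ.subst (U k) :=
      (hUag k).mem hv0 (σ.puncture_mem _) (by simp; positivity)
    obtain ⟨a, ha, q, hq, h⟩ := h1
    refine ⟨⟨a.1, q, hq⟩, ?_⟩
    have h2 : σ.lam • a.2 + q.2 = 0 := (congrArg Prod.snd h).symm
    have h3 : a.2 = -(σ.lam⁻¹ • q.2) := by
      rw [← smul_neg, ← eq_neg_of_add_eq_zero_left h2, inv_smul_smul₀ hl]
    simpa [← h3] using ha
  choose e he using hpar
  let U' : ℕ → σ.Transversal := fun k => ⟨translate (σ.lam⁻¹ • (e k).2.1.2) (U k),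
    translate_mem_tilingSpace (hU k) _, ⟨(e k).1, by
      rw [mem_translate, zero_sub]
      exact he k⟩⟩
  obtain ⟨S, hS⟩ := exists_transversal_limit hflc (hyperfilter ℕ) U'
  obtain ⟨e₀, he₀⟩ := (hyperfilter ℕ).exists_eventually_eq e
  have hT₀S : T₀ = translate (-e₀.2.1.2) (σ.subst S.tiling) := by
    refine Agree.eq (σ := σ) fun r => ?_
    have hev : ∀ᶠ k : ℕ in (hyperfilter ℕ : Filter ℕ), r ≤ (k : ℝ) + 1 := by
      refine (Nat.hyperfilter_le_atTop) ?_
      filter_upwards [eventually_ge_atTop ⌈r⌉₊] with k hk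
      have := Nat.ceil_le.1 hk
      linarith
    obtain ⟨k, h1, h2, h3⟩ := (hev.and ((hS ((σ.lam ^ 1)⁻¹ * (r + ‖-e₀.2.1.2‖))).and he₀)).exists
    refine ((hUag k).mono h1).trans ?_
    have h4 := h2.iterate_subst 1
    rw [mul_inv_cancel_left₀ (σ.lam_pow_ne 1)] at h4
    have h5 := Agree.translate (-e₀.2.1.2) h4
    simp only [U', Function.iterate_one, subst_translate, smul_inv_smul₀ hl] at h5
    rwa [h3, translate_neg_translate] at h5
  refine ⟨translate (σ.lam⁻¹ • (-e₀.2.1.2 + x)) S.tiling,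
    translate_mem_tilingSpace S.mem_tilingSpace _, ?_⟩
  rw [subst_translate, smul_inv_smul₀ hl, ← translate_translate, ← hT₀S, hT₀, translate_translate,
    neg_add_cancel, translate_zero]

theorem exists_iterate_subst_eq [Fintype ι] [Nonempty ι] (hprim : σ.Primitive)
    (hflc : σ.FiniteLocalComplexity) (n : ℕ) : ∀ {T : Set (ι × EuclideanSpace ℝ (Fin d))},
    T ∈ σ.tilingSpace → ∃ S ∈ σ.tilingSpace, σ.subst^[n] S = T := by
  induction n with
  | zero => exact fun hT => ⟨_, hT, rfl⟩
  | succ n ih =>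
    intro T hT
    obtain ⟨S, hS, rfl⟩ := ih hT
    obtain ⟨S', hS', rfl⟩ := exists_subst_eq hprim hflc hS
    exact ⟨S', hS', rfl⟩

end TileSubstitution

namespace TileSubstitution

variable {d : ℕ} {ι : Type*} {σ : TileSubstitution d ι}

theorem add_mem_iterate_subst {n : ℕ} {i : ι} {x u : EuclideanSpace ℝ (Fin d)}
    {t : ι × EuclideanSpace ℝ (Fin d)} :
    (t.1, t.2 + σ.lam ^ n • u) ∈ σ.subst^[n] {(i, x + u)} ↔ t ∈ σ.subst^[n] {(i, x)} := by
  have : ({(i, x + u)} : Set (ι × EuclideanSpace ℝ (Fin d))) = translate u {(i, x)} := by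
    rw [translate_singleton]
  rw [this, iterate_subst_translate, mem_translate]
  simp

theorem sub_mem_iterate_subst {n : ℕ} {i : ι} {x u : EuclideanSpace ℝ (Fin d)}
    {t : ι × EuclideanSpace ℝ (Fin d)} :
    (t.1, t.2 - σ.lam ^ n • u) ∈ σ.subst^[n] {(i, x - u)} ↔ t ∈ σ.subst^[n] {(i, x)} := by
  have := add_mem_iterate_subst (σ := σ) (n := n) (i := i) (x := x) (u := -u) (t := t)
  rwa [smul_neg, ← sub_eq_add_neg, ← sub_eq_add_neg] at this

/-! ### Short vectors are not local periods -/

/-- Uniform repetitivity: by finite local complexity there are finitely many patches to accommodate,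
so one order of supertiles contains them all. -/
theorem exists_patch_level [Fintype ι] (hprim : σ.Primitive)
    (hflc : σ.FiniteLocalComplexity) (r : ℝ) :
    ∃ m : ℕ, ∀ (T : σ.Transversal) (v : ι) (y : EuclideanSpace ℝ (Fin d)), ∃ u,
      translate u (σ.meeting T.tiling (Metric.ball 0 r)) ⊆ σ.subst^[m] {(v, y)} := by
  obtain ⟨k, -, hk⟩ := hprim.exists_mem
  have h : ∀ P ∈ Set.range fun T : σ.Transversal => σ.meeting T.tiling (Metric.ball 0 r),
      ∀ᶠ m in atTop, ∀ (v : ι) (y : EuclideanSpace ℝ (Fin d)), ∃ u,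
        translate u P ⊆ σ.subst^[m] {(v, y)} := by
    rintro _ ⟨T, rfl⟩
    have hfin := T.mem_tilingSpace.1.isPacking.finite_meeting r
    obtain ⟨i, n, w, hw⟩ := T.mem_tilingSpace.2 hfin.toFinset (by
      rw [Set.Finite.coe_toFinset]
      exact fun t ht => ht.1)
    rw [Set.Finite.coe_toFinset] at hw
    filter_upwards [eventually_ge_atTop (n + k)] with m hm v y
    obtain ⟨l, rfl⟩ := Nat.exists_eq_add_of_le hm
    obtain ⟨x, hx⟩ := hk (k + l) (by omega) i v
    have hx' : (i, x + σ.lam ^ (k + l) • y) ∈ σ.subst^[k + l] {(v, 0 + y)} :=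
      add_mem_iterate_subst (t := (i, x)).2 hx
    rw [zero_add] at hx'
    have h1 := iterate_subst_subset_of_mem hx' n
    rw [iterate_subst_singleton, ← add_assoc] at h1
    refine ⟨-w + σ.lam ^ n • (x + σ.lam ^ (k + l) • y), ?_⟩
    rw [← translate_translate]
    refine (translate_mono ?_).trans h1
    have := translate_mono (v := -w) hw
    rwa [translate_neg_translate] at this
  obtain ⟨m, hm⟩ := ((eventually_all_finite (hflc r)).2 h).exists
  exact ⟨m, fun T v y => hm _ ⟨T, rfl⟩ v y⟩

/-- The supertile of order `n + m` contains copies of all patches of supertiles of order `n`. A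
local period `z` that is short at this scale therefore acts around every tile of `σ.subst^[n] W`,
and becomes a global period. -/
theorem exists_no_short_period [Fintype ι] (hprim : σ.Primitive)
    (hflc : σ.FiniteLocalComplexity) (haper : σ.Aperiodic) :
    ∃ m : ℕ, ∀ W ∈ σ.tilingSpace, ∀ (n : ℕ) (v : ι) (y z : EuclideanSpace ℝ (Fin d)),
      σ.subst^[n + m] {(v, y)} ⊆ W → ‖z‖ ≤ σ.lam ^ n →
      (∀ t ∈ σ.subst^[n + m] {(v, y)}, (t.1, t.2 + z) ∈ W) → z = 0 := by
  obtain ⟨R, hR0, hR⟩ := σ.exists_supp_bound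
  -- At the scale of `W` a puncture is within `R` of that of its supertile and the period moves it
  -- by at most `1`; the patch of radius `R + 2` contains both ends.
  obtain ⟨m, hm⟩ := exists_patch_level hprim hflc (R + 2)
  refine ⟨m, fun W hW n v y z hsub hz hper => ?_⟩
  have hl := σ.lam_pow_pos n
  have hWn := iterate_subst_mem_tilingSpace hW n
  refine haper _ hWn z ?_
  symm
  refine IsTiling.eq_of_subset hWn.1 (hWn.1.translate z) ?_
  have hclaim : ∀ t ∈ σ.subst^[n] W, (t.1, t.2 + z) ∈ σ.subst^[n] W := by
    intro t ht
    obtain ⟨⟨i, x⟩, ha, hta⟩ := (mem_iterate_subst n).1 ht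
    let S : σ.Transversal := ⟨translate (-x) W, translate_mem_tilingSpace hW _, ⟨i, by
      rw [mem_translate]; simpa using ha⟩⟩
    obtain ⟨u, hu⟩ := hm S v y
    have hmem : ∀ b : ι × EuclideanSpace ℝ (Fin d), b ∈ S.tiling → ∀ p ∈ σ.tileSupp b,
        ‖p‖ < R + 2 → σ.subst^[n] {(b.1, b.2 + u)} ⊆ σ.subst^[n + m] {(v, y)} := by
      intro b hb p hp hr
      refine iterate_subst_subset_of_mem (hu ?_) n
      rw [mem_translate]
      simp only [add_sub_cancel_right]
      exact ⟨hb, p, hp, mem_ball_zero_iff.2 hr⟩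
    have ht0 : (t.1, t.2 - σ.lam ^ n • x) ∈ σ.subst^[n] {(i, (0 : EuclideanSpace ℝ (Fin d)))} := by
      have := sub_mem_iterate_subst (u := x).2 hta
      rwa [sub_self] at this
    have h0S : (i, (0 : EuclideanSpace ℝ (Fin d))) ∈ S.tiling := by
      change _ ∈ translate (-x) W
      rw [mem_translate]; simpa using ha
    have ht1 : (t.1, t.2 - σ.lam ^ n • x + σ.lam ^ n • u) ∈ σ.subst^[n] {(i, 0 + u)} :=
      add_mem_iterate_subst (t := (t.1, t.2 - σ.lam ^ n • x)).2 ht0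
    have ht2 := hper _ (hmem _ h0S 0 (σ.puncture_mem _) (by rw [norm_zero]; linarith) ht1)
    have hp0 : ‖(σ.lam ^ n)⁻¹ • (t.2 - σ.lam ^ n • x + z)‖ < R + 2 := by
      have h1 := norm_sub_le_of_mem_tileSupp hR
        (tileSupp_of_mem_iterate_subst n ht0 (σ.puncture_mem _))
      simp only [sub_zero] at h1
      rw [smul_add]
      have h2 : ‖(σ.lam ^ n)⁻¹ • z‖ ≤ 1 := by
        rw [norm_smul, norm_inv, Real.norm_of_nonneg hl.le, inv_mul_le_iff₀ hl, mul_one]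
        exact hz
      refine (norm_add_le _ _).trans_lt ?_
      linarith
    obtain ⟨b, hb, hpb⟩ := S.mem_tilingSpace.1.exists_mem
      ((σ.lam ^ n)⁻¹ • (t.2 - σ.lam ^ n • x + z))
    have hsubb := hmem b hb _ hpb hp0
    -- The moved puncture lies in the copy of the supertile of `b`, so the moved tile is one of the
    -- tiles of that copy. It is then carried back to the original place.
    have ht3 := hW.1.isPacking.mem_iterate_subst (hsubb.trans hsub) ht2
      (σ.puncture_mem_interior _) (by
        have h3 := (mem_tileSupp_add (σ := σ) (v := u)).2 hpb
        convert h3 using 1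
        simp only [smul_add, smul_sub, inv_smul_smul₀ hl.ne']
        exact add_right_comm _ _ _)
    refine (mem_iterate_subst n).2 ⟨(b.1, b.2 + x), ?_, ?_⟩
    · have : b ∈ translate (-x) W := hb
      rw [mem_translate] at this
      simpa using this
    · have h4 := sub_mem_iterate_subst (u := u).2 ht3
      simp only [add_sub_cancel_right] at h4
      have h5 := add_mem_iterate_subst (u := x).2 h4
      convert h5 using 2
      simp only
      abel
  intro t ht
  have hneg : translate z (σ.subst^[n] W) = σ.subst^[n] W := by
    refine ((hWn.1.translate z).eq_of_subset hWn.1 fun s hs => ?_)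
    rw [mem_translate] at hs
    simpa using hclaim _ hs
  rwa [hneg]

/-! ### Prototiles are fat -/

/-- Every point of a prototile is near an interior point, with a ball around it; compactness makes
the radius of the ball uniform. -/
theorem exists_fat_radius [Finite ι] (σ : TileSubstitution d ι) {ρ : ℝ} (hρ : 0 < ρ) :
    ∃ c, 0 < c ∧ ∀ i, ∀ q ∈ σ.supp i, ∃ q', Metric.ball q' c ⊆ σ.supp i ∧
      Metric.ball q' c ⊆ Metric.ball q ρ := by
  have h : ∀ i, ∀ᶠ c in 𝓝[>] (0 : ℝ), ∀ q ∈ σ.supp i, ∃ q', Metric.ball q' c ⊆ σ.supp i ∧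
      Metric.ball q' c ⊆ Metric.ball q ρ := by
    intro i
    refine (σ.isCompact_supp i).induction_on (p := fun S => ∀ᶠ c in 𝓝[>] (0 : ℝ), ∀ q ∈ S, ∃ q',
      Metric.ball q' c ⊆ σ.supp i ∧ Metric.ball q' c ⊆ Metric.ball q ρ) ?_ ?_ ?_ ?_
    · exact Eventually.of_forall fun c q hq => absurd hq (Set.notMem_empty q)
    · exact fun S S' hS h => h.mono fun c hc q hq => hc q (hS hq)
    · intro S S' h h'
      filter_upwards [h, h'] with c hc hc' q hq
      exact hq.elim (hc q) (hc' q)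
    · intro q hq
      rw [← σ.closure_interior_supp, Metric.mem_closure_iff] at hq
      obtain ⟨q', hq', hqq'⟩ := hq (ρ / 3) (by positivity)
      obtain ⟨c₀, hc₀, hsub⟩ := Metric.mem_nhds_iff.1 (mem_interior_iff_mem_nhds.1 hq')
      refine ⟨Metric.ball q (ρ / 3), mem_nhdsWithin_of_mem_nhds (Metric.ball_mem_nhds _
        (by positivity)), ?_⟩
      filter_upwards [Ioo_mem_nhdsGT (lt_min hc₀ (show 0 < ρ / 3 by positivity))] with c hc p hp
      have hc1 := hc.2.trans_le (min_le_left _ _)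
      have hc2 := hc.2.trans_le (min_le_right _ _)
      refine ⟨q', (Metric.ball_subset_ball hc1.le).trans hsub, fun x hx => ?_⟩
      rw [Metric.mem_ball] at hx hp ⊢
      have h1 := dist_triangle4 x q' q p
      rw [dist_comm q' q, dist_comm q p] at h1
      linarith
  obtain ⟨c, hc, hc0⟩ := ((eventually_all.2 h).and self_mem_nhdsWithin).exists
  exact ⟨c, hc0, hc⟩

/-! ### Unique composition -/

variable (σ) in
/-- The tiles `(i, 0)` and `(j, z)` occur in tilings with the same `M`-th substitution. -/
def Compatible (M : ℕ) (i j : ι) (z : EuclideanSpace ℝ (Fin d)) : Prop :=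
  ∃ U ∈ σ.tilingSpace, ∃ U' ∈ σ.tilingSpace, (i, (0 : EuclideanSpace ℝ (Fin d))) ∈ U ∧
    (j, z) ∈ U' ∧ σ.subst^[M] U = σ.subst^[M] U'

theorem Compatible.mono {M N : ℕ} {i j : ι} {z : EuclideanSpace ℝ (Fin d)}
    (h : σ.Compatible M i j z) (hMN : M ≤ N) : σ.Compatible N i j z := by
  obtain ⟨U, hU, U', hU', h1, h2, h3⟩ := h
  obtain ⟨k, rfl⟩ := Nat.exists_eq_add_of_le' hMN
  exact ⟨U, hU, U', hU', h1, h2, by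
    rw [Function.iterate_add_apply, h3, ← Function.iterate_add_apply]⟩

theorem Compatible.of_mem {M : ℕ} {i j : ι} {x y : EuclideanSpace ℝ (Fin d)}
    {U U' : Set (ι × EuclideanSpace ℝ (Fin d))} (hU : U ∈ σ.tilingSpace) (hU' : U' ∈ σ.tilingSpace)
    (hi : (i, x) ∈ U) (hj : (j, y) ∈ U') (h : σ.subst^[M] U = σ.subst^[M] U') :
    σ.Compatible M i j (y - x) := by
  refine ⟨translate (-x) U, translate_mem_tilingSpace hU _, translate (-x) U',
    translate_mem_tilingSpace hU' _, ?_, ?_, ?_⟩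
  · rw [mem_translate]; simpa using hi
  · rw [mem_translate]; simpa using hj
  · rw [iterate_subst_translate, iterate_subst_translate, h]

/-- Near `z₁` the inflation of `(i, 0)` contains a large supertile. Its tiles also belong to the
inflation of `(j, z₂)`, and shifting this inflation to that of `(j, z₁)` takes them into the same
tiling again. So `λ^M (z₁ - z₂)` is a short local period, hence zero. -/
theorem exists_separation [Fintype ι] [Nonempty ι] (hprim : σ.Primitive)
    (hflc : σ.FiniteLocalComplexity) (haper : σ.Aperiodic) :
    ∃ (ε : ℝ) (M₁ : ℕ), 0 < ε ∧ ∀ M, M₁ ≤ M → ∀ (i j : ι), ∀ z₁ ∈ σ.supp i, ∀ z₂ ∈ σ.supp i,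
      σ.Compatible M i j z₁ → σ.Compatible M i j z₂ → ‖z₁ - z₂‖ < ε → z₁ = z₂ := by
  obtain ⟨R, hR0, hR⟩ := σ.exists_supp_bound
  obtain ⟨ρ, hρ0, hρ⟩ := σ.exists_inradius
  obtain ⟨c, hc0, hc⟩ := σ.exists_fat_radius (half_pos hρ0)
  obtain ⟨m, hm⟩ := exists_no_short_period hprim hflc haper
  obtain ⟨k, hk⟩ := pow_unbounded_of_one_lt (2 * R / c) σ.one_lt_lam
  rw [div_lt_iff₀ hc0] at hk
  -- The bound `ρ / 2` keeps the supertile within the inradius around `z₂`; the other one makes the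
  -- period shorter than `λ^n`.
  refine ⟨min (ρ / 2) (σ.lam ^ (m + k))⁻¹, m + k,
    lt_min (by positivity) (inv_pos.2 (σ.lam_pow_pos _)), ?_⟩
  rintro M hM i j z₁ hz₁ z₂ - ⟨U₁, hU₁, U₁', hU₁', hi₁, hj₁, h₁⟩
    ⟨U₂, hU₂, U₂', hU₂', hi₂, hj₂, h₂⟩ hzz
  obtain ⟨n, rfl⟩ := Nat.exists_eq_add_of_le' hM
  have hzz1 := hzz.trans_le (min_le_left _ _)
  have hzz2 := hzz.trans_le (min_le_right _ _)
  obtain ⟨q, hq, hqz⟩ := hc i z₁ hz₁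
  have hqi : q ∈ σ.tileSupp (i, 0) := by
    rw [mem_tileSupp, sub_zero]
    exact hq (Metric.mem_ball_self hc0)
  obtain ⟨⟨v, y⟩, hv, hqv⟩ := exists_iterate_subst_mem k (Set.mem_singleton _) hqi
  have hball : ∀ p ∈ σ.tileSupp (v, y), (σ.lam ^ k)⁻¹ • p ∈ Metric.ball q c := by
    intro p hp
    have h3 := norm_sub_le_of_mem_tileSupp hR hp
    have h4 := norm_sub_le_of_mem_tileSupp hR hqv
    have hl := σ.lam_pow_pos k
    rw [mem_ball_iff_norm]
    calc ‖(σ.lam ^ k)⁻¹ • p - q‖ = ‖(σ.lam ^ k)⁻¹ • ((p - y) - (σ.lam ^ k • q - y))‖ := by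
          rw [sub_sub_sub_cancel_right, smul_sub, inv_smul_smul₀ hl.ne']
      _ = (σ.lam ^ k)⁻¹ * ‖(p - y) - (σ.lam ^ k • q - y)‖ := by
          rw [norm_smul, norm_inv, Real.norm_of_nonneg hl.le]
      _ < c := by
        rw [inv_mul_lt_iff₀ hl]
        have := norm_sub_le (p - y) (σ.lam ^ k • q - y)
        simp only at h3 h4
        linarith
  have hD := iterate_subst_subset_of_mem hv (n + m)
  rw [add_assoc] at hD
  have hzero := hm (σ.subst^[n + (m + k)] U₁) (iterate_subst_mem_tilingSpace hU₁ _) n v y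
    (σ.lam ^ (n + (m + k)) • (z₁ - z₂))
    (hD.trans (iterate_subst_mono (Set.singleton_subset_iff.2 hi₁) _)) (by
      rw [norm_smul, Real.norm_of_nonneg (σ.lam_pow_pos _).le, pow_add, mul_assoc]
      have hl := σ.lam_pow_pos (m + k)
      have : σ.lam ^ (m + k) * ‖z₁ - z₂‖ ≤ 1 := by
        rw [← le_div_iff₀' hl, one_div]
        exact hzz2.le
      nlinarith [σ.lam_pow_pos n]) (by
    intro t ht
    have hp := tileSupp_of_mem_iterate_subst _ ht (σ.puncture_mem t)
    have hp' := hball _ hp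
    rw [smul_smul, ← mul_inv, ← pow_add, add_comm k, add_assoc] at hp'
    have ht2 : t ∈ σ.subst^[n + (m + k)] {(j, z₂)} := by
      refine (hU₂'.1.iterate_subst _).isPacking.mem_iterate_subst
        (iterate_subst_mono (Set.singleton_subset_iff.2 hj₂) _) ?_ (σ.puncture_mem_interior t) ?_
      · rw [← h₂]
        exact iterate_subst_mono (Set.singleton_subset_iff.2 hi₂) _ (hD ht)
      · have h5 := hqz hp'
        rw [mem_tileSupp]
        refine hρ j ?_
        rw [mem_ball_iff_norm] at h5
        rw [mem_ball_zero_iff]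
        have h6 := norm_add_le ((σ.lam ^ (n + (m + k)))⁻¹ • t.2 - z₁) (z₁ - z₂)
        rw [sub_add_sub_cancel] at h6
        simp only
        linarith
    rw [h₁]
    refine iterate_subst_mono (Set.singleton_subset_iff.2 hj₁) _ ?_
    have h7 := add_mem_iterate_subst (u := z₁ - z₂).2 ht2
    rwa [add_sub_cancel] at h7)
  rcases smul_eq_zero.1 hzero with h | h
  · exact absurd h (σ.lam_pow_ne _)
  · exact sub_eq_zero.1 h

/-- Compatible positions of tiles that touch are finite in number: `z` is a puncture `x'` of the
first tiling, near the origin, plus a displacement inside a prototile, and both range over finite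
sets. Compatibility persists as `M` grows, so one level serves for all. -/
theorem exists_compatible_level [Fintype ι] [Nonempty ι] (hprim : σ.Primitive)
    (hflc : σ.FiniteLocalComplexity) (haper : σ.Aperiodic) :
    ∃ M₀ : ℕ, ∀ M i j z, σ.Compatible M i j z →
      (σ.tileSupp (i, 0) ∩ σ.tileSupp (j, z)).Nonempty → σ.Compatible M₀ i j z := by
  obtain ⟨R, hR0, hR⟩ := σ.exists_supp_bound
  obtain ⟨ε, M₁, hε, hsep⟩ := exists_separation hprim hflc haper
  have hfat : ∀ i j, {z | z ∈ σ.supp i ∧ ∃ M, σ.Compatible M i j z}.Finite := by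
    intro i j
    refine TotallyBounded.finite_of_separated
      ((σ.isCompact_supp i).totallyBounded.subset fun z hz => hz.1) hε ?_
    rintro z₁ ⟨hz₁, M, hM⟩ z₂ ⟨hz₂, N, hN⟩ hd
    rw [dist_eq_norm] at hd
    have hl : M ≤ max M₁ (max M N) := (le_max_left _ _).trans (le_max_right _ _)
    have hr : N ≤ max M₁ (max M N) := (le_max_right _ _).trans (le_max_right _ _)
    exact hsep _ (le_max_left M₁ (max M N)) i j z₁ hz₁ z₂ hz₂ (hM.mono hl) (hN.mono hr) hd
  have hD : (⋃ P ∈ Set.range fun T : σ.Transversal => σ.meeting T.tiling (Metric.ball 0 (2 * R + 1)),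
      P).Finite := by
    refine (hflc _).biUnion ?_
    rintro _ ⟨T, rfl⟩
    exact T.mem_tilingSpace.1.isPacking.finite_meeting _
  have hZ := (hD.image Prod.snd).add
    (Set.finite_iUnion fun i => Set.finite_iUnion fun j => hfat i j)
  let Θ : Set (ι × ι × EuclideanSpace ℝ (Fin d)) := {θ | (∃ M, σ.Compatible M θ.1 θ.2.1 θ.2.2) ∧
    (σ.tileSupp (θ.1, 0) ∩ σ.tileSupp (θ.2.1, θ.2.2)).Nonempty}
  have hΘ : Θ.Finite := by
    refine ((Set.finite_univ (α := ι)).prod ((Set.finite_univ (α := ι)).prod hZ)).subset ?_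
    rintro ⟨i, j, z⟩ ⟨⟨M, U, hU, U', hU', hi, hj, h⟩, p, hp, hp'⟩
    refine ⟨trivial, trivial, ?_⟩
    obtain ⟨⟨i', x'⟩, ha, hz⟩ := hU.1.exists_mem z
    have h1 := norm_sub_le_of_mem_tileSupp hR hp
    have h2 := norm_sub_le_of_mem_tileSupp hR hp'
    simp only [sub_zero] at h1 h2
    have h3 : ‖z‖ < 2 * R + 1 := by
      have := norm_sub_le p (p - z)
      rw [sub_sub_cancel] at this
      linarith
    refine Set.mem_add.2 ⟨x', ⟨(i', x'), ?_, rfl⟩, z - x', ?_, add_sub_cancel _ _⟩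
    · exact Set.mem_biUnion ⟨⟨U, hU, ⟨i, hi⟩⟩, rfl⟩ ⟨ha, z, hz, mem_ball_zero_iff.2 h3⟩
    · exact Set.mem_iUnion.2 ⟨i', Set.mem_iUnion.2 ⟨j, hz, M, Compatible.of_mem hU hU' ha hj h⟩⟩
  have hev : ∀ θ ∈ Θ, ∀ᶠ M in atTop, σ.Compatible M θ.1 θ.2.1 θ.2.2 := by
    rintro θ ⟨⟨M, hM⟩, -⟩
    filter_upwards [eventually_ge_atTop M] with N hN using hM.mono hN
  obtain ⟨M₀, hM₀⟩ := ((eventually_all_finite hΘ).2 hev).exists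
  exact ⟨M₀, fun M i j z h hne => hM₀ (i, j, z) ⟨⟨M, h⟩, hne⟩⟩

/-- Unique composition: the substitution is injective on the tiling space. -/
theorem subst_injOn [Fintype ι] [Nonempty ι] (hprim : σ.Primitive)
    (hflc : σ.FiniteLocalComplexity) (haper : σ.Aperiodic) :
    Set.InjOn σ.subst σ.tilingSpace := by
  obtain ⟨M₀, hM₀⟩ := exists_compatible_level hprim hflc haper
  intro S hS S' hS' h
  -- Descend `M₀` levels: ancestors of overlapping tiles of `S` and `S'` are compatible at level `M₀
  -- + 1`, hence at level `M₀`. Their substitutions then fit into one packing, where overlapping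
  -- tiles coincide.
  obtain ⟨Q, hQ, rfl⟩ := exists_iterate_subst_eq hprim hflc M₀ hS
  obtain ⟨Q', hQ', rfl⟩ := exists_iterate_subst_eq hprim hflc M₀ hS'
  rw [← Function.iterate_succ_apply' σ.subst, ← Function.iterate_succ_apply' σ.subst] at h
  refine hS.1.eq_of_subset hS'.1 fun s hs => ?_
  obtain ⟨s', hs', hp'⟩ := hS'.1.exists_mem s.2
  suffices s = s' by rwa [this]
  obtain ⟨⟨i, x⟩, ha, hsa⟩ := (mem_iterate_subst M₀).1 hs
  obtain ⟨⟨j, y⟩, hb, hsb⟩ := (mem_iterate_subst M₀).1 hs'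
  have h1 := tileSupp_of_mem_iterate_subst M₀ hsa (σ.puncture_mem s)
  have h2 := tileSupp_of_mem_iterate_subst M₀ hsb hp'
  have hne : (σ.tileSupp (i, 0) ∩ σ.tileSupp (j, y - x)).Nonempty := by
    refine ⟨(σ.lam ^ M₀)⁻¹ • s.2 - x, ?_, ?_⟩
    · rw [mem_tileSupp] at h1 ⊢
      simpa using h1
    · rw [mem_tileSupp] at h2 ⊢
      simpa using h2
  obtain ⟨U, hU, U', hU', hiU, hjU', hUU'⟩ :=
    hM₀ _ i j (y - x) (Compatible.of_mem hQ hQ' ha hb h) hne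
  have h3 : (s.1, s.2 - σ.lam ^ M₀ • x) ∈ σ.subst^[M₀] U := by
    have := sub_mem_iterate_subst (u := x).2 hsa
    rw [sub_self] at this
    exact iterate_subst_mono (Set.singleton_subset_iff.2 hiU) _ this
  have h4 : (s'.1, s'.2 - σ.lam ^ M₀ • x) ∈ σ.subst^[M₀] U := by
    rw [hUU']
    exact iterate_subst_mono (Set.singleton_subset_iff.2 hjU') _ (sub_mem_iterate_subst.2 hsb)
  have h5 := (hU.1.iterate_subst M₀).isPacking.eq_of_mem h3 h4 (σ.puncture_mem_interior _) (by
    rw [mem_tileSupp] at hp' ⊢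
    simpa using hp')
  simp only [Prod.mk.injEq, sub_left_inj] at h5
  exact Prod.ext h5.1 h5.2

end TileSubstitution

namespace TileSubstitution

variable {d : ℕ} {ι : Type*} {σ : TileSubstitution d ι}

/-! ### Composition of the tilings of the transversal -/

variable (σ) in
/-- The edges of the Bratteli diagram of the substitution. -/
abbrev Edge : Type _ := Σ i : ι, {t : ι × EuclideanSpace ℝ (Fin d) // t ∈ σ.sub i}

theorem Transversal.ext_tiling {T T' : σ.Transversal} (h : T.tiling = T'.tiling) : T = T' := by
  cases T
  cases T'
  cases h
  rfl

/-- The prototile at the origin of a tiling of the transversal. -/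
def Transversal.label (T : σ.Transversal) : ι := T.puncture.choose

theorem Transversal.label_mem (T : σ.Transversal) :
    (T.label, (0 : EuclideanSpace ℝ (Fin d))) ∈ T.tiling := T.puncture.choose_spec

theorem Transversal.label_eq (T : σ.Transversal) {i : ι}
    (h : (i, (0 : EuclideanSpace ℝ (Fin d))) ∈ T.tiling) : T.label = i :=
  T.mem_tilingSpace.1.isPacking.eq_of_puncture T.label_mem h

/-- `T` is the substitution of `S`, translated so that the tile of `T` at the origin occurs in the
substitution of the tile of `S` at the origin as prescribed by the edge `e`. -/
def IsStep (e : σ.Edge) (S T : σ.Transversal) : Prop :=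
  (e.1, (0 : EuclideanSpace ℝ (Fin d))) ∈ S.tiling ∧
    T.tiling = translate (-e.2.1.2) (σ.subst S.tiling)

theorem mem_subst_singleton_edge (e : σ.Edge) :
    e.2.1 ∈ σ.subst {(e.1, (0 : EuclideanSpace ℝ (Fin d)))} :=
  ⟨_, rfl, _, e.2.2, by simp⟩

namespace IsStep

variable {e : σ.Edge} {S T : σ.Transversal}

theorem label_right (h : IsStep e S T) : T.label = e.2.1.1 := by
  refine T.label_eq ?_
  rw [h.2, mem_translate, zero_sub, neg_neg]
  exact subst_mono (Set.singleton_subset_iff.2 h.1) (mem_subst_singleton_edge e)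

theorem label_left (h : IsStep e S T) : S.label = e.1 := S.label_eq h.1

theorem subst_eq (h : IsStep e S T) : σ.subst S.tiling = translate e.2.1.2 T.tiling := by
  rw [h.2, translate_translate, neg_add_cancel, translate_zero]

end IsStep

/-- The tiling obtained from `S` by a substitution, with the puncture of the tile prescribed by an
edge moved to the origin. -/
theorem exists_isStep (e : σ.Edge) (S : σ.Transversal) (h : S.label = e.1) :
    ∃ T, IsStep e S T := by
  have h0 : (e.1, (0 : EuclideanSpace ℝ (Fin d))) ∈ S.tiling := h ▸ S.label_mem
  refine ⟨⟨translate (-e.2.1.2) (σ.subst S.tiling),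
    translate_mem_tilingSpace (subst_mem_tilingSpace S.mem_tilingSpace) _, e.2.1.1, ?_⟩, h0, rfl⟩
  rw [mem_translate, zero_sub, neg_neg]
  exact subst_mono (Set.singleton_subset_iff.2 h0) (mem_subst_singleton_edge e)

theorem exists_isStep_right [Fintype ι] [Nonempty ι] (hprim : σ.Primitive)
    (hflc : σ.FiniteLocalComplexity) (T : σ.Transversal) : ∃ e S, IsStep e S T := by
  have hl := σ.lam_pos.ne'
  obtain ⟨S, hS, hST⟩ := exists_subst_eq hprim hflc T.mem_tilingSpace
  have hT := T.label_mem
  rw [← hST] at hT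
  obtain ⟨a, ha, q, hq, h⟩ := hT
  have h2 : σ.lam • a.2 = -q.2 := eq_neg_of_add_eq_zero_left (congrArg Prod.snd h).symm
  have h0 : (a.1, (0 : EuclideanSpace ℝ (Fin d))) ∈ translate (-a.2) S := by
    rw [mem_translate]
    simpa using ha
  refine ⟨⟨a.1, q, hq⟩, ⟨translate (-a.2) S, translate_mem_tilingSpace hS _, _, h0⟩, h0, ?_⟩
  rw [subst_translate, hST, translate_translate, smul_neg, h2]
  simp [translate_zero]

/-- Injectivity determines `S` up to a translation by `u`, and `u = 0` because the tile at the
origin has a single parent. -/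
theorem IsStep.unique (hinj : Set.InjOn σ.subst σ.tilingSpace) {e f : σ.Edge}
    {S S' T : σ.Transversal} (h : IsStep e S T) (h' : IsStep f S' T) : e = f ∧ S = S' := by
  have hl := σ.lam_pos.ne'
  set u := σ.lam⁻¹ • (e.2.1.2 - f.2.1.2) with hu
  have hlu : σ.lam • u = e.2.1.2 - f.2.1.2 := smul_inv_smul₀ hl _
  have hS : S.tiling = translate u S'.tiling := by
    refine hinj S.mem_tilingSpace (translate_mem_tilingSpace S'.mem_tilingSpace _) ?_
    rw [subst_translate, hlu, h.subst_eq, h'.subst_eq, translate_translate, add_sub_cancel]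
  have h1 : (f.1, u) ∈ S.tiling := by
    rw [hS, mem_translate]
    simpa using h'.1
  have h2 : e.2.1 ∈ σ.subst {(f.1, u)} := by
    refine ⟨_, rfl, _, f.2.2, Prod.ext ?_ ?_⟩
    · exact h.label_right.symm.trans h'.label_right
    · simp [hlu]
  have h3 := S.mem_tilingSpace.1.isPacking.parent_unique (n := 1) h.1 h1
    (mem_subst_singleton_edge e) h2
  have h4 : u = 0 := (congrArg Prod.snd h3).symm
  have h5 : e.2.1.2 = f.2.1.2 := by rwa [h4, smul_zero, eq_comm, sub_eq_zero] at hlu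
  constructor
  · have h6 : e.1 = f.1 := congrArg Prod.fst h3
    have h7 : e.2.1 = f.2.1 := Prod.ext (h.label_right.symm.trans h'.label_right) h5
    obtain ⟨i, t, ht⟩ := e
    obtain ⟨j, t', ht'⟩ := f
    obtain rfl : i = j := h6
    obtain rfl : t = t' := h7
    rfl
  · refine Transversal.ext_tiling ?_
    rw [hS, h4, translate_zero]

theorem IsStep.agree {e : σ.Edge} {S S' T T' : σ.Transversal} (h : IsStep e S T)
    (h' : IsStep e S' T') {r : ℝ}
    (hag : σ.Agree (σ.lam⁻¹ * (r + ‖e.2.1.2‖)) S.tiling S'.tiling) :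
    σ.Agree r T.tiling T'.tiling := by
  rw [h.2, h'.2]
  refine Agree.translate _ ?_
  have := hag.iterate_subst 1
  rwa [pow_one, mul_inv_cancel_left₀ σ.lam_pos.ne', ← norm_neg] at this

variable (σ) in
/-- Every tiling of the transversal is in a unique way a translate of the substitution of a
tiling of the transversal. -/
def UniqueComposition : Prop :=
  (∀ T : σ.Transversal, ∃ e S, IsStep e S T) ∧ Set.InjOn σ.subst σ.tilingSpace

namespace UniqueComposition

/-- The edge that describes the position of the tile at the origin in its supertile. -/
def edge (h : σ.UniqueComposition) (T : σ.Transversal) : σ.Edge := (h.1 T).choose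

/-- The tiling by the supertiles, rescaled. -/
def shift (h : σ.UniqueComposition) (T : σ.Transversal) : σ.Transversal :=
  (h.1 T).choose_spec.choose

theorem isStep (h : σ.UniqueComposition) (T : σ.Transversal) : IsStep (h.edge T) (h.shift T) T :=
  (h.1 T).choose_spec.choose_spec

theorem edge_eq (h : σ.UniqueComposition) {e : σ.Edge} {S T : σ.Transversal}
    (hs : IsStep e S T) : h.edge T = e := ((h.isStep T).unique h.2 hs).1

theorem shift_eq (h : σ.UniqueComposition) {e : σ.Edge} {S T : σ.Transversal}
    (hs : IsStep e S T) : h.shift T = S := ((h.isStep T).unique h.2 hs).2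

/-- The Robinson map: the path of the sequence of the supertiles of the tile at the origin. -/
def path (h : σ.UniqueComposition) (T : σ.Transversal) :
    StationaryBratteli.InfPath σ.bratteli where
  start := T.label
  edge n := h.edge (h.shift^[n] T)
  src_zero := (h.isStep T).label_right.symm
  tgt_eq_src n := by
    rw [Function.iterate_succ_apply']
    exact (h.isStep _).label_left.symm.trans (h.isStep _).label_right

theorem path_edge (h : σ.UniqueComposition) (T : σ.Transversal) (n : ℕ) :
    (h.path T).edge n = h.edge (h.shift^[n] T) := rfl

/-! ### Local recognizability -/

/-- Otherwise there are tilings with ever larger agreement and different edges. Limits of their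
supertile tilings, substituted again, give one common tiling, whose edge is unique. -/
theorem exists_edge_radius [Finite ι] (h : σ.UniqueComposition)
    (hflc : σ.FiniteLocalComplexity) :
    ∃ R, 0 < R ∧ ∀ T T' : σ.Transversal, σ.Agree R T.tiling T'.tiling → h.edge T = h.edge T' := by
  by_contra hcon
  push Not at hcon
  choose T T' hag hne using fun k : ℕ => hcon (k + 1) (by positivity)
  have hlim : ∀ T : ℕ → σ.Transversal, ∃ T₀ : σ.Transversal,
      (∀ᶠ k in hyperfilter ℕ, h.edge (T k) = h.edge T₀) ∧
      ∀ r, ∀ᶠ k in hyperfilter ℕ, σ.Agree r (T k).tiling T₀.tiling := by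
    intro T
    obtain ⟨S, hS⟩ := exists_transversal_limit hflc (hyperfilter ℕ) fun k => h.shift (T k)
    obtain ⟨e, he⟩ := (hyperfilter ℕ).exists_eventually_eq fun k => h.edge (T k)
    have hl : S.label = e.1 := by
      obtain ⟨k, hk, hk'⟩ := ((hS 1).and he).exists
      refine S.label_eq (hk.mem ?_ (σ.puncture_mem _) (by simp))
      rw [← hk']
      exact (h.isStep (T k)).1
    obtain ⟨T₀, hT₀⟩ := exists_isStep e S hl
    refine ⟨T₀, ?_, fun r => ?_⟩
    · rwa [h.edge_eq hT₀]
    · filter_upwards [he, hS (σ.lam⁻¹ * (r + ‖e.2.1.2‖))] with k hk hk'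
      exact (hk ▸ h.isStep (T k)).agree hT₀ hk'
  obtain ⟨T₀, he, hT₀⟩ := hlim T
  obtain ⟨T₀', he', hT₀'⟩ := hlim T'
  have heq : T₀ = T₀' := by
    refine Transversal.ext_tiling (Agree.eq (σ := σ) fun r => ?_)
    have hev : ∀ᶠ k : ℕ in (hyperfilter ℕ : Filter ℕ), r ≤ (k : ℝ) + 1 := by
      refine (Nat.hyperfilter_le_atTop) ?_
      filter_upwards [eventually_ge_atTop ⌈r⌉₊] with k hk
      have := Nat.ceil_le.1 hk
      linarith
    obtain ⟨k, ⟨h1, h2⟩, h3⟩ := ((hev.and (hT₀ r)).and (hT₀' r)).exists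
    exact h2.symm.trans (((hag k).mono h1).trans h3)
  obtain ⟨k, h1, h2⟩ := (he.and he').exists
  exact hne k (by rw [h1, h2, heq])

/-- The parent of a tile is read off from the patch of fixed radius around that tile, so agreement
descends to the supertiles with an additive loss only. -/
theorem exists_agree_of_subst [Finite ι] (h : σ.UniqueComposition)
    (hflc : σ.FiniteLocalComplexity) :
    ∃ R, 0 < R ∧ ∀ S ∈ σ.tilingSpace, ∀ S' ∈ σ.tilingSpace, ∀ r,
      σ.Agree (σ.lam * r + R) (σ.subst S) (σ.subst S') → σ.Agree r S S' := by
  obtain ⟨R₀, hR₀, hedge⟩ := h.exists_edge_radius hflc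
  obtain ⟨R, hR, hRb⟩ := σ.exists_supp_bound
  have hl := σ.lam_pos
  refine ⟨R₀ + R, by positivity, fun S hS S' hS' r hag =>
    Agree.of_subset hS.1 hS'.1.isPacking ?_⟩
  rintro ⟨i, x⟩ hs p hp hr
  obtain ⟨⟨j, y⟩, ht, hpt⟩ := exists_subst_mem hp
  have hlp : ‖σ.lam • p‖ < σ.lam * r := by
    rw [norm_smul, Real.norm_of_nonneg hl.le]
    exact mul_lt_mul_of_pos_left hr hl
  have htS : (j, y) ∈ σ.subst S := subst_mono (Set.singleton_subset_iff.2 hs) ht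
  have htS' : (j, y) ∈ σ.subst S' := hag.mem htS hpt (by linarith)
  have hy : ‖y‖ ≤ σ.lam * r + R := by
    have h1 := norm_sub_le_of_mem_tileSupp hRb hpt
    calc ‖y‖ = ‖σ.lam • p - (σ.lam • p - y)‖ := by rw [sub_sub_cancel]
      _ ≤ ‖σ.lam • p‖ + ‖σ.lam • p - y‖ := norm_sub_le _ _
      _ ≤ σ.lam * r + R := by linarith
  have hmk : ∀ S ∈ σ.tilingSpace, (j, y) ∈ σ.subst S → ∃ A : σ.Transversal,
      A.tiling = translate (-y) (σ.subst S) := fun S hS h =>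
    ⟨⟨_, translate_mem_tilingSpace (subst_mem_tilingSpace hS) _, j, by
      rw [mem_translate]
      simpa using h⟩, rfl⟩
  obtain ⟨A, hA⟩ := hmk S hS htS
  obtain ⟨A', hA'⟩ := hmk S' hS' htS'
  have hAA' : h.edge A = h.edge A' := by
    refine hedge A A' ?_
    rw [hA, hA']
    refine Agree.translate _ (hag.mono ?_)
    rw [norm_neg]
    linarith
  obtain ⟨_, rfl, q, hq, hjy⟩ := ht
  obtain ⟨rfl, rfl⟩ : j = q.1 ∧ y = σ.lam • x + q.2 := Prod.ext_iff.1 hjy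
  have hstep : IsStep ⟨i, q, hq⟩ ⟨translate (-x) S, translate_mem_tilingSpace hS _, i, by
      rw [mem_translate]; simpa using hs⟩ A := by
    refine ⟨by rw [mem_translate]; simpa using hs, ?_⟩
    rw [hA, subst_translate, translate_translate, smul_neg, neg_add]
  have hA's := h.isStep A'
  rw [← hAA', h.edge_eq hstep] at hA's
  have hS'eq : S' = translate x (h.shift A').tiling := by
    refine h.2 hS' (translate_mem_tilingSpace (h.shift A').mem_tilingSpace _) ?_
    rw [subst_translate, hA's.subst_eq, hA', translate_translate, translate_translate]
    simp only
    rw [add_comm (σ.lam • x), neg_add_cancel, translate_zero]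
  rw [hS'eq, mem_translate]
  simpa using hA's.1

theorem exists_shift_agree [Finite ι] (h : σ.UniqueComposition)
    (hflc : σ.FiniteLocalComplexity) :
    ∃ R, 0 < R ∧ ∀ T T' : σ.Transversal, ∀ r, 0 ≤ r →
      σ.Agree (σ.lam * r + R) T.tiling T'.tiling →
        h.edge T = h.edge T' ∧ σ.Agree r (h.shift T).tiling (h.shift T').tiling := by
  obtain ⟨R₀, hR₀, hedge⟩ := h.exists_edge_radius hflc
  obtain ⟨R₁, hR₁, hag⟩ := h.exists_agree_of_subst hflc
  obtain ⟨M, hM⟩ : ∃ M, ∀ e : σ.Edge, ‖e.2.1.2‖ ≤ M := by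
    obtain ⟨M, hM⟩ := (Set.finite_range fun e : σ.Edge => ‖e.2.1.2‖).bddAbove
    exact ⟨M, fun e => hM ⟨e, rfl⟩⟩
  refine ⟨max R₀ (R₁ + M), lt_max_of_lt_left hR₀, fun T T' r hr hT => ?_⟩
  have hlr : 0 ≤ σ.lam * r := mul_nonneg σ.lam_pos.le hr
  have he : h.edge T = h.edge T' :=
    hedge T T' (hT.mono (by have := le_max_left R₀ (R₁ + M); linarith))
  refine ⟨he, hag _ (h.shift T).mem_tilingSpace _ (h.shift T').mem_tilingSpace _ ?_⟩
  rw [(h.isStep T).subst_eq, (h.isStep T').subst_eq, ← he]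
  refine Agree.translate _ (hT.mono ?_)
  have := le_max_right R₀ (R₁ + M)
  have := hM (h.edge T)
  linarith

theorem exists_radius_edge_eq [Finite ι] (h : σ.UniqueComposition)
    (hflc : σ.FiniteLocalComplexity) :
    ∃ c, 0 < c ∧ ∀ n, ∀ T T' : σ.Transversal, σ.Agree (c * σ.lam ^ n) T.tiling T'.tiling →
      ∀ k ≤ n, (h.path T).edge k = (h.path T').edge k := by
  obtain ⟨R, hR, hstep⟩ := h.exists_shift_agree hflc
  have hl : 0 < σ.lam - 1 := sub_pos.2 σ.one_lt_lam
  -- `-b` is the fixed point of `r ↦ λ r + R`, the radius needed for one step, so the radii `(b + R)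
  -- λ^n - b` satisfy the recursion exactly.
  set b := R / (σ.lam - 1) with hb
  have hb0 : 0 < b := div_pos hR hl
  have hbR : σ.lam * b = b + R := by
    rw [hb]
    field_simp
    ring
  have key : ∀ n, ∀ T T' : σ.Transversal,
      σ.Agree ((b + R) * σ.lam ^ n - b) T.tiling T'.tiling →
      ∀ k ≤ n, (h.path T).edge k = (h.path T').edge k := by
    intro n
    induction n with
    | zero =>
      intro T T' hag k hk
      obtain rfl : k = 0 := by omega
      exact (hstep T T' 0 le_rfl (hag.mono (by simp))).1
    | succ n ih =>
      intro T T' hag k hk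
      have h1 : (1 : ℝ) ≤ σ.lam ^ n := one_le_pow₀ σ.one_lt_lam.le
      have h2 : b + R ≤ (b + R) * σ.lam ^ n := le_mul_of_one_le_right (by positivity) h1
      obtain ⟨he, hs⟩ := hstep T T' ((b + R) * σ.lam ^ n - b) (by linarith) (hag.mono (by
        rw [mul_sub, hbR, pow_succ]
        linarith))
      cases k with
      | zero => exact he
      | succ k => exact ih _ _ hs k (by omega)
  exact ⟨b + R, by positivity, fun n T T' hag => key n T T' (hag.mono (by linarith))⟩

theorem pre_path_eq (h : σ.UniqueComposition) {T T' : σ.Transversal} {n : ℕ}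
    (he : ∀ k ≤ n, (h.path T).edge k = (h.path T').edge k) :
    (h.path T).pre (n + 1) = (h.path T').pre (n + 1) := by
  refine StationaryBratteli.InfPath.pre_succ_eq_iff.2 ⟨?_, fun k hk => he k hk.le⟩
  rw [← (h.path T).src_zero, ← (h.path T').src_zero, he 0 (Nat.zero_le n)]

theorem path_surjective [Fintype ι] [Nonempty ι] (h : σ.UniqueComposition)
    (hprim : σ.Primitive) (hflc : σ.FiniteLocalComplexity) : Function.Surjective h.path := by
  -- A finite stretch of edges is realized by substituting backwards, from the last edge to the
  -- first; a limit of such tilings realizes the infinite path, since each edge is locally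
  -- determined.
  have hfin : ∀ n, ∀ f : ℕ → σ.Edge, (∀ k, (f k).1 = (f (k + 1)).2.1.1) →
      ∃ T : σ.Transversal, T.label = (f 0).2.1.1 ∧ ∀ k < n, (h.path T).edge k = f k := by
    intro n
    induction n with
    | zero =>
      intro f _
      obtain ⟨T, hT, hT0⟩ := exists_tiling_mem hprim (f 0).2.1.1
      exact ⟨⟨T, hT, _, hT0⟩, Transversal.label_eq _ hT0, by simp⟩
    | succ n ih =>
      intro f hf
      obtain ⟨S, hS, hSk⟩ := ih (fun k => f (k + 1)) fun k => hf (k + 1)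
      obtain ⟨T, hT⟩ := exists_isStep (f 0) S (hS.trans (hf 0).symm)
      refine ⟨T, hT.label_right, fun k hk => ?_⟩
      cases k with
      | zero => exact h.edge_eq hT
      | succ k =>
        rw [path_edge, Function.iterate_succ_apply, h.shift_eq hT]
        exact hSk k (by omega)
  intro x
  choose T _ hT using fun n => hfin n x.edge x.tgt_eq_src
  obtain ⟨T₀, hT₀⟩ := exists_transversal_limit hflc (hyperfilter ℕ) T
  obtain ⟨c, hc, hedge⟩ := h.exists_radius_edge_eq hflc
  have he : ∀ n, (h.path T₀).edge n = x.edge n := by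
    intro n
    have hev : ∀ᶠ k : ℕ in (hyperfilter ℕ : Filter ℕ), n < k :=
      Nat.hyperfilter_le_atTop (eventually_gt_atTop n)
    obtain ⟨k, h1, h2⟩ := (hev.and (hT₀ (c * σ.lam ^ n))).exists
    rw [← hedge n _ _ h2 n le_rfl, hT k n h1]
  refine ⟨T₀, StationaryBratteli.InfPath.ext' fun n => ?_⟩
  cases n with
  | zero => rfl
  | succ n =>
    refine StationaryBratteli.InfPath.pre_succ_eq_iff.2 ⟨?_, fun k _ => he k⟩
    rw [← (h.path T₀).src_zero, ← x.src_zero, he 0]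

end UniqueComposition

/-! ### Border forcing -/

/-- The nearby tiles that miss `K` are finite in number, so their union is closed and stays away
from the compact set `K`. -/
theorem exists_collar_radius [Finite ι] (W : Set (ι × EuclideanSpace ℝ (Fin d)))
    (hW : σ.IsTiling W) {K : Set (EuclideanSpace ℝ (Fin d))} (hK : IsCompact K) :
    ∃ ε, 0 < ε ∧ ∀ p ∈ K, ∀ q, ‖q - p‖ < ε → ∃ t ∈ σ.meeting W K, q ∈ σ.tileSupp t := by
  obtain ⟨r, hr0, hr⟩ := hK.isBounded.exists_pos_norm_le
  have hfin := hW.isPacking.finite_meeting (r + 1)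
  let F := σ.meeting W (Metric.ball 0 (r + 1)) \ σ.meeting W K
  have hclosed : IsClosed (⋃ t ∈ F, σ.tileSupp t) := by
    refine (hfin.subset Set.sdiff_subset).isClosed_biUnion fun t _ => ?_
    rw [← closure_interior_tileSupp]
    exact isClosed_closure
  obtain ⟨δ, hδ, hsub⟩ := hK.exists_thickening_subset_open
    (hclosed.isOpen_compl.inter (Metric.isOpen_ball (x := (0 : EuclideanSpace ℝ (Fin d)))
      (ε := r + 1))) (by
    intro p hp
    refine ⟨fun hmem => ?_, ?_⟩
    · obtain ⟨t, ht, hpt⟩ := Set.mem_iUnion₂.1 hmem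
      exact ht.2 ⟨ht.1.1, p, hpt, hp⟩
    · rw [mem_ball_zero_iff]
      have := hr p hp
      linarith)
  refine ⟨δ, hδ, fun p hp q hq => ?_⟩
  obtain ⟨h1, h2⟩ := hsub (Metric.mem_thickening_iff.2 ⟨p, hp, by rwa [dist_eq_norm]⟩)
  obtain ⟨t, ht, hqt⟩ := hW.exists_mem q
  refine ⟨t, ?_, hqt⟩
  by_contra hcon
  exact h1 (Set.mem_biUnion (⟨⟨ht, q, hqt, h2⟩, hcon⟩ : t ∈ F) hqt)

/-- Border forcing in metric form: the tiles that meet the inflated tile cover a neighbourhood of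
it, of width uniform over the prototiles, and this neighbourhood depends on the type only. -/
theorem ForcesBorder.exists_radius [Fintype ι] [Nonempty ι] (hb : σ.ForcesBorder)
    (hprim : σ.Primitive) :
    ∃ (N : ℕ) (ε : ℝ), 0 < ε ∧ ∀ i : ι, ∀ S ∈ σ.tilingSpace, ∀ S' ∈ σ.tilingSpace,
      (i, (0 : EuclideanSpace ℝ (Fin d))) ∈ S → (i, (0 : EuclideanSpace ℝ (Fin d))) ∈ S' →
      ∀ t ∈ σ.subst^[N] S, ∀ q ∈ σ.tileSupp t, ∀ p ∈ σ.supp i, ‖q - σ.lam ^ N • p‖ < ε →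
        t ∈ σ.subst^[N] S' := by
  obtain ⟨N, hN⟩ := hb
  choose U hU hiU using exists_tiling_mem (σ := σ) hprim
  choose ε hε0 hε using fun i => exists_collar_radius (σ.subst^[N] (U i))
    ((hU i).1.iterate_subst N) ((σ.isCompact_supp i).image (continuous_const_smul (σ.lam ^ N)))
  obtain ⟨i₀, hi₀⟩ := Finite.exists_min ε
  refine ⟨N, ε i₀, hε0 i₀, fun i S hS S' hS' hiS hiS' t ht q hq p hp hqp => ?_⟩
  have hopen : IsOpen {q : EuclideanSpace ℝ (Fin d) | ‖q - σ.lam ^ N • p‖ < ε i₀} :=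
    isOpen_lt (by fun_prop) continuous_const
  rw [← closure_interior_tileSupp, mem_closure_iff] at hq
  obtain ⟨q', hq', hq't⟩ := hq _ hopen hqp
  obtain ⟨u, hu, hq'u⟩ := hε i (σ.lam ^ N • p) ⟨p, hp, rfl⟩ q' (lt_of_lt_of_le hq' (hi₀ i))
  have huS := hu
  rw [hN i (U i) (hU i) S hS (hiU i) hiS] at huS
  rw [hN i (U i) (hU i) S' hS' (hiU i) hiS'] at hu
  rw [(hS.1.iterate_subst N).isPacking.eq_of_mem ht huS.1 hq't hq'u]
  exact hu.1

namespace UniqueComposition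

variable (σ) in
/-- The position of the tile at the origin in its supertile of order `n`. -/
def offset (f : ℕ → σ.Edge) : ℕ → EuclideanSpace ℝ (Fin d)
  | 0 => 0
  | n + 1 => offset f n + σ.lam ^ n • (f n).2.1.2

theorem tiling_eq (h : σ.UniqueComposition) (T : σ.Transversal) (n : ℕ) :
    T.tiling = translate (-offset σ (h.path T).edge n)
      (σ.subst^[n] (h.shift^[n] T).tiling) := by
  induction n with
  | zero => simp [offset, translate_zero]
  | succ n ih =>
    have h1 := (h.isStep (h.shift^[n] T)).2
    rw [h1, iterate_subst_translate, translate_translate,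
      ← Function.iterate_succ_apply σ.subst] at ih
    rw [ih, Function.iterate_succ_apply' h.shift, offset, neg_add_rev, smul_neg]
    rfl

theorem offset_congr {f g : ℕ → σ.Edge} {n : ℕ} (h : ∀ k < n, f k = g k) :
    offset σ f n = offset σ g n := by
  induction n with
  | zero => rfl
  | succ n ih => rw [offset, offset, ih fun k hk => h k (by omega), h n (by omega)]

theorem offset_mem (h : σ.UniqueComposition) (T : σ.Transversal) (n : ℕ) :
    (T.label, offset σ (h.path T).edge n) ∈
      σ.subst^[n] {((h.shift^[n] T).label, (0 : EuclideanSpace ℝ (Fin d)))} := by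
  induction n with
  | zero => rfl
  | succ n ih =>
    have h1 := h.isStep (h.shift^[n] T)
    have h2 : (h.edge (h.shift^[n] T)).2.1 ∈
        σ.subst {((h.shift^[n + 1] T).label, (0 : EuclideanSpace ℝ (Fin d)))} := by
      rw [Function.iterate_succ_apply', h1.label_left]
      exact mem_subst_singleton_edge _
    have h3 := iterate_subst_subset_of_mem (k := 1) h2 n
    refine h3 ?_
    have h4 := add_mem_iterate_subst (u := (h.edge (h.shift^[n] T)).2.1.2).2 ih
    rw [zero_add, h1.label_right] at h4
    exact h4

/-- The prefix fixes the type of the supertile of order `N + k` and its position around the origin.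
Border forcing fixes a collar of width `ε` around it at the scale of `k`, and `k` inflations make
this a ball of radius `ε λ^k`, even if the origin is close to the boundary. -/
theorem exists_agree_of_pre_eq [Fintype ι] [Nonempty ι] (h : σ.UniqueComposition)
    (hprim : σ.Primitive) (hb : σ.ForcesBorder) :
    ∃ c, 0 < c ∧ ∀ n, ∀ T T' : σ.Transversal, (h.path T).pre n = (h.path T').pre n →
      σ.Agree (c * σ.lam ^ n - 1) T.tiling T'.tiling := by
  obtain ⟨N, ε, hε, hN⟩ := hb.exists_radius hprim
  have key : ∀ k, ∀ T T' : σ.Transversal,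
      (h.path T).pre (N + k + 1) = (h.path T').pre (N + k + 1) →
      σ.Agree (ε * σ.lam ^ k) T.tiling T'.tiling := by
    intro k T T' hpre
    have hl := σ.lam_pow_pos k
    obtain ⟨hstart, hedge⟩ := StationaryBratteli.InfPath.pre_succ_eq_iff.1 hpre
    rw [add_comm N k] at hedge
    set b := offset σ (h.path T).edge (k + N) with hbdef
    have hb' : offset σ (h.path T').edge (k + N) = b := (offset_congr hedge).symm
    have hlab : (h.shift^[k + N] T).label = (h.shift^[k + N] T').label := by
      rcases Nat.eq_zero_or_pos (k + N) with h0 | h0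
      · rw [h0]
        exact hstart
      · obtain ⟨m, hm⟩ : ∃ m, k + N = m + 1 := ⟨k + N - 1, by omega⟩
        have h1 := hedge m (by omega)
        rw [hm, Function.iterate_succ_apply', Function.iterate_succ_apply',
          (h.isStep _).label_left, (h.isStep _).label_left]
        exact congrArg Sigma.fst h1
    set i := (h.shift^[k + N] T).label with hi
    have hiS := (h.shift^[k + N] T).label_mem
    have hiS' := (h.shift^[k + N] T').label_mem
    rw [← hi] at hiS
    rw [← hlab] at hiS'
    have hoff := tileSupp_of_mem_iterate_subst _ (h.offset_mem T (k + N)) (σ.puncture_mem _)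
    rw [mem_tileSupp, sub_zero] at hoff
    refine Agree.of_subset T.mem_tilingSpace.1 T'.mem_tilingSpace.1.isPacking ?_
    intro t ht p hp hpr
    rw [h.tiling_eq T (k + N), mem_translate, Function.iterate_add_apply, sub_neg_eq_add] at ht
    rw [h.tiling_eq T' (k + N), mem_translate, Function.iterate_add_apply, sub_neg_eq_add, hb']
    obtain ⟨a, ha, hta⟩ := (mem_iterate_subst k).1 ht
    refine (mem_iterate_subst k).2 ⟨a, ?_, hta⟩
    refine hN i _ (h.shift^[k + N] T).mem_tilingSpace _ (h.shift^[k + N] T').mem_tilingSpace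
      hiS hiS' a ha _ (tileSupp_of_mem_iterate_subst k hta ((σ.mem_tileSupp_add).2 hp)) _ hoff ?_
    have h1 : σ.lam ^ N • (σ.lam ^ (k + N))⁻¹ • b = (σ.lam ^ k)⁻¹ • b := by
      rw [smul_smul, pow_add, mul_inv, mul_comm (σ.lam ^ k)⁻¹,
        mul_inv_cancel_left₀ (σ.lam_pow_ne N)]
    change ‖_ - σ.lam ^ N • (σ.lam ^ (k + N))⁻¹ • b‖ < ε
    rw [h1, smul_add, add_sub_cancel_right, norm_smul, norm_inv, Real.norm_of_nonneg hl.le,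
      inv_mul_lt_iff₀ hl, mul_comm]
    exact hpr
  have hl := σ.lam_pow_pos (N + 1)
  -- The constant makes the radius at most `0` for `n ≤ N`, where nothing is known. The `-1` cancels
  -- the `1` in the metric `(1 + r)⁻¹`.
  refine ⟨min ε 1 * (σ.lam ^ (N + 1))⁻¹, by positivity, fun n T T' hpre => ?_⟩
  rcases le_or_gt n N with hn | hn
  · have h1 : min ε 1 * (σ.lam ^ (N + 1))⁻¹ * σ.lam ^ n ≤ 1 := by
      rw [mul_assoc]
      refine mul_le_one₀ (min_le_right _ _)
        (mul_nonneg (inv_nonneg.2 hl.le) (σ.lam_pow_pos n).le) ?_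
      rw [inv_mul_le_iff₀ hl, mul_one]
      exact pow_le_pow_right₀ σ.one_lt_lam.le (by omega)
    have h2 : ∀ p : EuclideanSpace ℝ (Fin d),
        ¬ ‖p‖ < min ε 1 * (σ.lam ^ (N + 1))⁻¹ * σ.lam ^ n - 1 := fun p hp => by
      have := norm_nonneg p
      linarith
    exact Agree.of_forall (fun t _ p _ hp => absurd hp (h2 p)) fun t _ p _ hp => absurd hp (h2 p)
  · obtain ⟨k, rfl⟩ : ∃ k, n = N + k + 1 := ⟨n - N - 1, by omega⟩
    refine (key k T T' hpre).mono ?_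
    have h1 : min ε 1 * (σ.lam ^ (N + 1))⁻¹ * σ.lam ^ (N + k + 1) = min ε 1 * σ.lam ^ k := by
      rw [add_right_comm, pow_add σ.lam (N + 1), mul_assoc, inv_mul_cancel_left₀ hl.ne']
    rw [h1]
    have := mul_le_mul_of_nonneg_right (min_le_left ε 1) (σ.lam_pow_pos k).le
    linarith

theorem _root_.TileSubstitution.dist_le_of_agree {T T' : σ.Transversal} {r : ℝ} (hr : 0 ≤ r)
    (h : σ.Agree r T.tiling T'.tiling) : dist T T' ≤ (1 + r)⁻¹ :=
  csInf_le (σ.transversalDist_bddBelow T T') ⟨r, hr, rfl, h⟩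

theorem _root_.TileSubstitution.le_dist_of_not_agree {T T' : σ.Transversal} {r : ℝ}
    (h : ¬ σ.Agree r T.tiling T'.tiling) : (1 + r)⁻¹ ≤ dist T T' := by
  refine le_csInf (σ.transversalDist_nonempty T T') ?_
  rintro _ ⟨r', hr', rfl, hag⟩
  refine inv_anti₀ (by linarith) ?_
  by_contra hlt
  exact h (Agree.mono (σ := σ) hag (by linarith))

theorem exists_dist_le [Fintype ι] [Nonempty ι] (h : σ.UniqueComposition)
    (hprim : σ.Primitive) (hb : σ.ForcesBorder) :
    ∃ C, 0 < C ∧ ∀ n, ∀ T T' : σ.Transversal, (h.path T).pre n = (h.path T').pre n →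
      dist T T' ≤ C * σ.lam⁻¹ ^ n := by
  obtain ⟨c, hc, hag⟩ := h.exists_agree_of_pre_eq hprim hb
  refine ⟨c⁻¹, inv_pos.2 hc, fun n T T' hpre => ?_⟩
  have hl := σ.lam_pow_pos n
  rw [inv_pow, ← mul_inv]
  rcases le_total 0 (c * σ.lam ^ n - 1) with h0 | h0
  · refine (dist_le_of_agree h0 (hag n T T' hpre)).trans_eq ?_
    rw [add_sub_cancel]
  · refine (dist_le_of_agree le_rfl (Agree.of_forall (fun t _ p _ hp => absurd hp (norm_nonneg p).not_gt) fun t _ p _ hp =>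
      absurd hp (norm_nonneg p).not_gt)).trans ?_
    rw [add_zero, inv_one]
    exact (one_le_inv₀ (by positivity)).2 (by linarith)

theorem exists_le_dist [Finite ι] (h : σ.UniqueComposition) (hflc : σ.FiniteLocalComplexity) :
    ∃ c, 0 < c ∧ ∀ n, ∀ T T' : σ.Transversal, (h.path T).pre (n + 1) ≠ (h.path T').pre (n + 1) →
      c * σ.lam⁻¹ ^ n ≤ dist T T' := by
  obtain ⟨c, hc, hedge⟩ := h.exists_radius_edge_eq hflc
  refine ⟨(1 + c)⁻¹, by positivity, fun n T T' hpre => ?_⟩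
  have hl := σ.lam_pow_pos n
  have hl1 : 1 ≤ σ.lam ^ n := one_le_pow₀ σ.one_lt_lam.le
  refine le_trans ?_ (le_dist_of_not_agree (r := c * σ.lam ^ n) fun hag =>
    hpre (h.pre_path_eq (hedge n T T' hag)))
  rw [inv_pow, ← mul_inv, add_mul, one_mul]
  exact inv_anti₀ (by positivity) (by linarith)

theorem path_injective [Fintype ι] [Nonempty ι] (h : σ.UniqueComposition)
    (hprim : σ.Primitive) (hb : σ.ForcesBorder) : Function.Injective h.path := by
  intro T T' heq
  obtain ⟨C, hC, hdist⟩ := h.exists_dist_le hprim hb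
  have hlim : Tendsto (fun n : ℕ => C * σ.lam⁻¹ ^ n) atTop (𝓝 (C * 0)) :=
    (tendsto_pow_atTop_nhds_zero_of_lt_one (inv_nonneg.2 σ.lam_pos.le)
      (inv_lt_one_of_one_lt₀ σ.one_lt_lam)).const_mul C
  rw [mul_zero] at hlim
  exact dist_le_zero.1 (ge_of_tendsto' hlim fun n => hdist n T T' (by rw [heq]))

end UniqueComposition

end TileSubstitution

/-! ### The Perron-Frobenius theorem for primitive matrices -/

namespace StationaryBratteli

theorem mulVec_pos {n : Type*} [Fintype n] {P : Matrix n n ℝ} (hP : ∀ i j, 0 < P i j)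
    {y : n → ℝ} (hy : ∀ i, 0 ≤ y i) (hy0 : y ≠ 0) (i : n) : 0 < (P *ᵥ y) i := by
  obtain ⟨j, hj⟩ := Function.ne_iff.1 hy0
  exact Finset.sum_pos' (fun k _ => mul_nonneg (hP i k).le (hy k))
    ⟨j, Finset.mem_univ j, mul_pos (hP i j) ((hy j).lt_of_ne' hj)⟩

/-- Collatz–Wielandt: maximize `c` over the pairs with `c x ≤ A x`, `x` in the simplex. At a maximum
equality holds, since otherwise applying the positive matrix `A^k` makes the inequality strict
everywhere and `c` could grow. -/
theorem exists_isPerronFrobenius {n : Type*} [Fintype n] [DecidableEq n] [Nonempty n]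
    {A : Matrix n n ℝ} (hA : A.IsPrimitive) :
    ∃ p : ℝ × (n → ℝ), IsPerronFrobenius A p.1 p.2 := by
  obtain ⟨k, -, hk⟩ := hA.exists_pos_pow
  set M := ∑ i, ∑ j, A i j with hM
  let K : Set (ℝ × (n → ℝ)) :=
    (Set.Icc 0 M ×ˢ stdSimplex ℝ n) ∩ {p | ∀ v, p.1 * p.2 v ≤ (A *ᵥ p.2) v}
  have hle : ∀ c : ℝ, ∀ x ∈ stdSimplex ℝ n, (∀ v, c * x v ≤ (A *ᵥ x) v) → c ≤ M := by
    intro c x hx hc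
    have hx1 : ∀ v, x v ≤ 1 := fun v =>
      hx.2 ▸ Finset.single_le_sum (fun i _ => hx.1 i) (Finset.mem_univ v)
    calc c = ∑ v, c * x v := by rw [← Finset.mul_sum, hx.2, mul_one]
      _ ≤ ∑ v, (A *ᵥ x) v := Finset.sum_le_sum fun v _ => hc v
      _ ≤ M := Finset.sum_le_sum fun i _ => Finset.sum_le_sum fun j _ =>
        mul_le_of_le_one_right (hA.nonneg i j) (hx1 j)
  have hcont : Continuous fun p : ℝ × (n → ℝ) => A *ᵥ p.2 :=
    continuous_const.matrix_mulVec continuous_snd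
  have hKc : IsCompact K := by
    refine (isCompact_Icc.prod (isCompact_stdSimplex ℝ n)).inter_right ?_
    simp only [Set.ofPred_forall]
    exact isClosed_iInter fun v => isClosed_le
      (continuous_fst.mul ((continuous_apply v).comp continuous_snd))
      ((continuous_apply v).comp hcont)
  have hKne : K.Nonempty := by
    obtain ⟨i⟩ := ‹Nonempty n›
    have hi := single_mem_stdSimplex ℝ i
    refine ⟨(0, Pi.single i 1), ⟨⟨le_rfl, ?_⟩, hi⟩, fun v => ?_⟩
    · exact Finset.sum_nonneg fun i _ => Finset.sum_nonneg fun j _ => hA.nonneg i j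
    · rw [zero_mul]
      exact Finset.sum_nonneg fun j _ => mul_nonneg (hA.nonneg v j) (hi.1 j)
  obtain ⟨⟨c, x⟩, ⟨⟨hc0, hx⟩, hcx⟩, hmax⟩ := hKc.exists_isMaxOn hKne continuous_fst.continuousOn
  have hx0 : x ≠ 0 := by
    rintro rfl
    simpa using hx.2
  have hy := mulVec_pos hk hx.1 hx0
  have heq : A *ᵥ x = c • x := by
    by_contra hne
    have hz : A *ᵥ x - c • x ≠ 0 := sub_ne_zero.2 hne
    have hpos := mulVec_pos hk (y := A *ᵥ x - c • x) (fun i => sub_nonneg.2 (hcx i)) hz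
    set y := A ^ k *ᵥ x with hydef
    have hAy : A ^ k *ᵥ (A *ᵥ x - c • x) = A *ᵥ y - c • y := by
      rw [Matrix.mulVec_sub, Matrix.mulVec_smul, hydef, Matrix.mulVec_mulVec,
        Matrix.mulVec_mulVec, ← pow_succ, ← pow_succ']
    rw [hAy] at hpos
    obtain ⟨v₀, hv₀⟩ := Finite.exists_min fun v => (A *ᵥ y) v / y v
    have hc' : c < (A *ᵥ y) v₀ / y v₀ := by
      rw [lt_div_iff₀ (hy v₀)]
      exact sub_pos.1 (hpos v₀)
    have hs : 0 < ∑ v, y v := Finset.sum_pos (fun v _ => hy v) Finset.univ_nonempty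
    have hx' : (∑ v, y v)⁻¹ • y ∈ stdSimplex ℝ n := by
      refine ⟨fun v => mul_nonneg (inv_nonneg.2 hs.le) (hy v).le, ?_⟩
      simp only [Pi.smul_apply, smul_eq_mul]
      rw [← Finset.mul_sum, inv_mul_cancel₀ hs.ne']
    have hcx' : ∀ v, (A *ᵥ y) v₀ / y v₀ * ((∑ v, y v)⁻¹ • y) v ≤
        (A *ᵥ ((∑ v, y v)⁻¹ • y)) v := by
      intro v
      rw [Matrix.mulVec_smul, Pi.smul_apply, Pi.smul_apply, smul_eq_mul, smul_eq_mul,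
        mul_left_comm]
      exact mul_le_mul_of_nonneg_left ((le_div_iff₀ (hy v)).1 (hv₀ v)) (inv_nonneg.2 hs.le)
    exact (hmax (a := ((A *ᵥ y) v₀ / y v₀, (∑ v, y v)⁻¹ • y))
      ⟨⟨⟨hc0.1.trans hc'.le, hle _ _ hx' hcx'⟩, hx'⟩, hcx'⟩).not_gt hc'
  refine ⟨(c, x), fun v => ?_, hx.2, heq⟩
  -- `A^k x = c^k x` has positive entries, and hence so does `x`.
  have hpow : ∀ m, A ^ m *ᵥ x = c ^ m • x := by
    intro m
    induction m with
    | zero => simp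
    | succ m ih => rw [pow_succ', ← Matrix.mulVec_mulVec, ih, Matrix.mulVec_smul, heq, smul_smul,
        pow_succ]
  have := hy v
  rw [hpow] at this
  exact pos_of_mul_pos_right this (pow_nonneg hc0.1 k)

variable {V E : Type*} {B : StationaryBratteli V E}

theorem isPerronFrobenius_pf [Fintype V] [DecidableEq V] [Nonempty V]
    (hA : B.adjacency.IsPrimitive) :
    IsPerronFrobenius B.adjacency B.pfEigenvalue B.pfVector := by
  have h := exists_isPerronFrobenius hA
  rw [pfEigenvalue, pfVector, pfPair, dif_pos h]
  exact h.choose_spec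

/-- The positive entries of `A^k` are integers, so at least `1`, and `Λ^k ν_v ≥ ∑ ν = 1`. With two
vertices `ν_v < 1`, whence `Λ > 1`. -/
theorem PFData.of_isPrimitive [Fintype V] [DecidableEq V] [Nontrivial V]
    (hA : B.adjacency.IsPrimitive) : B.PFData := by
  have hspec := isPerronFrobenius_pf hA
  refine ⟨hspec, ?_⟩
  obtain ⟨hpos, hsum, heig⟩ := hspec
  obtain ⟨k, -, hk⟩ := hA.exists_pos_pow
  let N : Matrix V V ℕ := fun v v' => Nat.card {e : E // B.src e = v ∧ B.tgt e = v'}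
  have hN : B.adjacency = N.map (Nat.castRingHom ℝ) := rfl
  have hone : ∀ i j, 1 ≤ (B.adjacency ^ k) i j := by
    intro i j
    have h1 : (B.adjacency ^ k) i j = ((N ^ k) i j : ℕ) := by
      rw [hN, ← Matrix.map_pow]
      rfl
    have h2 := hk i j
    rw [h1] at h2 ⊢
    exact_mod_cast h2
  have hpow : ∀ m, B.adjacency ^ m *ᵥ B.pfVector = B.pfEigenvalue ^ m • B.pfVector := by
    intro m
    induction m with
    | zero => simp
    | succ m ih => rw [pow_succ', ← Matrix.mulVec_mulVec, ih, Matrix.mulVec_smul, heig, smul_smul,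
        pow_succ]
  obtain ⟨v, w, hvw⟩ := exists_pair_ne V
  have hlt : B.pfVector v < 1 := by
    rw [← hsum]
    exact Finset.single_lt_sum hvw.symm (Finset.mem_univ v) (Finset.mem_univ w) (hpos w)
      fun i _ _ => (hpos i).le
  have hge : 1 ≤ B.pfEigenvalue ^ k * B.pfVector v := by
    have h1 := congrFun (hpow k) v
    rw [Pi.smul_apply, smul_eq_mul] at h1
    rw [← h1, ← hsum]
    exact Finset.sum_le_sum fun i _ => le_mul_of_one_le_left (hpos i).le (hone v i)
  have hnonneg : 0 ≤ B.pfEigenvalue := by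
    have h1 := congrFun heig v
    rw [Pi.smul_apply, smul_eq_mul] at h1
    refine nonneg_of_mul_nonneg_left (b := B.pfVector v) ?_ (hpos v)
    rw [← h1]
    exact Finset.sum_nonneg fun i _ => mul_nonneg (hA.nonneg v i) (hpos i).le
  by_contra hle
  have h1 : B.pfEigenvalue ^ k ≤ 1 := pow_le_one₀ hnonneg (not_lt.1 hle)
  have h2 := mul_le_mul_of_nonneg_right h1 (hpos v).le
  linarith

end StationaryBratteli

/-- A map with two-sided Hölder bounds is a bi-Hölder homeomorphism onto its range. -/
theorem exists_isBiHolder {X : Type*} [MetricSpace X] (f : X → ℝ) {θ c C : ℝ} (hθ : 0 < θ)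
    (hc : 0 < c) (hC : 0 < C) (hle : ∀ x y, c * dist x y ^ θ ≤ dist (f x) (f y))
    (hge : ∀ x y, dist (f x) (f y) ≤ C * dist x y ^ θ) {S : Set ℝ} (hS : Set.range f = S) :
    ∃ φ : X ≃ₜ S, IsBiHolder φ := by
  subst hS
  have hinj : Function.Injective f := by
    intro x y hxy
    have h := hle x y
    rw [hxy, dist_self] at h
    have h1 : dist x y ^ θ = 0 :=
      le_antisymm (nonpos_of_mul_nonpos_right h hc) (Real.rpow_nonneg dist_nonneg θ)
    exact dist_eq_zero.1 ((Real.rpow_eq_zero dist_nonneg hθ.ne').1 h1)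
  have hcont : Continuous f := by
    rw [continuous_iff_continuousAt]
    intro x
    rw [ContinuousAt, tendsto_iff_dist_tendsto_zero]
    have h : Continuous fun y => C * dist y x ^ θ :=
      continuous_const.mul ((continuous_id.dist continuous_const).rpow_const fun _ => Or.inr hθ.le)
    have h0 := h.tendsto x
    rw [dist_self, Real.zero_rpow hθ.ne', mul_zero] at h0
    exact squeeze_zero (fun _ => dist_nonneg) (fun y => hge y x) h0
  let e := Equiv.ofInjective f hinj
  have hinv : Continuous e.symm := by
    rw [continuous_iff_continuousAt]
    intro y
    rw [ContinuousAt, tendsto_iff_dist_tendsto_zero]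
    have h : Continuous fun z => (c⁻¹ * dist z y) ^ θ⁻¹ :=
      (continuous_const.mul (continuous_id.dist continuous_const)).rpow_const
        fun _ => Or.inr (inv_pos.2 hθ).le
    have h0 := h.tendsto y
    rw [dist_self, mul_zero, Real.zero_rpow (inv_pos.2 hθ).ne'] at h0
    refine squeeze_zero (fun _ => dist_nonneg) (fun z => ?_) h0
    have h1 := hle (e.symm z) (e.symm y)
    have h2 : ∀ z, f (e.symm z) = z := fun z => congrArg Subtype.val (e.apply_symm_apply z)
    rw [h2, h2, ← Subtype.dist_eq, ← le_inv_mul_iff₀ hc] at h1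
    exact (Real.le_rpow_inv_iff_of_pos dist_nonneg
      (mul_nonneg (inv_pos.2 hc).le dist_nonneg) hθ).2 h1
  exact ⟨⟨e, hcont.subtype_mk _, hinv⟩, θ, c, C, hθ, hc, hC, fun x y => ⟨hle x y, hge x y⟩⟩

/-! ### Existence of two prototiles -/

namespace TileSubstitution

variable {d : ℕ} {ι : Type*} {σ : TileSubstitution d ι}

-- With a single prototile, simple edges leave a single tile in its substitution. Its inflation
-- would then be a translate of it, which the diameter forbids.
open scoped Pointwise in
theorem nontrivial_of_simpleEdges [Nonempty ι] (hd : 0 < d) (hs : σ.bratteli.SimpleEdges) :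
    Nontrivial ι := by
  by_contra hι
  rw [not_nontrivial_iff_subsingleton] at hι
  obtain ⟨i⟩ := ‹Nonempty ι›
  have h0 := interior_subset (σ.zero_mem_interior i)
  obtain ⟨t, ht, -⟩ := Set.mem_iUnion₂.1 ((σ.sub_cover i).symm.subset ⟨0, h0, rfl⟩)
  have huniq : ∀ t' ∈ σ.sub i, t' = t := fun t' ht' =>
    congrArg (fun e : σ.Edge => e.2.1)
      (hs ⟨i, t', ht'⟩ ⟨i, t, ht⟩ (Subsingleton.elim _ _) (Subsingleton.elim _ _))
  have hcov : σ.tileSupp (i, t.2) = σ.lam • σ.supp i := by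
    have h1 := σ.sub_cover i
    rw [show ((σ.lam • σ.supp i : Set _)) = (fun p => σ.lam • p) '' σ.supp i from rfl, ← h1]
    ext p
    simp only [Set.mem_iUnion, exists_prop]
    constructor
    · intro hp
      refine ⟨t, ht, ?_⟩
      rwa [Set.mem_ofPred_eq, Subsingleton.elim t.1 i]
    · rintro ⟨t', ht', hp⟩
      rw [huniq t' ht', Set.mem_ofPred_eq, Subsingleton.elim t.1 i] at hp
      exact hp
  have hdiam : Metric.diam (σ.tileSupp (i, t.2)) = Metric.diam (σ.supp i) := by
    have h1 : (IsometryEquiv.addRight t.2) '' σ.supp i = σ.tileSupp (i, t.2) := by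
      ext p
      simp [mem_tileSupp, sub_eq_add_neg]
    rw [← h1, IsometryEquiv.diam_image]
  rw [hcov, diam_smul₀, Real.norm_of_nonneg σ.lam_pos.le] at hdiam
  have : Nonempty (Fin d) := ⟨⟨0, hd⟩⟩
  have hpos : 0 < Metric.diam (σ.supp i) := by
    refine Metric.diam_pos ?_ (σ.isCompact_supp i).isBounded
    by_contra hnt
    have h1 := (Set.not_nontrivial_iff.1 hnt).anti (interior_subset)
    have h2 := h1.eq_singleton_of_mem (σ.zero_mem_interior i)
    have h3 := isOpen_interior (s := σ.supp i)
    rw [h2] at h3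
    exact not_isOpen_singleton _ h3
  have := mul_lt_mul_of_pos_right σ.one_lt_lam hpos
  linarith

end TileSubstitution

end

/-! ### The bi-Hölder homeomorphism -/

theorem mainTheorem8 {d : ℕ} (hd : 0 < d) {ι : Type*} [Fintype ι] [Nonempty ι]
    (σ : TileSubstitution d ι) (hprim : σ.Primitive) (hflc : σ.FiniteLocalComplexity)
    (haper : σ.Aperiodic) (hborder : σ.ForcesBorder)
    (hsimple : σ.bratteli.SimpleEdges)
    (hdistinct : Function.Injective σ.bratteli.pfVector) :
    ∃ s₁ : ℝ, ∀ s : ℝ, s₁ < s →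
      ∃ φ : σ.Transversal ≃ₜ σ.bratteli.omegaSpectrum d s, IsBiHolder φ := by
  classical
  have := TileSubstitution.nontrivial_of_simpleEdges hd hsimple
  have hB : σ.bratteli.PFData := StationaryBratteli.PFData.of_isPrimitive (by
    rw [TileSubstitution.Primitive] at hprim
    convert hprim)
  have huc : σ.UniqueComposition :=
    ⟨TileSubstitution.exists_isStep_right hprim hflc,
      TileSubstitution.subst_injOn hprim hflc haper⟩
  have hd' : (0 : ℝ) < d := Nat.cast_pos.2 hd
  obtain ⟨a₀, ha₀, hbounds⟩ := hB.exists_limitEigenval_bounds hd hsimple hdistinct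
  obtain ⟨C₁, hC₁, hup⟩ := huc.exists_dist_le hprim hborder
  obtain ⟨c₁, hc₁, hlow⟩ := huc.exists_le_dist hflc
  refine ⟨d * (a₀ + 1) + 2, fun s hs => ?_⟩
  obtain ⟨a, rfl⟩ : ∃ a : ℝ, s = d * (a + 1) + 2 := ⟨(s - 2) / d - 1, by
    rw [sub_add_cancel, mul_div_cancel₀ _ hd'.ne', sub_add_cancel]⟩
  have ha : a₀ < a := by
    have h1 : (d : ℝ) * (a₀ + 1) < d * (a + 1) := by linarith
    linarith [lt_of_mul_lt_mul_left h1 hd'.le]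
  obtain ⟨c, C, hc, hC, hcC⟩ := hbounds a ha
  set q := σ.bratteli.pfEigenvalue ^ (-a) with hq
  have hlogL := Real.log_pos hB.one_lt
  have hlogl := Real.log_pos σ.one_lt_lam
  -- The exponent with `λ^(-θ) = Λ^(-a)`: it takes the scale of the tilings at depth `n` to that of
  -- the spectrum.
  set θ := a * Real.log σ.bratteli.pfEigenvalue / Real.log σ.lam with hθdef
  have hθ : 0 < θ := div_pos (mul_pos (ha₀.trans ha) hlogL) hlogl
  have hl0 : 0 < σ.lam⁻¹ := inv_pos.2 σ.lam_pos
  have hqθ : ∀ n : ℕ, (σ.lam⁻¹ ^ n) ^ θ = q ^ n := by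
    intro n
    have h1 : σ.lam⁻¹ ^ θ = q := by
      rw [hq, Real.rpow_def_of_pos hl0, Real.rpow_def_of_pos hB.eig_pos, Real.log_inv, hθdef]
      congr 1
      field_simp
    rw [← Real.rpow_natCast, ← Real.rpow_mul hl0.le, mul_comm, Real.rpow_mul hl0.le, h1,
      Real.rpow_natCast]
  have hsurj := huc.path_surjective hprim hflc
  have hinj := huc.path_injective hprim hborder
  have key : ∀ D, 0 < D → ∀ n : ℕ, (D * σ.lam⁻¹ ^ n) ^ θ = D ^ θ * q ^ n := fun D hD n => by
    rw [Real.mul_rpow hD.le (pow_pos hl0 n).le, hqθ]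
  refine exists_isBiHolder
    (fun T => σ.bratteli.limitEigenval d (d * (a + 1) + 2) (huc.path T)) hθ
    (c := c * (C₁ ^ θ)⁻¹) (C := C * (c₁ ^ θ)⁻¹) (by positivity) (by positivity) ?_ ?_ ?_
  · intro T T'
    rcases eq_or_ne T T' with rfl | hne
    · simp [Real.zero_rpow hθ.ne']
    obtain ⟨n, hn, hn'⟩ := StationaryBratteli.InfPath.exists_split (hinj.ne hne)
    refine le_trans ?_ (hcC _ _ n hn hn').1
    rw [mul_assoc]
    refine mul_le_mul_of_nonneg_left ?_ hc.le
    rw [inv_mul_le_iff₀ (Real.rpow_pos_of_pos hC₁ θ), ← key C₁ hC₁]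
    exact Real.rpow_le_rpow dist_nonneg (hup n T T' hn) hθ.le
  · intro T T'
    rcases eq_or_ne T T' with rfl | hne
    · simp [Real.zero_rpow hθ.ne']
    obtain ⟨n, hn, hn'⟩ := StationaryBratteli.InfPath.exists_split (hinj.ne hne)
    refine (hcC _ _ n hn hn').2.trans ?_
    rw [mul_assoc]
    refine mul_le_mul_of_nonneg_left ?_ hC.le
    rw [le_inv_mul_iff₀ (Real.rpow_pos_of_pos hc₁ θ), ← key c₁ hc₁]
    exact Real.rpow_le_rpow (mul_nonneg hc₁.le (pow_pos hl0 n).le) (hlow n T T' hn') hθ.le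
  · rw [← hB.range_limitEigenval hd (ha₀.trans ha) fun z y n h h' => (hcC z y n h h').2]
    exact hsurj.range_comp (σ.bratteli.limitEigenval d (d * (a + 1) + 2))
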